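/- **Theorem 2.7.** Let $p$ be a prime, let $\zeta$ be a primitive $p$-th root of unity, $\mathbb{Z}_p(\zeta)=\mathbb{Z}_p[\zeta]$, let $G$ be a finite $p$-group and let $N$ be a central subgroup of $G$ of order $p$. Let $U$ be a second countable profinite $\mathbb{Z}_pG$-lattice, that is, a second countable profinite $\mathbb{Z}_pG$-module that is free as a profinite $\mathbb{Z}_p$-module. Write $U^N$ for the $\mathbb{Z}_p[G/N]$-module of $N$-fixed points of $U$. Fix an isomorphism $\psi:N\to\langle\zeta\rangle$; since $\sum_{n\in N}n$ annihilates $U/U^N$, the latter is a $\mathbb{Z}_p(\zeta)G$-module on which $\zeta$ acts as $\psi^{-1}(\zeta)\in N$. Suppose that 1. the restriction of $U$ to $N$ is a free profinite $\mathbb{Z}_pN$-module, 2. $U^N$ is a profinite permutation $\mathbb{Z}_p[G/N]$-lattice, 3. $U/U^N$ is a profinite generalized permutation $\mathbb{Z}_p(\zeta)G$-lattice. Then $U$ is a profinite permutation $\mathbb{Z}_pG$-lattice. Here a *profinite permutation* $\mathbb{Z}_pG$-*lattice* is a profinite $\mathbb{Z}_pG$-module that has a profinite $\mathbb{Z}_p$-basis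 left invariant by $G$, a profinite $\mathbb{Z}_p$-basis being a closed subset $X$ such that the module is the free profinite $\mathbb{Z}_p$-module on the profinite space $X$. A *finitely generated generalized permutation* $\mathbb{Z}_p(\zeta)G$-*lattice* is a finite direct sum of modules induced to $G$ from rank one $\mathbb{Z}_p(\zeta)H$-lattices, $H\le G$, on which $H$ acts through a homomorphism $H\to\langle\zeta\rangle$; a *profinite generalized permutation* $\mathbb{Z}_p(\zeta)G$-*lattice* is an inverse limit of finitely generated ones. -/

import Mathlib

open Polynomial

universe u v w

namespace ProfiniteLattice

/-- A profinite module over a topological ring: a compact, Hausdorff, totally disconnected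
topological module. -/
structure IsProfiniteModule (R : Type*) [CommRing R] [TopologicalSpace R]
    (M : Type*) [AddCommGroup M] [Module R M] [TopologicalSpace M] : Prop where
  isTopologicalAddGroup : IsTopologicalAddGroup M
  continuousSMul : ContinuousSMul R M
  compactSpace : CompactSpace M
  t2Space : T2Space M
  totallyDisconnectedSpace : TotallyDisconnectedSpace M

section Lattices

variable {p : ℕ} [Fact p.Prime] {G : Type v} [Group G]
  {M : Type u} [AddCommGroup M] [Module ℤ_[p] M] [TopologicalSpace M]

/-- A profinite `ℤ_p`-module with a continuous linear action of `G`. For a finite (discrete)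
group `G` this is the same thing as a profinite `ℤ_p G`-module. -/
structure IsProfiniteRep (ρ : Representation ℤ_[p] G M) : Prop where
  isProfiniteModule : IsProfiniteModule ℤ_[p] M
  continuous (g : G) : Continuous (ρ g)

variable (p) in
/-- `X` is a profinite `ℤ_p`-basis of `M`: it is a closed subset, and `M` is the free profinite
`ℤ_p`-module on the profinite space `X`, i.e. each continuous map from `X` to a
profinite `ℤ_p`-module extends uniquely to a continuous `ℤ_p`-linear map on `M`. -/
def IsProfiniteBasis (X : Set M) : Prop :=
  IsClosed X ∧
  ∀ (L : Type u) [AddCommGroup L] [Module ℤ_[p] L] [TopologicalSpace L],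
    IsProfiniteModule ℤ_[p] L → ∀ f : X → L, Continuous f →
      ∃! φ : M →L[ℤ_[p]] L, ∀ x : X, φ (x : M) = f x

/-- A profinite `ℤ_p G`-lattice: a profinite `ℤ_p G`-module that is free as a profinite
`ℤ_p`-module. -/
def IsLattice (ρ : Representation ℤ_[p] G M) : Prop :=
  IsProfiniteRep ρ ∧ ∃ X : Set M, IsProfiniteBasis p X

/-- A profinite permutation `ℤ_p G`-lattice: a profinite `ℤ_p G`-module with a profinite
`ℤ_p`-basis left invariant by `G`. -/
def IsPermutationLattice (ρ : Representation ℤ_[p] G M) : Prop :=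
  IsProfiniteRep ρ ∧
    ∃ X : Set M, IsProfiniteBasis p X ∧ ∀ g : G, ∀ x ∈ X, ρ g x ∈ X

/-- A free profinite `ℤ_p G`-module (`G` finite): there is a closed subset `X` such that each
continuous map from `X` to a profinite `ℤ_p G`-module extends uniquely to a continuous
`ℤ_p G`-linear map. -/
def IsFree (ρ : Representation ℤ_[p] G M) : Prop :=
  IsProfiniteRep ρ ∧
  ∃ X : Set M, IsClosed X ∧
    ∀ (L : Type u) [AddCommGroup L] [Module ℤ_[p] L] [TopologicalSpace L]
      (σ : Representation ℤ_[p] G L), IsProfiniteRep σ →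
      ∀ f : X → L, Continuous f →
        ∃! φ : M →L[ℤ_[p]] L,
          (∀ (g : G) (m : M), φ (ρ g m) = σ g (φ m)) ∧ ∀ x : X, φ (x : M) = f x

end Lattices

section Zeta

variable (p : ℕ) [Fact p.Prime]

/-- The ring `ℤ_p(ζ) = ℤ_p[X] / (Φ_p)`, with `ζ` a primitive `p`-th root of unity (the
polynomial `Φ_p` being irreducible over `ℚ_p`). -/
abbrev ZpZeta : Type := AdjoinRoot (cyclotomic p ℤ_[p])

/-- The `p`-adic topology on `ℤ_p(ζ)`: its topology as a finite free `ℤ_p`-module. -/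
noncomputable instance : TopologicalSpace (ZpZeta p) := moduleTopology ℤ_[p] (ZpZeta p)

theorem root_pow_eq_one : (AdjoinRoot.root (cyclotomic p ℤ_[p])) ^ p = 1 := by
  have h : (AdjoinRoot.mk (cyclotomic p ℤ_[p])) (X ^ p - 1) = 0 :=
    AdjoinRoot.mk_eq_zero.2 (cyclotomic.dvd_X_pow_sub_one p ℤ_[p])
  simpa [sub_eq_zero] using h

/-- The root of unity `ζ`, as a unit of `ℤ_p(ζ)`. -/
noncomputable def zeta : (ZpZeta p)ˣ :=
  Units.ofPowEqOne (AdjoinRoot.root (cyclotomic p ℤ_[p])) p (root_pow_eq_one p)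
    (Fact.out : p.Prime).ne_zero

theorem zeta_pow_eq_one : zeta p ^ p = 1 := by
  exact Units.pow_ofPowEqOne _ _

variable {p} {G : Type v} [Group G]

/-- The rank one `ℤ_p(ζ)H`-lattice on which `H` acts through a character `φ : H → ⟨ζ⟩`. -/
noncomputable def rankOne {H : Type*} [Group H] (φ : H →* Subgroup.zpowers (zeta p)) :
    Representation (ZpZeta p) H (ZpZeta p) where
  toFun h := LinearMap.mulLeft (ZpZeta p) ((φ h : (ZpZeta p)ˣ) : ZpZeta p)
  map_one' := by ext; simp
  map_mul' a b := by ext; simp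

/-- A finitely generated generalized permutation `ℤ_p(ζ)G`-lattice: a finite direct sum of modules
induced from rank one lattices as above, for subgroups of `G`. -/
def IsFiniteGenPerm {F : Type w} [AddCommGroup F] [Module (ZpZeta p) F]
    (σ : Representation (ZpZeta p) G F) : Prop :=
  ∃ (n : ℕ) (H : Fin n → Subgroup G) (φ : ∀ k, H k →* Subgroup.zpowers (zeta p)),
    Nonempty (σ.Equiv
      (Representation.directSum fun k => Representation.ind (H k).subtype (rankOne (φ k))))

/-- A profinite generalized permutation `ℤ_p(ζ)G`-lattice: the limit (as a topological module)
of an inverse system, over a directed set, of finitely generated generalized permutation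
`ℤ_p(ζ)G`-lattices. The latter carry their canonical topology, which is the only one making them
profinite `ℤ_p(ζ)`-modules. -/
def IsGenPerm {V : Type u} [AddCommGroup V] [Module (ZpZeta p) V]
    [TopologicalSpace V] (τ : Representation (ZpZeta p) G V) : Prop :=
  ∃ (I : Type w) (_ : Preorder I) (_ : IsDirectedOrder I) (_ : Nonempty I)
    (F : I → Type w) (_ : ∀ i, AddCommGroup (F i)) (_ : ∀ i, Module (ZpZeta p) (F i))
    (_ : ∀ i, TopologicalSpace (F i))
    (σ : ∀ i, Representation (ZpZeta p) G (F i))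
    (t : ∀ i j, i ≤ j → (F j →L[ZpZeta p] F i))
    (π : ∀ i, V →L[ZpZeta p] F i),
    (∀ i, IsProfiniteModule (ZpZeta p) (F i)) ∧
    (∀ i, IsFiniteGenPerm (σ i)) ∧
    (∀ i j (hij : i ≤ j) (g : G) (x : F j), t i j hij (σ j g x) = σ i g (t i j hij x)) ∧
    (∀ i (x : F i), t i i le_rfl x = x) ∧
    (∀ i j k (hij : i ≤ j) (hjk : j ≤ k) (x : F k),
      t i j hij (t j k hjk x) = t i k (hij.trans hjk) x) ∧
    (∀ i (g : G) (y : V), π i (τ g y) = σ i g (π i y)) ∧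
    (∀ i j (hij : i ≤ j) (y : V), t i j hij (π j y) = π i y) ∧
    (∀ x : ∀ i, F i, (∀ i j (hij : i ≤ j), t i j hij (x j) = x i) →
      ∃! y : V, ∀ i, π i y = x i) ∧
    (inferInstance : TopologicalSpace V) =
      ⨅ i, TopologicalSpace.induced (π i) inferInstance

end Zeta

section FixedQuotient

variable {p : ℕ} [Fact p.Prime] {G : Type v} [Group G]
  {U : Type u} [AddCommGroup U] [Module ℤ_[p] U]

theorem invariants_le_comap (ρ : Representation ℤ_[p] G U) {N : Subgroup G}
    (hN : N ≤ Subgroup.center G) (g : G) :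
    Representation.invariants (ρ.comp N.subtype) ≤ (Representation.invariants (ρ.comp N.subtype)).comap (ρ g) := by
  intro x hx n
  have hc : (n : G) * g = g * n := ((Subgroup.mem_center_iff.1 (hN n.2)) g).symm
  have hx' : ρ (n : G) x = x := hx n
  change ρ (n : G) (ρ g x) = ρ g x
  rw [← Module.End.mul_apply, ← map_mul, hc, map_mul, Module.End.mul_apply, hx']

/-- The module `U / U^N`. The extra arguments are the ones that determine its
`ℤ_p(ζ)G`-module structure below. -/
@[nolint unusedArguments]
def FixedQuotient (ρ : Representation ℤ_[p] G U) {N : Subgroup G}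
    (_hN : N ≤ Subgroup.center G) (_ψ : N ≃* Subgroup.zpowers (zeta p)) : Type u :=
  U ⧸ Representation.invariants (ρ.comp N.subtype)

variable (ρ : Representation ℤ_[p] G U) {N : Subgroup G}
  (hN : N ≤ Subgroup.center G) (ψ : N ≃* Subgroup.zpowers (zeta p))

noncomputable instance : AddCommGroup (FixedQuotient ρ hN ψ) :=
  inferInstanceAs (AddCommGroup (U ⧸ Representation.invariants (ρ.comp N.subtype)))

noncomputable instance : Module ℤ_[p] (FixedQuotient ρ hN ψ) :=
  inferInstanceAs (Module ℤ_[p] (U ⧸ Representation.invariants (ρ.comp N.subtype)))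

/-- The quotient topology on `U / U^N`. -/
instance [TopologicalSpace U] : TopologicalSpace (FixedQuotient ρ hN ψ) :=
  inferInstanceAs (TopologicalSpace (U ⧸ Representation.invariants (ρ.comp N.subtype)))

/-- The projection `U → U / U^N`. -/
noncomputable def FixedQuotient.proj : U →ₗ[ℤ_[p]] FixedQuotient ρ hN ψ :=
  Submodule.mkQ (Representation.invariants (ρ.comp N.subtype))

/-- The `ℤ_p G`-module structure of `U / U^N`. -/
noncomputable def quotientRep : Representation ℤ_[p] G (FixedQuotient ρ hN ψ) :=
  ρ.quotient _ (invariants_le_comap ρ hN)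

/-- The generator of `N` that corresponds to `ζ` under `ψ`. -/
noncomputable def generator (ψ : N ≃* Subgroup.zpowers (zeta p)) : N :=
  ψ.symm ⟨zeta p, Subgroup.mem_zpowers _⟩

theorem generator_pow : generator ψ ^ p = 1 := by
  rw [generator, ← map_pow, ← map_one ψ.symm]
  congr 1
  ext1
  exact zeta_pow_eq_one p

theorem mem_zpowers_generator (n : N) : n ∈ Subgroup.zpowers (generator ψ) := by
  obtain ⟨k, hk⟩ := Subgroup.mem_zpowers_iff.1 (ψ n).2
  refine Subgroup.mem_zpowers_iff.2 ⟨k, ?_⟩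
  rw [generator, ← map_zpow, MulEquiv.symm_apply_eq]
  ext1
  exact hk

theorem aeval_generator_cyclotomic :
    aeval (quotientRep ρ hN ψ (generator ψ : G)) (cyclotomic p ℤ_[p]) = 0 := by
  ext x
  obtain ⟨u, rfl⟩ : ∃ u, FixedQuotient.proj ρ hN ψ u = x := Submodule.mkQ_surjective _ x
  have key : ∀ i : ℕ, ((quotientRep ρ hN ψ (generator ψ : G)) ^ i)
      (FixedQuotient.proj ρ hN ψ u) =
      FixedQuotient.proj ρ hN ψ (ρ ((generator ψ : G) ^ i) u) := by
    intro i
    rw [← map_pow]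
    rfl
  rw [cyclotomic_prime, map_sum]
  simp only [map_pow, aeval_X]
  rw [LinearMap.sum_apply, Finset.sum_congr rfl fun i _ => key i, ← map_sum]
  refine (Submodule.Quotient.mk_eq_zero _).2 ?_
  have hfix : ρ (generator ψ : G) (∑ i ∈ Finset.range p, ρ ((generator ψ : G) ^ i) u) =
      ∑ i ∈ Finset.range p, ρ ((generator ψ : G) ^ i) u := by
    rw [map_sum]
    have h1 : ∀ i, ρ (generator ψ : G) (ρ ((generator ψ : G) ^ i) u) =
        ρ ((generator ψ : G) ^ (i + 1)) u := by
      intro i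
      rw [pow_succ', map_mul, Module.End.mul_apply]
    simp only [h1]
    have h2 := Finset.sum_range_succ (fun i => ρ ((generator ψ : G) ^ i) u) p
    have h3 := Finset.sum_range_succ' (fun i => ρ ((generator ψ : G) ^ i) u) p
    have h4 : (generator ψ : G) ^ p = 1 := by
      exact_mod_cast congrArg Subtype.val (generator_pow ψ)
    rw [h2, h4, pow_zero] at h3
    exact (add_right_cancel h3).symm
  have hpow : ∀ k : ℕ, ρ ((generator ψ : G) ^ k)
      (∑ i ∈ Finset.range p, ρ ((generator ψ : G) ^ i) u) =
      ∑ i ∈ Finset.range p, ρ ((generator ψ : G) ^ i) u := by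
    intro k
    induction k with
    | zero => simp
    | succ k ih => rw [pow_succ, map_mul, Module.End.mul_apply, hfix, ih]
  intro n
  have hfin : IsOfFinOrder (generator ψ) :=
    isOfFinOrder_iff_pow_eq_one.2 ⟨p, (Fact.out : p.Prime).pos, generator_pow ψ⟩
  obtain ⟨k, hk⟩ := hfin.mem_powers_iff_mem_zpowers.2 (mem_zpowers_generator ψ n)
  subst hk
  exact hpow k

/-- `U / U^N` is a `ℤ_p(ζ)`-module, `ζ` acting as the element `ψ⁻¹(ζ)` of `N`. -/
noncomputable instance : Module (ZpZeta p) (FixedQuotient ρ hN ψ) :=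
  Module.compHom (FixedQuotient ρ hN ψ)
    (Ideal.Quotient.lift (Ideal.span {cyclotomic p ℤ_[p]})
      (aeval (quotientRep ρ hN ψ (generator ψ : G)) :
        ℤ_[p][X] →ₐ[ℤ_[p]] Module.End ℤ_[p] (FixedQuotient ρ hN ψ)).toRingHom
      (fun a ha => by
        obtain ⟨b, rfl⟩ := Ideal.mem_span_singleton.1 ha
        simp [aeval_generator_cyclotomic]) :
      ZpZeta p →+* Module.End ℤ_[p] (FixedQuotient ρ hN ψ))

theorem mk_smul (f : ℤ_[p][X]) (x : FixedQuotient ρ hN ψ) :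
    (AdjoinRoot.mk (cyclotomic p ℤ_[p]) f : ZpZeta p) • x =
      aeval (quotientRep ρ hN ψ (generator ψ : G)) f x := rfl

/-- The `ℤ_p(ζ)G`-module structure of `U / U^N`. -/
noncomputable def zetaRep : Representation (ZpZeta p) G (FixedQuotient ρ hN ψ) where
  toFun g :=
    { toFun := quotientRep ρ hN ψ g
      map_add' := map_add _
      map_smul' := by
        intro r x
        obtain ⟨f, rfl⟩ := AdjoinRoot.mk_surjective r
        rw [RingHom.id_apply, mk_smul, mk_smul]
        have hc : Commute (quotientRep ρ hN ψ g) (quotientRep ρ hN ψ (generator ψ : G)) := by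
          rw [commute_iff_eq, ← map_mul, ← map_mul,
            Subgroup.mem_center_iff.1 (hN (generator ψ).2) g]
        have hc' : Commute (quotientRep ρ hN ψ g)
            (aeval (quotientRep ρ hN ψ (generator ψ : G)) f) := by
          induction f using Polynomial.induction_on with
          | C a => rw [aeval_C]; exact (Algebra.commutes a _).symm
          | add f g hf hg => rw [map_add]; exact hf.add_right hg
          | monomial n a _ =>
            rw [map_mul, aeval_C, map_pow, aeval_X]
            exact Commute.mul_right (Algebra.commutes a _).symm (hc.pow_right _)
        exact LinearMap.congr_fun hc'.eq x }
  map_one' := by ext x; exact LinearMap.congr_fun (map_one (quotientRep ρ hN ψ)) x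
  map_mul' g h := by ext x; exact LinearMap.congr_fun (map_mul (quotientRep ρ hN ψ) g h) x

end FixedQuotient

end ProfiniteLattice

/-!
Write `V = U / U^N`, a profinite generalized permutation lattice over `ℤ_p(ζ)`. The proof lifts a
monomial basis of `V` to a permutation basis of `U`.

*Decomposition of `V`.* A module induced from a rank one lattice is cyclic, generated by an
eigenvector of a subgroup, and its endomorphism ring is local because `G` is a `p`-group
(`hasLocalEnd_indRep`). Modulo any neighbourhood of zero, the identity of `V` factors through a
finite sum of such modules: by compactness, eigenvectors in a late stage of the inverse system are
close to eigenvectors in `V` (`IsGenPerm.exists_approximation`). Locality allows one to replace a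
factorization by a direct summand (`exists_orthogonal_approximation`). Since `V` has a countable
basis of neighbourhoods of zero, repeated splitting gives generators `v j`, tending to zero, of
independent induced modules whose sum is dense (`IsGenPerm.exists_generators`). If `v j` has
subgroup `H j` and character `φ j`, then comparison of the two actions of `N` on `v j` shows that
`N ≤ H j` and that `φ j` extends `ψ`. So `K j = ker φ j` meets `N` trivially and fixes `v j`.

*Lifting.* The obstruction to lifting `v j` to a `K j`-fixed element `x j` of `U` lies in
`H¹(K j, U^N)`, which vanishes because `U^N` is a permutation lattice
(`IsPermutationLattice.exists_coboundary`). By the open mapping theorem the `x j` can be chosen so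
that they tend to zero (`exists_small_fixed_lift`, `exists_null_selection`).

*Comparison.* Let `P` be the module of functions from the disjoint union of the `G ⧸ K j` to `ℤ_p`.
The translates of the `x j` define an equivariant continuous map `f : P → U`, and `N` permutes the
unit vectors of `P` freely. By construction `f` is surjective modulo `U^N`. An element of its kernel
is `N`-invariant, because the only `ℤ_p`-linear relations between the powers of `ζ` are the
multiples of the sum of all of them (`permRep_eq_of_map_eq_zero`). As `U` is free over `N`, the
elements of `U^N` are traces, and an element of trace zero is a combination of elements
`(n - 1) u`. Therefore kernel and cokernel of `f` are divisible by `p`, hence zero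
(`bijective_of_trace`).

*Profinite basis.* The translates of the `x j` tend to zero, so that they are not a closed basis. The
indices are grouped according to the subgroup `K j`, a finite set of values. In each group one
member is kept and its translates are added to the corresponding translates of the other members.
The resulting set is compact, `G`-invariant and a profinite basis (`isProfiniteBasis_of_null`).
-/

namespace ProfiniteLattice

/-! ### Splitting off modules with local endomorphism rings -/

section Splitting

variable {A : Type*} [Ring A]

/-- The endomorphism ring of `S` is local: it is nonzero, and for each `f`, one of `f` and `1 - f` is
invertible. -/
def HasLocalEnd (A : Type*) [Ring A] (S : Type*) [AddCommGroup S] [Module A S] : Prop :=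
  Nontrivial S ∧ ∀ f : S →ₗ[A] S, Function.Bijective f ∨
    Function.Bijective ((LinearMap.id : S →ₗ[A] S) - f)

variable {S T T' : Type*} [AddCommGroup S] [Module A S] [AddCommGroup T] [Module A T]
  [AddCommGroup T'] [Module A T']

theorem exists_inverse {f : S →ₗ[A] T} (hf : Function.Bijective f) :
    ∃ g : T →ₗ[A] S, (∀ x, g (f x) = x) ∧ ∀ y, f (g y) = y :=
  ⟨(LinearEquiv.ofBijective f hf).symm, fun x => (LinearEquiv.ofBijective f hf).symm_apply_apply x,
    fun y => (LinearEquiv.ofBijective f hf).apply_symm_apply y⟩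

theorem HasLocalEnd.not_bijective_add (hS : HasLocalEnd A S) {f g : S →ₗ[A] T}
    (hf : ¬ Function.Bijective f) (hg : ¬ Function.Bijective g) :
    ¬ Function.Bijective (f + g) := by
  intro h
  obtain ⟨e, he, he'⟩ := exists_inverse h
  have hsum : LinearMap.id - e ∘ₗ f = e ∘ₗ g := by
    ext x
    have := he x
    simp only [LinearMap.add_apply, map_add] at this
    simp only [LinearMap.sub_apply, LinearMap.id_apply, LinearMap.comp_apply]
    rw [sub_eq_iff_eq_add']
    exact this.symm
  have hbij : Function.Bijective e := by
    refine ⟨fun a b hab => ?_, fun x => ⟨_, he x⟩⟩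
    rw [← he' a, ← he' b, hab]
  rcases hS.2 (e ∘ₗ f) with h1 | h1
  · rw [LinearMap.coe_comp] at h1
    exact hf ((Function.Bijective.of_comp_iff' hbij f).1 h1)
  · rw [hsum, LinearMap.coe_comp] at h1
    exact hg ((Function.Bijective.of_comp_iff' hbij g).1 h1)

theorem HasLocalEnd.not_bijective_comp (hS : Nontrivial S) (hT : HasLocalEnd A T)
    {f : S →ₗ[A] T} (g : T →ₗ[A] T') (hf : ¬ Function.Bijective f) :
    ¬ Function.Bijective (g ∘ₗ f) := by
  intro h
  obtain ⟨e, he, he'⟩ := exists_inverse h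
  simp only [LinearMap.comp_apply] at he he'
  rcases hT.2 (f ∘ₗ e ∘ₗ g) with h1 | h1
  · refine hf ⟨fun a b hab => h.1 (by simp [hab]), fun t => ?_⟩
    obtain ⟨t', ht'⟩ := h1.2 t
    exact ⟨_, ht'⟩
  · obtain ⟨s, hs⟩ := exists_ne (0 : S)
    have h2 : ((LinearMap.id : T →ₗ[A] T) - f ∘ₗ e ∘ₗ g) (f s) = 0 := by simp [he]
    have h3 : f s = 0 := h1.1 (by rw [h2, map_zero])
    apply hs
    rw [← he s, h3, map_zero, map_zero]

variable {V : Type*} [AddCommGroup V] [Module A V] {ι : Type*} [DecidableEq ι]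
  {M : ι → Type*} [∀ a, AddCommGroup (M a)] [∀ a, Module A (M a)]

/-- The `(a, b)` entry of the matrix `1 - π h`. -/
def defect (h : ∀ a, M a →ₗ[A] V) (π : ∀ a, V →ₗ[A] M a) (a b : ι) : M b →ₗ[A] M a :=
  LinearMap.proj a ∘ₗ LinearMap.single A M b - π a ∘ₗ h b

theorem defect_apply (h : ∀ a, M a →ₗ[A] V) (π : ∀ a, V →ₗ[A] M a) (a b : ι) (x : M b) :
    defect h π a b x = Pi.single b x a - π a (h b x) := rfl

/-- If all entries of `1 - π h` are non-isomorphisms, then `π h` is invertible, and replacing `h`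
by `h (π h)⁻¹` one obtains a dual pair of families. The inverse is found by Gaussian
elimination, which the locality of the endomorphism rings makes possible. The subgroups `C a` stand
for a property of the maps `π a`, such as continuity, that is kept by the elimination. -/
theorem exists_dual_families (hM : ∀ a, HasLocalEnd A (M a))
    (C : ∀ a, AddSubgroup (V →ₗ[A] M a))
    (hC : ∀ a b (f : M a →ₗ[A] M b), ∀ π ∈ C a, f ∘ₗ π ∈ C b) (s : Finset ι) :
    ∀ (q : V →ₗ[A] V), (∀ x, q (q x) = q x) →
    ∀ (h : ∀ a, M a →ₗ[A] V) (π : ∀ a, V →ₗ[A] M a),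
      (∀ a ∈ s, ∀ x, q (h a x) = h a x) → (∀ a ∈ s, ∀ x, π a (q x) = π a x) →
      (∀ a ∈ s, π a ∈ C a) →
      (∀ a ∈ s, ∀ b ∈ s, ¬ Function.Bijective (defect h π a b)) →
    ∃ (h' : ∀ a, M a →ₗ[A] V) (π' : ∀ a, V →ₗ[A] M a),
      (∀ a ∈ s, ∀ x, q (h' a x) = h' a x) ∧ (∀ a ∈ s, ∀ x, π' a (q x) = π' a x) ∧
      (∀ a ∈ s, π' a ∈ C a) ∧
      (∀ a ∈ s, ∀ b ∈ s, ∀ x, π' a (h' b x) = Pi.single b x a) ∧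
      ∀ x, (∀ a ∈ s, π' a x = 0) → ∀ a ∈ s, π a x = 0 := by
  induction s using Finset.induction_on with
  | empty => intro q _ h π _ _ _ _; exact ⟨h, π, by simp⟩
  | insert a s has ih =>
    intro q hq h π hh hπ hπC hd
    have haa : Function.Bijective (π a ∘ₗ h a) := by
      have h1 := hd a (by simp) a (by simp)
      have h2 : defect h π a a = LinearMap.id - π a ∘ₗ h a := by
        ext x; simp [defect_apply]
      rw [h2] at h1
      exact ((hM a).2 _).resolve_right h1
    -- the pivot `π a ∘ h a` is invertible, and the rest of the family is made orthogonal to the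
    -- idempotent `ε` that belongs to it
    obtain ⟨e, he, he'⟩ := exists_inverse haa
    simp only [LinearMap.comp_apply] at he he'
    have hne : ∀ c ∈ s, c ≠ a := fun c hc hca => has (hca ▸ hc)
    have hha := hh a (by simp)
    have hπa := hπ a (by simp)
    let ε : V →ₗ[A] V := h a ∘ₗ e ∘ₗ π a
    have hε : ∀ x, ε x = h a (e (π a x)) := fun x => rfl
    have hqε : ∀ x, q (ε x) = ε x := fun x => by rw [hε, hha]
    have hεq : ∀ x, ε (q x) = ε x := fun x => by rw [hε, hπa, hε]
    have hεε : ∀ x, ε (ε x) = ε x := fun x => by rw [hε (ε x), hε x, he']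
    have hπε : ∀ x, π a (ε x) = π a x := fun x => by rw [hε, he']
    have hεh : ∀ x, ε (h a x) = h a x := fun x => by rw [hε, he]
    obtain ⟨h1, π1, hq1, hπ1, hC1, hδ1, hker⟩ := ih (q - ε)
      (by intro x; simp [hq, hqε, hεq, hεε])
      (fun c => h c - ε ∘ₗ h c) (fun c => π c - π c ∘ₗ ε)
      (by
        intro c hc x
        have := hh c (by simp [hc])
        simp [this, hqε, hεε])
      (by
        intro c hc x
        have := hπ c (by simp [hc])
        simp [this, hεq, hεε])
      (by
        intro c hc
        refine (C c).sub_mem (hπC c (by simp [hc])) ?_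
        exact hC a c (π c ∘ₗ h a ∘ₗ e) (π a) (hπC a (by simp)))
      (by
        intro c hc b hb
        have hrew : defect (fun c => h c - ε ∘ₗ h c) (fun c => π c - π c ∘ₗ ε) c b =
            defect h π c b + (π c ∘ₗ h a ∘ₗ e) ∘ₗ (- defect h π a b) := by
          ext x
          have hab : (Pi.single b x : ∀ i, M i) a = 0 := by
            rw [Pi.single_eq_of_ne (hne b hb).symm]
          simp only [defect_apply, LinearMap.sub_apply, LinearMap.comp_apply, map_sub, hεε,
            LinearMap.add_apply, LinearMap.neg_apply, hab, zero_sub, neg_neg]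
          rw [hε (h b x)]
          abel
        rw [hrew]
        refine (hM b).not_bijective_add (hd c (by simp [hc]) b (by simp [hb])) ?_
        refine HasLocalEnd.not_bijective_comp (hM b).1 (hM a) _ ?_
        intro hbij
        apply hd a (by simp) b (by simp [hb])
        have : (⇑(-defect h π a b) : M b → M a) = (fun y => -y) ∘ defect h π a b := rfl
        rw [this] at hbij
        exact (Function.Bijective.of_comp_iff' (Equiv.neg (M a)).bijective _).1 hbij)
    simp only [LinearMap.sub_apply] at hq1 hπ1 hker
    have hqh1 : ∀ c ∈ s, ∀ x, q (h1 c x) = h1 c x := by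
      intro c hc x
      conv_rhs => rw [← hq1 c hc x]
      conv_lhs => rw [← hq1 c hc x]
      simp [hq, hqε]
    have hεh1 : ∀ c ∈ s, ∀ x, ε (h1 c x) = 0 := by
      intro c hc x
      have := hq1 c hc x
      rwa [hqh1 c hc x, sub_eq_self] at this
    have hπ1ε : ∀ c ∈ s, ∀ x, π1 c (ε x) = 0 := by
      intro c hc x
      have := hπ1 c hc (ε x)
      rw [hqε, hεε, sub_self, map_zero] at this
      exact this.symm
    refine ⟨Function.update h1 a (h a ∘ₗ e), Function.update π1 a (π a), ?_, ?_, ?_, ?_, ?_⟩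
    · intro c hc x
      rcases Finset.mem_insert.1 hc with rfl | hc
      · simp [hha]
      · simp [hne c hc, hqh1 c hc]
    · intro c hc x
      rcases Finset.mem_insert.1 hc with rfl | hc
      · simp [hπa]
      · have := hπ1 c hc x
        rw [map_sub, hπ1ε c hc, sub_zero] at this
        simp [hne c hc, this]
    · intro c hc
      rcases Finset.mem_insert.1 hc with rfl | hc
      · simpa using hπC _ (by simp)
      · simpa [hne c hc] using hC1 c hc
    · intro c hc b hb x
      rcases Finset.mem_insert.1 hc with rfl | hc' <;>
        rcases Finset.mem_insert.1 hb with rfl | hb'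
      · simp [he']
      · have h2 : (π c) (h1 b x) = 0 := by rw [← hπε, hεh1 b hb', map_zero]
        simp [hne b hb', (hne b hb').symm, h2]
      · have h2 := hπ1ε c hc' (h b (e x))
        rw [hεh] at h2
        simp [hne c hc', h2]
      · simp [hne c hc', hne b hb', hδ1 c hc' b hb']
    · intro x hx
      have hxa : π a x = 0 := by simpa using hx a (by simp)
      have hεx : ε x = 0 := by rw [hε, hxa, map_zero, map_zero]
      intro c hc
      rcases Finset.mem_insert.1 hc with rfl | hc
      · exact hxa
      · have h3 := hker x (fun c hc => by
          have := hx c (by simp [hc])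
          simpa [hne c hc] using this) c hc
        simpa [hεx] using h3

/-- If the idempotent `q` is approximated modulo `O` by a map that factors through a finite direct
sum of modules with local endomorphism rings, then it is approximated by the projection to a
direct summand of that kind. The family of least cardinality does it: if some entry of
`1 - π h` were an isomorphism, a member of the family could be eliminated. -/
theorem exists_orthogonal_approximation (hM : ∀ a, HasLocalEnd A (M a))
    (C : ∀ a, AddSubgroup (V →ₗ[A] M a))
    (hC : ∀ a b (f : M a →ₗ[A] M b), ∀ π ∈ C a, f ∘ₗ π ∈ C b)
    (O : AddSubgroup V) (q : V →ₗ[A] V) (hq : ∀ x, q (q x) = q x) (s : Finset ι)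
    (h : ∀ a, M a →ₗ[A] V) (π : ∀ a, V →ₗ[A] M a)
    (hh : ∀ a ∈ s, ∀ x, q (h a x) = h a x) (hπ : ∀ a ∈ s, ∀ x, π a (q x) = π a x)
    (hπC : ∀ a ∈ s, π a ∈ C a) (hO : ∀ x, q x - ∑ a ∈ s, h a (π a x) ∈ O) :
    ∃ (t : Finset ι) (h' : ∀ a, M a →ₗ[A] V) (π' : ∀ a, V →ₗ[A] M a),
      (∀ a ∈ t, ∀ x, q (h' a x) = h' a x) ∧ (∀ a ∈ t, ∀ x, π' a (q x) = π' a x) ∧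
      (∀ a ∈ t, π' a ∈ C a) ∧
      (∀ a ∈ t, ∀ b ∈ t, ∀ x, π' a (h' b x) = Pi.single b x a) ∧
      ∀ x, q x - ∑ a ∈ t, h' a (π' a x) ∈ O := by
  induction hn : s.card using Nat.strong_induction_on generalizing s h π with
  | _ n ih =>
  by_cases hbad : ∃ a ∈ s, ∃ b ∈ s, Function.Bijective (defect h π a b)
  · obtain ⟨a, ha, b, hb, hab⟩ := hbad
    obtain ⟨θ, hθ, hθ'⟩ := exists_inverse hab
    have hsum : ∀ y : M b, ∑ c ∈ s, h c (defect h π c b y) =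
        h b y - ∑ c ∈ s, h c (π c (h b y)) := by
      intro y
      simp only [defect_apply, map_sub, Finset.sum_sub_distrib]
      congr 1
      rw [Finset.sum_eq_single_of_mem b hb]
      · simp
      · intro c _ hcb
        rw [Pi.single_eq_of_ne hcb, map_zero]
    -- `h b - ∑ h c ∘ π c ∘ h b` takes values in `O`, and its term at `a` is an isomorphism onto `M a`
    -- followed by `h a`; solving for this term eliminates `a`
    refine ih (s.erase a).card (hn ▸ Finset.card_erase_lt_of_mem ha) (s.erase a) h
      (fun c => π c - defect h π c b ∘ₗ θ ∘ₗ π a)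
      (fun c hc => hh c (Finset.mem_of_mem_erase hc)) ?_ ?_ ?_ rfl
    · intro c hc x
      simp [hπ c (Finset.mem_of_mem_erase hc), hπ a ha]
    · intro c hc
      exact (C c).sub_mem (hπC c (Finset.mem_of_mem_erase hc))
        (hC a c (defect h π c b ∘ₗ θ) _ (hπC a ha))
    · intro x
      have h1 : ∑ c ∈ s.erase a, h c ((π c - defect h π c b ∘ₗ θ ∘ₗ π a) x) =
          ∑ c ∈ s, h c ((π c - defect h π c b ∘ₗ θ ∘ₗ π a) x) := by
        refine Finset.sum_erase _ ?_
        simp [hθ']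
      rw [h1]
      simp only [LinearMap.sub_apply, LinearMap.comp_apply, map_sub, Finset.sum_sub_distrib]
      rw [hsum]
      have h2 := O.add_mem (hO x) (hO (h b (θ (π a x))))
      rw [hh b hb] at h2
      convert h2 using 1
      abel
  · push Not at hbad
    obtain ⟨h', π', h1, h2, h3, h4, h5⟩ :=
      exists_dual_families hM C hC s q hq h π hh hπ hπC hbad
    refine ⟨s, h', π', h1, h2, h3, h4, fun x => ?_⟩
    set y := q x - ∑ a ∈ s, h' a (π' a x) with hy
    have hqy : q y = y := by
      rw [hy, map_sub, hq, map_sum]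
      congr 1
      exact Finset.sum_congr rfl fun a ha => h1 a ha _
    have hπ'y : ∀ a ∈ s, π' a y = 0 := by
      intro a ha
      rw [hy, map_sub, h2 a ha, map_sum, sub_eq_zero, Finset.sum_eq_single_of_mem a ha]
      · rw [h4 a ha a ha]; simp
      · intro b hb hba
        rw [h4 a ha b hb, Pi.single_eq_of_ne hba.symm]
    have hπy := h5 y hπ'y
    have h6 := hO y
    rwa [hqy, Finset.sum_eq_zero (fun a ha => by rw [hπy a ha, map_zero]), sub_zero] at h6

end Splitting

/-! ### The ring `ℤ_p(ζ)` -/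

section Ring

variable (p : ℕ) [Fact p.Prime]

instance : Module.Finite ℤ_[p] (ZpZeta p) :=
  (cyclotomic.monic p ℤ_[p]).finite_adjoinRoot

instance : IsNoetherianRing (ZpZeta p) :=
  IsNoetherianRing.of_finite ℤ_[p] (ZpZeta p)

/-- The residue map `ℤ_p(ζ) → 𝔽_p`, which sends `ζ` to `1`. -/
noncomputable def residue : ZpZeta p →+* ZMod p :=
  AdjoinRoot.lift (PadicInt.toZMod) 1 (by
    rw [eval₂_eq_eval_map, map_cyclotomic, eval_one_cyclotomic_prime]; simp)

theorem coe_zeta :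
    ((zeta p : (ZpZeta p)ˣ) : ZpZeta p) = AdjoinRoot.root (cyclotomic p ℤ_[p]) := rfl

theorem residue_zeta : residue p (zeta p : (ZpZeta p)ˣ) = 1 := by
  rw [coe_zeta, residue, AdjoinRoot.lift_root]

theorem residue_zpowers (z : Subgroup.zpowers (zeta p)) :
    residue p ((z : (ZpZeta p)ˣ) : ZpZeta p) = 1 := by
  obtain ⟨k, hk⟩ := Subgroup.mem_zpowers_iff.1 z.2
  rw [← hk]
  have : Units.map (residue p).toMonoidHom (zeta p) = 1 := by
    ext; exact residue_zeta p
  have h2 : Units.map (residue p).toMonoidHom (zeta p ^ k) = 1 := by rw [map_zpow, this, one_zpow]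
  exact congrArg Units.val h2

/-- Each element of `ℤ_p(ζ)` is congruent to a natural number modulo `ζ - 1` and `p`. -/
theorem exists_nat_congr (r : ZpZeta p) :
    ∃ (n : ℕ) (a b : ZpZeta p),
      r = n + a * (((zeta p : (ZpZeta p)ˣ) : ZpZeta p) - 1) + b * p ∧ residue p r = n := by
  obtain ⟨f, rfl⟩ := AdjoinRoot.mk_surjective r
  obtain ⟨g, hg⟩ := X_sub_C_dvd_sub_C_eval (a := (1 : ℤ_[p])) (p := f)
  obtain ⟨c, hc⟩ := Ideal.mem_span_singleton.1 (PadicInt.zmodRepr_spec (f.eval 1) |>.2 |> fun h => by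
    rwa [PadicInt.maximalIdeal_eq_span_p] at h :
      f.eval 1 - (PadicInt.zmodRepr (f.eval 1) : ℤ_[p]) ∈ Ideal.span {(p : ℤ_[p])})
  have key : AdjoinRoot.mk (cyclotomic p ℤ_[p]) f = (PadicInt.zmodRepr (f.eval 1) : ZpZeta p) +
      AdjoinRoot.mk _ g * (((zeta p : (ZpZeta p)ˣ) : ZpZeta p) - 1) +
      algebraMap ℤ_[p] (ZpZeta p) c * (p : ZpZeta p) := by
    have h1 := congrArg (AdjoinRoot.mk (cyclotomic p ℤ_[p])) hg
    have h2 := congrArg (algebraMap ℤ_[p] (ZpZeta p)) hc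
    simp only [map_sub, map_mul, map_natCast] at h2
    simp only [map_sub, map_mul, AdjoinRoot.mk_X, AdjoinRoot.mk_C, map_one] at h1
    rw [coe_zeta, mul_comm _ (_ - 1), mul_comm _ (p : ZpZeta p), ← h2, ← h1]
    rw [AdjoinRoot.algebraMap_eq]
    ring
  refine ⟨_, _, _, key, ?_⟩
  rw [key]
  simp [residue_zeta]

end Ring

/-! ### Simple modules over a `p`-group -/

section Local

variable {p : ℕ} [Fact p.Prime] {G : Type v} [Group G]

theorem finite_of_zmodModule_finite {Q : Type*} [AddCommGroup Q] (inst : Module (ZMod p) Q)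
    (h : Module.Finite (ZMod p) Q) : Finite Q :=
  Module.finite_of_finite (ZMod p)

theorem finite_of_p_nsmul {Q : Type*} [AddCommGroup Q] [Module (ZpZeta p) Q]
    [Module.Finite (ZpZeta p) Q] (hpQ : ∀ x : Q, p • x = 0) : Finite Q := by
  let : Module ℤ_[p] Q := Module.compHom Q (algebraMap ℤ_[p] (ZpZeta p))
  have : IsScalarTower ℤ_[p] (ZpZeta p) Q :=
    ⟨fun a b x => by rw [Algebra.smul_def, mul_smul]; rfl⟩
  have : Module.Finite ℤ_[p] Q := Module.Finite.trans (ZpZeta p) Q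
  let _ : Module (ZMod p) Q := AddCommGroup.zmodModule hpQ
  let : Algebra ℤ_[p] (ZMod p) := (PadicInt.toZMod).toAlgebra
  have : IsScalarTower ℤ_[p] (ZMod p) Q := by
    refine ⟨fun a b x => ?_⟩
    obtain ⟨c, hc⟩ := Ideal.mem_span_singleton.1 (PadicInt.zmodRepr_spec a |>.2 |> fun h => by
      rwa [PadicInt.maximalIdeal_eq_span_p] at h :
        a - (PadicInt.zmodRepr a : ℤ_[p]) ∈ Ideal.span {(p : ℤ_[p])})
    have ha : a = (PadicInt.zmodRepr a : ℤ_[p]) + c * p := by rw [mul_comm, ← hc]; ring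
    rw [Algebra.smul_def, RingHom.algebraMap_toAlgebra, mul_smul]
    generalize b • x = y
    have h1 : a • y = (PadicInt.zmodRepr a) • y := by
      conv_lhs => rw [ha]
      rw [add_smul, mul_smul, Nat.cast_smul_eq_nsmul, Nat.cast_smul_eq_nsmul, hpQ, smul_zero,
        add_zero]
    have h2 : PadicInt.toZMod a = (PadicInt.zmodRepr a : ZMod p) := by
      conv_lhs => rw [ha]
      simp
    rw [h1, h2, Nat.cast_smul_eq_nsmul]
  have hfin : Module.Finite (ZMod p) Q := Module.Finite.of_restrictScalars_finite ℤ_[p] (ZMod p) Q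
  exact finite_of_zmodModule_finite _ hfin

theorem exists_ne_zero_fixed {P : Type*} [Group P] (hP : IsPGroup p P) {Q : Type*}
    [AddCommGroup Q] [Finite Q] [Nontrivial Q] (hpQ : ∀ x : Q, p • x = 0) [DistribMulAction P Q] :
    ∃ x : Q, x ≠ 0 ∧ ∀ g : P, g • x = x := by
  obtain ⟨x, hx⟩ := exists_ne (0 : Q)
  have hdvd : p ∣ Nat.card Q := by
    rw [← addOrderOf_eq_prime (hpQ x) hx]
    exact addOrderOf_dvd_natCard x
  obtain ⟨y, hy, hy0⟩ := hP.exists_fixed_point_of_prime_dvd_card_of_fixed_point Q hdvd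
    (a := 0) (fun g => smul_zero g)
  exact ⟨y, hy0.symm, hy⟩

/-- On a simple finitely generated `ℤ_p(ζ)G`-module, `G` a `p`-group, both `G` and `ζ` act
trivially. -/
theorem trivial_of_simple (hG : IsPGroup p G) {Q : Type*} [AddCommGroup Q] [Module (ZpZeta p) Q]
    [Module.Finite (ZpZeta p) Q] [Nontrivial Q] (σ : Representation (ZpZeta p) G Q)
    (hs : ∀ N : Submodule (ZpZeta p) Q, (∀ g, ∀ x ∈ N, σ g x ∈ N) → N = ⊥ ∨ N = ⊤) :
    (∀ x : Q, p • x = 0) ∧ (∀ g x, σ g x = x) ∧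
      ∀ x : Q, ((zeta p : (ZpZeta p)ˣ) : ZpZeta p) • x = x := by
  have hpQ : ∀ x : Q, p • x = 0 := by
    let P : Submodule (ZpZeta p) Q := LinearMap.range (LinearMap.lsmul (ZpZeta p) Q (p : ZpZeta p))
    rcases hs P (by
      rintro g _ ⟨x, rfl⟩
      exact ⟨σ g x, by simp⟩) with h | h
    · intro x
      have : (p : ZpZeta p) • x ∈ P := ⟨x, rfl⟩
      rw [h, Submodule.mem_bot, Nat.cast_smul_eq_nsmul] at this
      exact this
    · exfalso
      let : Module ℤ_[p] Q := Module.compHom Q (algebraMap ℤ_[p] (ZpZeta p))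
      have : IsScalarTower ℤ_[p] (ZpZeta p) Q :=
        ⟨fun a b x => by rw [Algebra.smul_def, mul_smul]; rfl⟩
      have : Module.Finite ℤ_[p] Q := Module.Finite.trans (ZpZeta p) Q
      have hle : (⊤ : Submodule ℤ_[p] Q) ≤ Ideal.span {(p : ℤ_[p])} • ⊤ := by
        intro y _
        have hy : y ∈ P := h ▸ Submodule.mem_top
        obtain ⟨x, rfl⟩ := hy
        have : (LinearMap.lsmul (ZpZeta p) Q (p : ZpZeta p)) x = (p : ℤ_[p]) • x := by
          rw [LinearMap.lsmul_apply, Nat.cast_smul_eq_nsmul, Nat.cast_smul_eq_nsmul]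
        rw [this]
        exact Submodule.smul_mem_smul (Ideal.mem_span_singleton_self _) Submodule.mem_top
      have := Submodule.eq_bot_of_le_smul_of_le_jacobson_bot _ _ Module.Finite.fg_top hle
        (by
          rw [← PadicInt.maximalIdeal_eq_span_p]
          exact IsLocalRing.maximalIdeal_le_jacobson _)
      exact bot_ne_top this.symm
  have := finite_of_p_nsmul hpQ
  refine ⟨hpQ, ?_, ?_⟩
  · let : DistribMulAction G Q :=
      { smul g x := σ g x
        one_smul x := by change σ 1 x = x; simp
        mul_smul g h x := by change σ (g * h) x = σ g (σ h x); simp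
        smul_zero g := map_zero (σ g)
        smul_add g := map_add (σ g) }
    obtain ⟨x, hx, hfix⟩ := exists_ne_zero_fixed hG hpQ
    rcases hs (Representation.invariants σ) (by
      intro g y hy h
      rw [hy g, hy h]) with h | h
    · exact absurd ((Submodule.mem_bot _).1 (h ▸ hfix : x ∈ (⊥ : Submodule (ZpZeta p) Q))) hx
    · intro g y
      have hy : y ∈ Representation.invariants σ := h ▸ Submodule.mem_top
      exact hy g
  · have hz : IsPGroup p (Subgroup.zpowers (zeta p)) := by
      rintro ⟨z, hz⟩
      obtain ⟨k, rfl⟩ := Subgroup.mem_zpowers_iff.1 hz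
      refine ⟨1, ?_⟩
      ext1
      simp only [pow_one, SubmonoidClass.mk_pow, OneMemClass.coe_one]
      rw [← zpow_natCast, zpow_comm, zpow_natCast, zeta_pow_eq_one, one_zpow]
    obtain ⟨x, hx, hfix⟩ := exists_ne_zero_fixed hz hpQ
    have hfix' : ((zeta p : (ZpZeta p)ˣ) : ZpZeta p) • x = x :=
      hfix ⟨zeta p, Subgroup.mem_zpowers _⟩
    let N : Submodule (ZpZeta p) Q :=
      LinearMap.ker (LinearMap.lsmul (ZpZeta p) Q (((zeta p : (ZpZeta p)ˣ) : ZpZeta p) - 1))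
    have hN : ∀ y, y ∈ N ↔ ((zeta p : (ZpZeta p)ˣ) : ZpZeta p) • y = y := by
      intro y
      rw [LinearMap.mem_ker, LinearMap.lsmul_apply, sub_smul, one_smul, sub_eq_zero]
    rcases hs N (by
      intro g y hy
      rw [hN] at hy ⊢
      rw [← map_smul, hy]) with h | h
    · exact absurd ((Submodule.mem_bot _).1 (h ▸ (hN x).2 hfix')) hx
    · intro y
      rw [← hN, h]
      exact Submodule.mem_top

/-- A module generated by one element `x`, with an invariant functional to `𝔽_p` that does not
vanish at `x`, has a unique maximal submodule: the kernel of the functional. -/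
theorem eq_top_of_augmentation_ne_zero (hG : IsPGroup p G) {S : Type*} [AddCommGroup S]
    [Module (ZpZeta p) S] [Module.Finite (ZpZeta p) S] (σ : Representation (ZpZeta p) G S)
    (x : S) (hx : ∀ s, s ∈ Submodule.span (ZpZeta p) (Set.range fun g => σ g x))
    (ε : S →+ ZMod p) (hε : ∀ (r : ZpZeta p) s, ε (r • s) = residue p r * ε s)
    (hεG : ∀ g s, ε (σ g s) = ε s) (hε1 : ε x = 1)
    (N : Submodule (ZpZeta p) S) (hN : ∀ g, ∀ y ∈ N, σ g y ∈ N) (y : S) (hy : y ∈ N)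
    (hy0 : ε y ≠ 0) : N = ⊤ := by
  by_contra hNtop
  let 𝒮 : Set (Submodule (ZpZeta p) S) := {L | N ≤ L ∧ L ≠ ⊤ ∧ ∀ g, ∀ y ∈ L, σ g y ∈ L}
  obtain ⟨L, ⟨hNL, hLtop, hLG⟩, hmax⟩ := set_has_maximal_iff_noetherian.2
    (inferInstance : IsNoetherian (ZpZeta p) S) 𝒮 ⟨N, le_rfl, hNtop, hN⟩
  have : Nontrivial (S ⧸ L) := Submodule.Quotient.nontrivial_iff.2 hLtop
  obtain ⟨h1, h2, h3⟩ := trivial_of_simple hG (σ.quotient L hLG) (by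
    intro K hK
    by_cases hK' : K.comap L.mkQ = ⊤
    · right
      rw [eq_top_iff]
      intro q _
      obtain ⟨s, rfl⟩ := L.mkQ_surjective q
      have : s ∈ K.comap L.mkQ := hK' ▸ Submodule.mem_top
      exact this
    · left
      have hLK : L ≤ K.comap L.mkQ := by
        intro s hs
        have : L.mkQ s = 0 := (Submodule.Quotient.mk_eq_zero L).2 hs
        rw [Submodule.mem_comap, this]
        exact K.zero_mem
      have hmem : K.comap L.mkQ ∈ 𝒮 := ⟨hNL.trans hLK, hK', fun g s hs => hK g _ hs⟩
      have heq : K.comap L.mkQ = L := ((hLK.lt_or_eq).resolve_left (hmax _ hmem)).symm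
      rw [eq_bot_iff]
      intro q hq
      obtain ⟨s, rfl⟩ := L.mkQ_surjective q
      have hs : s ∈ K.comap L.mkQ := hq
      rw [heq] at hs
      exact (Submodule.Quotient.mk_eq_zero L).2 hs)
  have h1' : ∀ s, p • s ∈ L := fun s => (Submodule.Quotient.mk_eq_zero L).1 (h1 (L.mkQ s))
  have h2' : ∀ g s, σ g s - s ∈ L := fun g s => (Submodule.Quotient.eq L).1 (h2 g (L.mkQ s))
  have h3' : ∀ s, ((zeta p : (ZpZeta p)ˣ) : ZpZeta p) • s - s ∈ L :=
    fun s => (Submodule.Quotient.eq L).1 (h3 (L.mkQ s))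
  have key : ∀ s, ∃ n : ℕ, s - n • x ∈ L ∧ ε s = n := by
    intro s
    induction hx s using Submodule.span_induction with
    | mem s hs =>
      obtain ⟨g, rfl⟩ := hs
      exact ⟨1, by simpa using h2' g x, by simp [hεG, hε1]⟩
    | zero => exact ⟨0, by simp, by simp⟩
    | add s t _ _ hs ht =>
      obtain ⟨n, hn, hn'⟩ := hs
      obtain ⟨m, hm, hm'⟩ := ht
      refine ⟨n + m, ?_, by simp [hn', hm']⟩
      have := L.add_mem hn hm
      rw [add_smul]
      convert this using 1
      abel
    | smul r s _ hs =>
      obtain ⟨n, hn, hn'⟩ := hs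
      obtain ⟨m, a, b, hr, hr'⟩ := exists_nat_congr p r
      refine ⟨m * n, ?_, by rw [hε, hn', hr']; push_cast; ring⟩
      have e1 : r • s - (m * n) • x = m • (s - n • x) +
          a • (((zeta p : (ZpZeta p)ˣ) : ZpZeta p) • s - s) + b • (p • s) := by
        conv_lhs => rw [hr]
        simp only [add_smul, mul_smul, sub_smul, one_smul, Nat.cast_smul_eq_nsmul, smul_sub]
        abel
      rw [e1]
      exact L.add_mem (L.add_mem (L.smul_of_tower_mem m hn) (L.smul_mem a (h3' s)))
        (L.smul_mem b (h1' s))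
  apply hLtop
  obtain ⟨n, hn, hn'⟩ := key y
  have hnx : n • x ∈ L := by
    have := L.sub_mem (hNL hy) hn
    rwa [sub_sub_cancel] at this
  have hn0 : (n : ZMod p) ≠ 0 := hn' ▸ hy0
  have hcop : IsCoprime (n : ℤ) (p : ℤ) := by
    rw [Nat.isCoprime_iff_coprime, Nat.coprime_comm,
      (Fact.out : p.Prime).coprime_iff_not_dvd]
    rwa [Ne, ZMod.natCast_eq_zero_iff] at hn0
  obtain ⟨a, b, hab⟩ := hcop
  have hxL : x ∈ L := by
    have e2 : x = a • (n • x) + b • (p • x) := by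
      rw [← natCast_zsmul, ← natCast_zsmul, smul_smul, smul_smul, ← add_smul, hab, one_smul]
    rw [e2]
    exact L.add_mem (L.smul_of_tower_mem a hnx) (L.smul_of_tower_mem b (h1' x))
  rw [eq_top_iff]
  intro s _
  refine Submodule.span_le.2 ?_ (hx s)
  rintro _ ⟨g, rfl⟩
  exact hLG g x hxL

end Local

/-! ### Induced modules -/

section Induced

variable {p : ℕ} [Fact p.Prime] {G : Type v} [Group G] (H : Subgroup G)
  (φ : H →* Subgroup.zpowers (zeta p))

/-- The module induced from the rank one lattice with character `φ`. -/
noncomputable abbrev indRep : Representation (ZpZeta p) G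
    (Representation.IndV H.subtype (rankOne φ)) :=
  Representation.ind H.subtype (rankOne φ)

/-- The generator `1 ⊗ 1` of an induced module. -/
noncomputable def indGen : Representation.IndV H.subtype (rankOne φ) :=
  Representation.IndV.mk H.subtype (rankOne φ) 1 1

variable {H}

theorem indRep_indGen (g : G) :
    indRep H φ g (indGen H φ) = Representation.IndV.mk H.subtype (rankOne φ) g⁻¹ 1 := by
  rw [indGen, indRep, Representation.ind_mk, one_mul]

theorem mk_mul_left (h : H) (g : G) (r : ZpZeta p) :
    Representation.IndV.mk H.subtype (rankOne φ) (h * g) (((φ h : (ZpZeta p)ˣ) : ZpZeta p) * r) =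
      Representation.IndV.mk H.subtype (rankOne φ) g r := by
  have := Representation.Coinvariants.mk_self_apply
    (Representation.tprod ((Representation.leftRegular (ZpZeta p) G).comp H.subtype) (rankOne φ)) h
    (MonoidAlgebra.single g 1 ⊗ₜ[ZpZeta p] r)
  rw [Representation.IndV.mk, Representation.IndV.mk]
  simp only [LinearMap.comp_apply, TensorProduct.mk_apply]
  rw [← this]
  congr 1
  simp [rankOne]

theorem indRep_mem (h : H) :
    indRep H φ h (indGen H φ) = ((φ h : (ZpZeta p)ˣ) : ZpZeta p) • indGen H φ := by
  rw [indRep_indGen, ← mk_mul_left φ h, mul_inv_cancel, mul_one, indGen, ← map_smul, smul_eq_mul,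
    mul_one]

theorem mem_span_indGen (s : Representation.IndV H.subtype (rankOne φ)) :
    s ∈ Submodule.span (ZpZeta p) (Set.range fun g => indRep H φ g (indGen H φ)) := by
  set N := Submodule.span (ZpZeta p) (Set.range fun g => indRep H φ g (indGen H φ))
  have : N.mkQ = 0 := by
    refine Representation.IndV.hom_ext _ _ fun g => ?_
    ext
    simp only [LinearMap.comp_apply, LinearMap.zero_apply]
    refine (Submodule.Quotient.mk_eq_zero N).2 (Submodule.subset_span ⟨g⁻¹, ?_⟩)
    change indRep H φ g⁻¹ (indGen H φ) = _
    rw [indRep_indGen, inv_inv]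
    rfl
  exact (Submodule.Quotient.mk_eq_zero N).1 (LinearMap.congr_fun this s)

/-- The universal property of an induced module. -/
theorem exists_indRep_lift {W : Type*} [AddCommGroup W] [Module (ZpZeta p) W]
    (σ : Representation (ZpZeta p) G W) (y : W)
    (hy : ∀ h : H, σ h y = ((φ h : (ZpZeta p)ˣ) : ZpZeta p) • y) :
    ∃ f : Representation.IndV H.subtype (rankOne φ) →ₗ[ZpZeta p] W,
      (∀ g s, f (indRep H φ g s) = σ g (f s)) ∧ f (indGen H φ) = y := by
  let f₀ : MonoidAlgebra (ZpZeta p) G →ₗ[ZpZeta p] ZpZeta p →ₗ[ZpZeta p] W :=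
    (Finsupp.lift _ _ _ fun g : G =>
        (σ g⁻¹ : W →ₗ[ZpZeta p] W) ∘ₗ LinearMap.toSpanSingleton (ZpZeta p) W y) ∘ₗ
      (MonoidAlgebra.coeffLinearEquiv (ZpZeta p)).toLinearMap
  let f : Representation.IndV H.subtype (rankOne φ) →ₗ[ZpZeta p] W :=
    Representation.Coinvariants.lift _ (TensorProduct.lift f₀) (by
      intro h
      ext g
      have h1 : σ ((h : G)⁻¹) y = (((φ h)⁻¹ : (ZpZeta p)ˣ) : ZpZeta p) • y := by
        have := hy h⁻¹
        rwa [map_inv] at this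
      simp [f₀, rankOne, h1, smul_smul])
  have hf : ∀ g r, f (Representation.IndV.mk H.subtype (rankOne φ) g r) = r • σ g⁻¹ y := by
    intro g r
    simp [f, f₀]
  refine ⟨f, ?_, ?_⟩
  · intro g s
    have : f ∘ₗ indRep H φ g = σ g ∘ₗ f := by
      refine Representation.IndV.hom_ext _ _ fun g' => ?_
      ext
      simp only [LinearMap.comp_apply]
      change f (indRep H φ g (Representation.IndV.mk H.subtype (rankOne φ) g' 1)) =
        σ g (f (Representation.IndV.mk H.subtype (rankOne φ) g' 1))
      rw [Representation.ind_mk, hf, hf, mul_inv_rev, inv_inv, one_smul, one_smul, map_mul,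
        Module.End.mul_apply]
    exact LinearMap.congr_fun this s
  · rw [indGen, hf]; simp

instance [Finite G] : Module.Finite (ZpZeta p) (Representation.IndV H.subtype (rankOne φ)) := by
  refine ⟨Submodule.fg_def.2 ⟨Set.range fun g => indRep H φ g (indGen H φ), Set.finite_range _, ?_⟩⟩
  rw [eq_top_iff]
  exact fun s _ => mem_span_indGen φ s

open Classical in
/-- The coordinate of an element of an induced module at the generator. It is obtained from the map
to the coinduced module. -/
theorem exists_coordinate :
    ∃ l : Representation.IndV H.subtype (rankOne φ) →ₗ[ZpZeta p] ZpZeta p,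
      ∀ g, l (indRep H φ g (indGen H φ)) =
        if hg : g ∈ H then ((φ ⟨g, hg⟩ : (ZpZeta p)ˣ) : ZpZeta p) else 0 := by
  let σ : Representation (ZpZeta p) G (G → ZpZeta p) :=
    { toFun g := LinearMap.funLeft (ZpZeta p) (ZpZeta p) (· * g)
      map_one' := by ext; simp [LinearMap.funLeft]
      map_mul' g h := by ext; simp [LinearMap.funLeft, mul_assoc] }
  have hσ : ∀ g F a, σ g F a = F (a * g) := fun g F a => rfl
  let y : G → ZpZeta p := fun g => if hg : g ∈ H then ((φ ⟨g, hg⟩ : (ZpZeta p)ˣ) : ZpZeta p) else 0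
  obtain ⟨f, hf, hfx⟩ := exists_indRep_lift φ σ y (by
    intro h
    ext a
    rw [hσ, Pi.smul_apply, smul_eq_mul]
    by_cases ha : a ∈ H
    · have : a * h ∈ H := H.mul_mem ha h.2
      have e : (⟨a * h, this⟩ : H) = ⟨a, ha⟩ * h := rfl
      simp only [y, dif_pos ha, dif_pos this, e, map_mul, Subgroup.coe_mul, Units.val_mul]
      rw [mul_comm]
    · have : a * h ∉ H := fun h1 => ha ((H.mul_mem_cancel_right h.2).1 h1)
      simp only [y, dif_neg ha, dif_neg this, mul_zero])
  refine ⟨LinearMap.proj 1 ∘ₗ f, fun g => ?_⟩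
  rw [LinearMap.comp_apply, hf, hfx, LinearMap.proj_apply, hσ, one_mul]

/-- The augmentation of an induced module, with values in `𝔽_p`. -/
theorem exists_augmentation :
    ∃ ε : Representation.IndV H.subtype (rankOne φ) →+ ZMod p,
      (∀ (r : ZpZeta p) s, ε (r • s) = residue p r * ε s) ∧
      (∀ g s, ε (indRep H φ g s) = ε s) ∧ ε (indGen H φ) = 1 := by
  let : Module (ZpZeta p) (ZMod p) := Module.compHom (ZMod p) (residue p)
  have hsmul : ∀ (r : ZpZeta p) (a : ZMod p), r • a = residue p r * a := fun r a => rfl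
  obtain ⟨f, hf, hfx⟩ := exists_indRep_lift φ (1 : Representation (ZpZeta p) G (ZMod p)) 1 (by
    intro h
    rw [hsmul, residue_zpowers, one_mul]
    rfl)
  exact ⟨f.toAddMonoidHom, fun r s => f.map_smul r s, fun g s => hf g s, hfx⟩

theorem asModule_map_rep {W W' : Type*} [AddCommGroup W] [Module (ZpZeta p) W] [AddCommGroup W']
    [Module (ZpZeta p) W'] {σ : Representation (ZpZeta p) G W}
    {σ' : Representation (ZpZeta p) G W'}
    (f : σ.asModule →ₗ[MonoidAlgebra (ZpZeta p) G] σ'.asModule) (g : G) (x : W) :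
    f (σ g x : W) = σ' g (f x : W') :=
  Representation.IntertwiningMap.isIntertwining _ _
    ((Representation.IntertwiningMap.equivLinearMapAsModule σ σ').symm f) g x

theorem asModule_map_smul {W W' : Type*} [AddCommGroup W] [Module (ZpZeta p) W] [AddCommGroup W']
    [Module (ZpZeta p) W'] {σ : Representation (ZpZeta p) G W}
    {σ' : Representation (ZpZeta p) G W'}
    (f : σ.asModule →ₗ[MonoidAlgebra (ZpZeta p) G] σ'.asModule) (r : ZpZeta p) (x : W) :
    f (r • x : W) = (r • (f x : W') : W') :=
  ((Representation.IntertwiningMap.equivLinearMapAsModule σ σ').symm f).toLinearMap.map_smul r x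

/-- The endomorphisms outside the kernel of the augmentation at the generator are surjective by the
uniqueness of the maximal submodule, hence bijective. -/
theorem hasLocalEnd_indRep [Finite G] (hG : IsPGroup p G) :
    HasLocalEnd (MonoidAlgebra (ZpZeta p) G) (indRep H φ).asModule := by
  obtain ⟨ε, hε, hεG, hε1⟩ := exists_augmentation φ
  constructor
  · refine ⟨⟨(indGen H φ : Representation.IndV H.subtype (rankOne φ)),
      (0 : Representation.IndV H.subtype (rankOne φ)), fun h => ?_⟩⟩
    rw [h, map_zero] at hε1
    exact zero_ne_one hε1
  · have key : ∀ f : (indRep H φ).asModule →ₗ[MonoidAlgebra (ZpZeta p) G] (indRep H φ).asModule,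
        ε (f (indGen H φ)) ≠ 0 → Function.Bijective f := by
      intro f hf
      let f' : Representation.IndV H.subtype (rankOne φ) →ₗ[ZpZeta p]
          Representation.IndV H.subtype (rankOne φ) :=
        ((Representation.IntertwiningMap.equivLinearMapAsModule _ _).symm f).toLinearMap
      have hsurj : Function.Surjective f' := by
        rw [← LinearMap.range_eq_top]
        refine eq_top_of_augmentation_ne_zero hG (indRep H φ) (indGen H φ) (mem_span_indGen φ) ε hε
          hεG hε1 _ ?_ (f' (indGen H φ)) ⟨_, rfl⟩ hf
        rintro g _ ⟨x, rfl⟩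
        exact ⟨indRep H φ g x, asModule_map_rep f g x⟩
      exact ⟨OrzechProperty.injective_of_surjective_endomorphism f' hsurj, hsurj⟩
    intro f
    by_cases h : ε (f (indGen H φ)) = 0
    · right
      apply key
      let y : Representation.IndV H.subtype (rankOne φ) := f (indGen H φ)
      have h2 : ε (indGen H φ - y) = 1 := by
        rw [map_sub, hε1]
        change 1 - ε (f (indGen H φ)) = 1
        rw [h, sub_zero]
      intro h3
      exact zero_ne_one (h3.symm.trans h2)
    · exact Or.inl (key f h)

end Induced

open Topology Filter

/-! ### Finitely generated profinite modules -/

section Profinite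

/-- The subgroup `p ^ m F`. -/
def powMul (p : ℕ) (m : ℕ) (F : Type*) [AddCommGroup F] : AddSubgroup F :=
  (nsmulAddMonoidHom (α := F) (p ^ m)).range

theorem mem_powMul {m : ℕ} {F : Type*} [AddCommGroup F] {x : F} :
    x ∈ powMul p m F ↔ ∃ z, x = p ^ m • z := by
  simp [powMul, AddMonoidHom.mem_range, eq_comm]

variable {p : ℕ} [Fact p.Prime]

/-- In a compact `ℤ_p`-module the submodules `p ^ m M` tend to zero. -/
theorem exists_pow_nsmul_mem {M : Type*} [AddCommGroup M] [Module ℤ_[p] M] [TopologicalSpace M]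
    [ContinuousSMul ℤ_[p] M] [CompactSpace M] {W : Set M} (hW : W ∈ 𝓝 (0 : M)) :
    ∃ m : ℕ, ∀ z : M, p ^ m • z ∈ W := by
  obtain ⟨W', hW'W, hW'o, hW'0⟩ := mem_nhds_iff.1 hW
  obtain ⟨u, v, hu, -, hu0, hv, huv⟩ := generalized_tube_lemma
    (s := ({0} : Set ℤ_[p])) isCompact_singleton (t := (Set.univ : Set M)) isCompact_univ
    (n := (fun q : ℤ_[p] × M => q.1 • q.2) ⁻¹' W')
    (hW'o.preimage continuous_smul) (by
      rintro ⟨a, x⟩ ⟨ha, -⟩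
      rw [Set.mem_singleton_iff] at ha
      change a • x ∈ W'
      rwa [show a = 0 from ha, zero_smul])
  have ht : Tendsto (fun m : ℕ => (p : ℤ_[p]) ^ m) atTop (𝓝 0) :=
    tendsto_pow_atTop_nhds_zero_of_norm_lt_one (by
      rw [PadicInt.norm_p]
      exact inv_lt_one_of_one_lt₀ (by exact_mod_cast (Fact.out : p.Prime).one_lt))
  obtain ⟨m, hm⟩ := (ht.eventually (hu.mem_nhds (hu0 rfl))).exists
  refine ⟨m, fun z => hW'W ?_⟩
  have : ((p : ℤ_[p]) ^ m, z) ∈ u ×ˢ v := ⟨hm, hv trivial⟩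
  have h2 := huv this
  have e : ((p : ℤ_[p]) ^ m) • z = p ^ m • z := by
    rw [← Nat.cast_pow, Nat.cast_smul_eq_nsmul]
  rw [← e]
  exact h2

theorem isOpen_setOf_pow_dvd (m : ℕ) : IsOpen {z : ℤ_[p] | (p : ℤ_[p]) ^ m ∣ z} := by
  have : {z : ℤ_[p] | (p : ℤ_[p]) ^ m ∣ z} = Metric.closedBall 0 ((p : ℝ) ^ (-m : ℤ)) := by
    ext z
    rw [mem_closedBall_zero_iff, PadicInt.norm_le_pow_iff_mem_span_pow, Ideal.mem_span_singleton]
    rfl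
  rw [this]
  refine IsUltrametricDist.isOpen_closedBall _ (zpow_ne_zero _ ?_)
  exact_mod_cast (Fact.out : p.Prime).ne_zero

instance : IsModuleTopology ℤ_[p] (ZpZeta p) := ⟨rfl⟩

theorem continuous_algebraMap_zpZeta : Continuous (algebraMap ℤ_[p] (ZpZeta p)) := by
  have h := IsModuleTopology.toContinuousSMul ℤ_[p] (ZpZeta p)
  have : (algebraMap ℤ_[p] (ZpZeta p) : ℤ_[p] → ZpZeta p) = fun z => z • (1 : ZpZeta p) := by
    ext z; rw [Algebra.algebraMap_eq_smul_one]
  rw [this]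
  exact (continuous_id (X := ℤ_[p])).smul (continuous_const (y := (1 : ZpZeta p)))

variable {F : Type*} [AddCommGroup F] [Module (ZpZeta p) F] [TopologicalSpace F]

/-- A finitely generated profinite `ℤ_p(ζ)`-module is an open quotient of some `ℤ_p ^ n`. -/
theorem exists_open_cover [Module.Finite (ZpZeta p) F] (hF : IsProfiniteModule (ZpZeta p) F) :
    ∃ (n : ℕ) (y : Fin n → F) (g : (Fin n → ℤ_[p]) →+ F),
      (∀ z, g z = ∑ i, algebraMap ℤ_[p] (ZpZeta p) (z i) • y i) ∧
      Function.Surjective g ∧ Continuous g ∧ IsOpenMap g := by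
  have := hF.isTopologicalAddGroup
  have := hF.continuousSMul
  have := hF.compactSpace
  have := hF.t2Space
  let : Module ℤ_[p] F := Module.compHom F (algebraMap ℤ_[p] (ZpZeta p))
  have : IsScalarTower ℤ_[p] (ZpZeta p) F :=
    ⟨fun a b x => by rw [Algebra.smul_def, mul_smul]; rfl⟩
  have : Module.Finite ℤ_[p] F := Module.Finite.trans (ZpZeta p) F
  obtain ⟨n, f, hf⟩ := Module.Finite.exists_fin' ℤ_[p] F
  have hfy : ∀ z, f z = ∑ i, algebraMap ℤ_[p] (ZpZeta p) (z i) • f (Pi.single i 1) := by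
    intro z
    conv_lhs => rw [LinearMap.pi_apply_eq_sum_univ f z]
    refine Finset.sum_congr rfl fun i _ => ?_
    have e : (fun j => if i = j then (1 : ℤ_[p]) else 0) = Pi.single i 1 := by
      ext j
      simp [Pi.single_apply, eq_comm]
    rw [e]
    rfl
  have hcont : Continuous f := by
    have e : (f : (Fin n → ℤ_[p]) → F) =
        fun z => ∑ i, algebraMap ℤ_[p] (ZpZeta p) (z i) • f (Pi.single i 1) := funext hfy
    rw [e]
    refine continuous_finsetSum _ fun i _ => ?_
    exact (continuous_algebraMap_zpZeta.comp (continuous_apply i)).smul continuous_const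
  exact ⟨n, fun i => f (Pi.single i 1), f.toAddMonoidHom, hfy, hf, hcont,
    AddMonoidHom.isOpenMap_of_sigmaCompact f.toAddMonoidHom hf hcont⟩

theorem continuous_of_finite [Module.Finite (ZpZeta p) F] (hF : IsProfiniteModule (ZpZeta p) F)
    {M : Type*} [AddCommGroup M] [Module (ZpZeta p) M] [TopologicalSpace M]
    [IsTopologicalAddGroup M] [ContinuousSMul (ZpZeta p) M] (f : F →ₗ[ZpZeta p] M) :
    Continuous f := by
  obtain ⟨n, y, g, hg, hsurj, hcont, hopen⟩ := exists_open_cover hF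
  rw [(hopen.isQuotientMap hcont hsurj).continuous_iff]
  have e : (f : F → M) ∘ g = fun z => ∑ i, algebraMap ℤ_[p] (ZpZeta p) (z i) • f (y i) := by
    ext z; simp [hg]
  rw [e]
  refine continuous_finsetSum _ fun i _ => ?_
  exact (continuous_algebraMap_zpZeta.comp (continuous_apply i)).smul continuous_const

theorem isOpen_pow_nsmul [Module.Finite (ZpZeta p) F] (hF : IsProfiniteModule (ZpZeta p) F)
    (m : ℕ) : IsOpen (powMul p m F : Set F) := by
  obtain ⟨n, y, g, hg, hsurj, hcont, hopen⟩ := exists_open_cover hF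
  have e : (powMul p m F : Set F) = g '' (⋂ i, {z | (p : ℤ_[p]) ^ m ∣ z i}) := by
    ext x
    rw [SetLike.mem_coe, mem_powMul]
    constructor
    · rintro ⟨z, rfl⟩
      obtain ⟨c, rfl⟩ := hsurj z
      refine ⟨p ^ m • c, ?_, map_nsmul _ _ _⟩
      rw [Set.mem_iInter]
      intro i
      exact ⟨c i, by simp⟩
    · rintro ⟨c, hc, rfl⟩
      rw [Set.mem_iInter] at hc
      choose d hd using hc
      refine ⟨g d, ?_⟩
      rw [← map_nsmul]
      congr 1
      ext i
      simp [hd i]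
  rw [e]
  exact hopen _ (isOpen_iInter_of_finite fun i =>
    (isOpen_setOf_pow_dvd m).preimage
      (continuous_apply i : Continuous fun z : Fin n → ℤ_[p] => z i))

theorem exists_pow_nsmul_mem' (hF : IsProfiniteModule (ZpZeta p) F) {W : Set F}
    (hW : W ∈ 𝓝 (0 : F)) : ∃ m : ℕ, ∀ z : F, p ^ m • z ∈ W := by
  have := hF.continuousSMul
  have := hF.compactSpace
  let : Module ℤ_[p] F := Module.compHom F (algebraMap ℤ_[p] (ZpZeta p))
  have : ContinuousSMul ℤ_[p] F :=
    ⟨(continuous_algebraMap_zpZeta.comp continuous_fst).smul continuous_snd⟩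
  exact exists_pow_nsmul_mem hW

end Profinite

/-! ### Approximation of a limit by its stages -/

section Limit

/-- A compatible family exists in an inverse system of compact spaces as soon as the conditions on
it can be satisfied at each late stage. -/
theorem exists_thread {I : Type*} [Preorder I] [IsDirectedOrder I] {F : I → Type*}
    [∀ i, TopologicalSpace (F i)] [∀ i, CompactSpace (F i)] [∀ i, T2Space (F i)]
    [∀ i, Nonempty (F i)] (t : ∀ i j, i ≤ j → F j → F i) (ht : ∀ i j h, Continuous (t i j h))
    (htt : ∀ i j k (hij : i ≤ j) (hjk : j ≤ k) x, t i j hij (t j k hjk x) = t i k (hij.trans hjk) x)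
    (hid : ∀ i x, t i i le_rfl x = x)
    (Z : ∀ i, Set (F i)) (hZ : ∀ i, IsClosed (Z i))
    (htZ : ∀ i j h, ∀ x ∈ Z j, t i j h x ∈ Z i)
    (i₀ : I) (B : Set (F i₀)) (hB : IsClosed B)
    (hne : ∀ j (h : i₀ ≤ j), ∃ x ∈ Z j, t i₀ j h x ∈ B) :
    ∃ x : ∀ i, F i, (∀ i j h, t i j h (x j) = x i) ∧ (∀ i, x i ∈ Z i) ∧ x i₀ ∈ B := by
  classical
  let C : {j // i₀ ≤ j} → Set (∀ i, F i) := fun j =>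
    {x | (∀ k (h : k ≤ j.1), t k j.1 h (x j.1) = x k) ∧ x j.1 ∈ Z j.1 ∧ x i₀ ∈ B}
  have hCclosed : ∀ j, IsClosed (C j) := by
    intro j
    have e : C j = (⋂ (k) (h : k ≤ j.1), {x | t k j.1 h (x j.1) = x k}) ∩
        ((fun x : ∀ i, F i => x j.1) ⁻¹' Z j.1 ∩ (fun x : ∀ i, F i => x i₀) ⁻¹' B) := by
      ext x
      simp [C]
    rw [e]
    refine IsClosed.inter (isClosed_iInter fun k => isClosed_iInter fun h => ?_)
      (((hZ _).preimage (continuous_apply _)).inter (hB.preimage (continuous_apply _)))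
    exact isClosed_eq ((ht _ _ h).comp (continuous_apply _)) (continuous_apply _)
  have hCne : ∀ j, (C j).Nonempty := by
    rintro ⟨j, hj⟩
    obtain ⟨x, hx, hxB⟩ := hne j hj
    refine ⟨fun k => if h : k ≤ j then t k j h x else Classical.arbitrary _, ?_, ?_, ?_⟩
    · intro k h
      simp [h, hid]
    · simpa [hid] using hx
    · simpa [hj] using hxB
  have hCdir : Directed (· ⊇ ·) C := by
    rintro ⟨j, hj⟩ ⟨k, hk⟩
    obtain ⟨l, hjl, hkl⟩ := exists_ge_ge j k
    have key : ∀ (a : I) (ha : i₀ ≤ a) (hal : a ≤ l), C ⟨a, ha⟩ ⊇ C ⟨l, hj.trans hjl⟩ := by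
      rintro a ha hal x ⟨h1, h2, h3⟩
      refine ⟨fun b hb => ?_, ?_, h3⟩
      · have h4 := h1 a hal
        change t b a hb (x a) = x b
        rw [← h4, htt]
        exact h1 b (hb.trans hal)
      · have h4 := h1 a hal
        change x a ∈ Z a
        rw [← h4]
        exact htZ _ _ _ _ h2
    exact ⟨⟨l, hj.trans hjl⟩, key j hj hjl, key k hk hkl⟩
  have : Nonempty {j // i₀ ≤ j} := ⟨⟨i₀, le_rfl⟩⟩
  obtain ⟨x, hx⟩ := IsCompact.nonempty_iInter_of_directed_nonempty_isCompact_isClosed C hCdir hCne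
    (fun j => (hCclosed j).isCompact) hCclosed
  rw [Set.mem_iInter] at hx
  have hlate : ∀ i, ∃ j, i ≤ j ∧ i₀ ≤ j := fun i => exists_ge_ge i i₀
  refine ⟨x, fun i j h => ?_, fun i => ?_, (hx ⟨i₀, le_rfl⟩).2.2⟩
  · obtain ⟨k, hjk, hk⟩ := hlate j
    have h1 := (hx ⟨k, hk⟩).1
    rw [← h1 j hjk, ← h1 i (h.trans hjk), htt]
  · obtain ⟨k, hik, hk⟩ := hlate i
    have h1 := hx ⟨k, hk⟩
    rw [← h1.1 i hik]
    exact htZ _ _ _ _ h1.2.1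

variable {p : ℕ} [Fact p.Prime] {G : Type v} [Group G]

theorem finite_of_isFiniteGenPerm [Finite G] {F : Type w} [AddCommGroup F] [Module (ZpZeta p) F]
    {σ : Representation (ZpZeta p) G F} (h : IsFiniteGenPerm σ) : Module.Finite (ZpZeta p) F := by
  obtain ⟨n, H, φ, ⟨e⟩⟩ := h
  have : Module.Finite (ZpZeta p)
      (DirectSum (Fin n) fun k => Representation.IndV (H k).subtype (rankOne (φ k))) :=
    Module.Finite.equiv
      (DirectSum.linearEquivFunOnFintype (ZpZeta p) (Fin n)
        (fun k => Representation.IndV (H k).subtype (rankOne (φ k)))).symm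
  exact Module.Finite.equiv e.toLinearEquiv.symm

variable {V : Type u} [AddCommGroup V] [Module (ZpZeta p) V]

/-- The elements on which `H` acts through `φ`. -/
def eigenspace (τ : Representation (ZpZeta p) G V) (H : Subgroup G)
    (φ : H →* Subgroup.zpowers (zeta p)) : Set V :=
  {y | ∀ h : H, τ h y = ((φ h : (ZpZeta p)ˣ) : ZpZeta p) • y}

/-- A limit `V` of generalized permutation lattices is approximated by its stages: modulo any
neighbourhood of zero, the identity of `V` factors through a finitely generated generalized
permutation lattice, because the generators of a late stage can be approximated by eigenvectors
of the same kind in `V`. -/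
theorem IsGenPerm.exists_approximation [Finite G] [TopologicalSpace V]
    {τ : Representation (ZpZeta p) G V} (hτ : IsGenPerm.{u, v, w} τ) {O : Set V}
    (hO : O ∈ 𝓝 (0 : V)) :
    ∃ B : AddSubgroup V, (B : Set V) ∈ 𝓝 0 ∧ (B : Set V) ⊆ O ∧ (∃ m, powMul p m V ≤ B) ∧
    ∃ (n : ℕ) (H : Fin n → Subgroup G) (φ : ∀ a, H a →* Subgroup.zpowers (zeta p))
      (h : ∀ a, Representation.IndV (H a).subtype (rankOne (φ a)) →ₗ[ZpZeta p] V)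
      (π : ∀ a, V →ₗ[ZpZeta p] Representation.IndV (H a).subtype (rankOne (φ a))),
      (∀ a g x, h a (indRep (H a) (φ a) g x) = τ g (h a x)) ∧
      (∀ a g y, π a (τ g y) = indRep (H a) (φ a) g (π a y)) ∧
      (∀ a m, {y | π a y ∈ powMul p m _} ∈ 𝓝 (0 : V)) ∧
      ∀ y, y - ∑ a, h a (π a y) ∈ B := by
  classical
  obtain ⟨I, _, _, _, F, _, _, _, σ, t, π, hF, hσ, htσ, hid, htt, hπσ, htπ, hlim, htop⟩ := hτ
  have hfin : ∀ i, Module.Finite (ZpZeta p) (F i) := fun i => finite_of_isFiniteGenPerm (hσ i)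
  have := fun i => (hF i).isTopologicalAddGroup
  have := fun i => (hF i).continuousSMul
  have := fun i => (hF i).compactSpace
  have := fun i => (hF i).t2Space
  -- a basis of neighbourhoods of zero
  have hnhds : 𝓝 (0 : V) = ⨅ i, comap (π i) (𝓝 0) := by
    have h1 : (‹TopologicalSpace V› : TopologicalSpace V) =
      ⨅ i, TopologicalSpace.induced (π i) inferInstance := htop
    conv_lhs => rw [h1]
    rw [nhds_iInf]
    simp [nhds_induced]
  have hdir : Directed (· ≥ ·) fun i => comap (π i) (𝓝 (0 : F i)) := by
    have key : ∀ i j, i ≤ j → comap (π j) (𝓝 (0 : F j)) ≤ comap (π i) (𝓝 (0 : F i)) := by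
      intro i j hij
      have h1 : (π i : V → F i) = t i j hij ∘ π j := by
        ext y; exact (htπ i j hij y).symm
      rw [h1, ← comap_comap]
      refine comap_mono (map_le_iff_le_comap.1 ?_)
      have := (t i j hij).continuous.tendsto 0
      rwa [map_zero] at this
    intro i j
    obtain ⟨k, hik, hjk⟩ := exists_ge_ge i j
    exact ⟨k, key i k hik, key j k hjk⟩
  have hpow : ∀ i m, (powMul p m (F i) : Set (F i)) ∈ 𝓝 0 := fun i m =>
    (isOpen_pow_nsmul (hF i) m).mem_nhds (zero_mem _)
  have hbasis : ∀ i m, {y | π i y ∈ powMul p m (F i)} ∈ 𝓝 (0 : V) := by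
    intro i m
    rw [hnhds]
    exact mem_iInf_of_mem i (preimage_mem_comap (hpow i m))
  have hO' := hO
  rw [hnhds, mem_iInf_of_directed hdir] at hO'
  obtain ⟨i, hi⟩ := hO'
  obtain ⟨W, hW, hWO⟩ := hi
  obtain ⟨m, hm⟩ := exists_pow_nsmul_mem' (hF i) hW
  let B : AddSubgroup V := (powMul p m (F i)).comap (π i).toLinearMap.toAddMonoidHom
  have hB : ∀ y, y ∈ B ↔ π i y ∈ powMul p m (F i) := fun y => Iff.rfl
  refine ⟨B, hbasis i m, ?_, ⟨m, ?_⟩, ?_⟩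
  · intro y hy
    apply hWO
    obtain ⟨z, hz⟩ := mem_powMul.1 ((hB y).1 hy)
    change π i y ∈ W
    rw [hz]
    exact hm z
  · intro y hy
    obtain ⟨z, rfl⟩ := mem_powMul.1 hy
    rw [hB, map_nsmul]
    exact mem_powMul.2 ⟨_, rfl⟩
  -- late stages map eigenvectors close to eigenvectors of `V`
  have hstage : ∀ (q : Σ H : Subgroup G, H →* Subgroup.zpowers (zeta p)),
      ∃ j, ∃ h : i ≤ j, ∀ x ∈ eigenspace (σ j) q.1 q.2, ∃ y ∈ eigenspace τ q.1 q.2,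
        π i y - t i j h x ∈ powMul p m (F i) := by
    rintro ⟨H, φ⟩
    by_contra hcon
    push Not at hcon
    obtain ⟨x, hx, hxZ, hxB⟩ := exists_thread (fun i j h x => t i j h x)
      (fun i j h => (t i j h).continuous) htt hid (fun j => eigenspace (σ j) H φ)
      (fun j => by
        have e : eigenspace (σ j) H φ =
            ⋂ h : H, {y | σ j h y = ((φ h : (ZpZeta p)ˣ) : ZpZeta p) • y} := by
          ext y; simp [eigenspace]
        rw [e]
        exact isClosed_iInter fun h => isClosed_eq (continuous_of_finite (hF j) (σ j h))
          (continuous_const_smul _))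
      (fun k j hkj x hx h => by
        rw [← htσ, hx h, map_smul])
      i {x | ∀ y ∈ eigenspace τ H φ, π i y - x ∉ powMul p m (F i)}
      (by
        have e : {x | ∀ y ∈ eigenspace τ H φ, π i y - x ∉ powMul p m (F i)} =
            ⋂ y ∈ eigenspace τ H φ, {x | π i y - x ∈ powMul p m (F i)}ᶜ := by
          ext x; simp
        rw [e]
        refine isClosed_biInter fun y _ => isClosed_compl_iff.2 ?_
        exact (isOpen_pow_nsmul (hF i) m).preimage (continuous_const.sub continuous_id))
      (fun j h => by
        obtain ⟨x, hx, hx'⟩ := hcon j h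
        exact ⟨x, hx, hx'⟩)
    obtain ⟨y, hy, huniq⟩ := hlim x hx
    refine hxB y ?_ ?_
    · intro h
      obtain ⟨z, hz, hzu⟩ := hlim (fun j => σ j h (x j)) (fun i j hij => by rw [htσ, hx])
      rw [hzu (τ h y) (fun j => by rw [hπσ, hy]), hzu (((φ h : (ZpZeta p)ˣ) : ZpZeta p) • y)]
      intro j
      simp only [map_smul, hy]
      exact (hxZ j h).symm
    · rw [hy, sub_self]
      exact zero_mem _
  choose j hij hj using hstage
  have : Finite (Subgroup.zpowers (zeta p)) :=
    finite_zpowers.2 (isOfFinOrder_iff_pow_eq_one.2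
      ⟨p, (Fact.out : p.Prime).pos, zeta_pow_eq_one p⟩)
  have : Finite (Σ H : Subgroup G, H →* Subgroup.zpowers (zeta p)) := by
    have : ∀ H : Subgroup G, Finite (H →* Subgroup.zpowers (zeta p)) := fun H =>
      Finite.of_injective (fun f : H →* Subgroup.zpowers (zeta p) => (f : H → _))
        DFunLike.coe_injective
    infer_instance
  obtain ⟨k, hk⟩ := Finite.exists_le j
  have hik : i ≤ k := (hij ⟨⊥, 1⟩).trans (hk _)
  have hgood : ∀ (H : Subgroup G) (φ : H →* Subgroup.zpowers (zeta p)),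
      ∀ x ∈ eigenspace (σ k) H φ, ∃ y ∈ eigenspace τ H φ,
        π i y - t i k hik x ∈ powMul p m (F i) := by
    intro H φ x hx
    have hjk := hk ⟨H, φ⟩
    obtain ⟨y, hy, hyx⟩ := hj ⟨H, φ⟩ (t _ _ hjk x) (fun h => by rw [← htσ, hx h, map_smul])
    rw [htt] at hyx
    exact ⟨y, hy, hyx⟩
  obtain ⟨n, H, φ, ⟨e⟩⟩ := hσ k
  let inc : ∀ a, Representation.IndV (H a).subtype (rankOne (φ a)) →ₗ[ZpZeta p] F k := fun a =>
    e.symm.toLinearEquiv.toLinearMap ∘ₗ DirectSum.lof (ZpZeta p) (Fin n)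
      (fun a => Representation.IndV (H a).subtype (rankOne (φ a))) a
  let pr : ∀ a, F k →ₗ[ZpZeta p] Representation.IndV (H a).subtype (rankOne (φ a)) := fun a =>
    DirectSum.component (ZpZeta p) (Fin n)
      (fun a => Representation.IndV (H a).subtype (rankOne (φ a))) a ∘ₗ e.toLinearEquiv.toLinearMap
  have he : ∀ g x, e (σ k g x) = Representation.directSum
      (fun a => Representation.ind (H a).subtype (rankOne (φ a))) g (e x) := fun g x =>
    Representation.IntertwiningMap.isIntertwining _ _ e.toIntertwiningMap g x
  have he' : ∀ g x, e.symm (Representation.directSum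
      (fun a => Representation.ind (H a).subtype (rankOne (φ a))) g x) = σ k g (e.symm x) :=
    fun g x => Representation.IntertwiningMap.isIntertwining _ _ e.symm.toIntertwiningMap g x
  have hpr : ∀ a g x, pr a (σ k g x) = indRep (H a) (φ a) g (pr a x) := by
    intro a g x
    change e (σ k g x) a = _
    rw [he]
    exact DirectSum.lmap_apply _ _ _
  have hinc : ∀ a g x, inc a (indRep (H a) (φ a) g x) = σ k g (inc a x) := by
    intro a g x
    change e.symm (DirectSum.lof _ _ _ a _) = σ k g (e.symm (DirectSum.lof _ _ _ a x))
    rw [← he']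
    congr 1
    exact (DirectSum.lmap_lof (fun a => indRep (H a) (φ a) g) a x).symm
  have hsum : ∀ x, ∑ a, inc a (pr a x) = x := by
    intro x
    change ∑ a, e.symm (DirectSum.lof _ _ _ a (e x a)) = x
    rw [← map_sum]
    have h1 : ∑ a, DirectSum.lof (ZpZeta p) (Fin n)
        (fun a => Representation.IndV (H a).subtype (rankOne (φ a))) a (e x a) = e x := by
      ext a
      simp [DirectSum.sum_apply, DirectSum.lof_eq_of, DirectSum.of_apply]
    rw [h1]
    exact e.symm_apply_apply x
  have hch : ∀ a, ∃ y ∈ eigenspace τ (H a) (φ a),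
      π i y - t i k hik (inc a (indGen (H a) (φ a))) ∈ powMul p m (F i) := fun a =>
    hgood (H a) (φ a) _ (fun h => by rw [← hinc, indRep_mem, map_smul])
  choose y hy hyi using hch
  choose f hf hfy using fun a => exists_indRep_lift (φ a) τ (y a) (hy a)
  have hclose : ∀ a s, π i (f a s) - t i k hik (inc a s) ∈ powMul p m (F i) := by
    intro a s
    induction mem_span_indGen (φ a) s using Submodule.span_induction with
    | mem s hs =>
      obtain ⟨g, rfl⟩ := hs
      obtain ⟨z, hz⟩ := mem_powMul.1 (hyi a)
      simp only
      rw [hf, hπσ, hinc, htσ, hfy, ← map_sub, hz, map_nsmul]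
      exact mem_powMul.2 ⟨_, rfl⟩
    | zero => simp
    | add s s' _ _ h1 h2 =>
      simp only [map_add]
      rw [add_sub_add_comm]
      exact add_mem h1 h2
    | smul r s _ h1 =>
      simp only [map_smul]
      rw [← smul_sub]
      obtain ⟨z, hz⟩ := mem_powMul.1 h1
      rw [hz, smul_comm]
      exact mem_powMul.2 ⟨_, rfl⟩
  refine ⟨n, H, φ, f, fun a => pr a ∘ₗ (π k).toLinearMap, hf, ?_, ?_, ?_⟩
  · intro a g y
    simp only [LinearMap.comp_apply, ContinuousLinearMap.coe_coe]
    rw [hπσ, hpr]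
  · intro a m'
    refine mem_of_superset (hbasis k m') fun y hy => ?_
    obtain ⟨z, hz⟩ := mem_powMul.1 hy
    rw [Set.mem_ofPred_eq, LinearMap.comp_apply, ContinuousLinearMap.coe_coe, hz, map_nsmul]
    exact mem_powMul.2 ⟨_, rfl⟩
  · intro y
    rw [hB, map_sub, map_sum, ← neg_sub, neg_mem_iff]
    have e1 : π i y = ∑ a, t i k hik (inc a (pr a (π k y))) := by
      rw [← map_sum, hsum, htπ]
    rw [e1, ← Finset.sum_sub_distrib]
    exact sum_mem fun a _ => hclose a _

end Limit

/-! ### Decomposition of a profinite generalized permutation lattice -/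

section Decomposition

variable {p : ℕ} [Fact p.Prime] {G : Type v} [Group G]
  {V : Type u} [AddCommGroup V] [Module (ZpZeta p) V]

/-- A finite family of induced modules, with homomorphisms to and from `V`. -/
structure Block (τ : Representation (ZpZeta p) G V) where
  /-- the index set -/
  T : Type
  [fintype : Fintype T]
  /-- the subgroups from which the modules are induced -/
  H : T → Subgroup G
  /-- the characters of these subgroups -/
  φ : ∀ a, H a →* Subgroup.zpowers (zeta p)
  /-- the maps to `V` -/
  h : ∀ a, (indRep (H a) (φ a)).asModule →ₗ[MonoidAlgebra (ZpZeta p) G] τ.asModule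
  /-- the maps from `V` -/
  π : ∀ a, τ.asModule →ₗ[MonoidAlgebra (ZpZeta p) G] (indRep (H a) (φ a)).asModule

attribute [instance] Block.fintype

variable {τ : Representation (ZpZeta p) G V}

/-- The endomorphism of `V` that factors through the family. -/
noncomputable def Block.proj (b : Block τ) :
    τ.asModule →ₗ[MonoidAlgebra (ZpZeta p) G] τ.asModule :=
  ∑ a, b.h a ∘ₗ b.π a

theorem Block.proj_apply (b : Block τ) (y : τ.asModule) : b.proj y = ∑ a, b.h a (b.π a y) := by
  simp [Block.proj]

variable [TopologicalSpace V]

/-- A continuous idempotent endomorphism. -/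
structure IsContinuousProjection
    (q : τ.asModule →ₗ[MonoidAlgebra (ZpZeta p) G] τ.asModule) : Prop where
  idem : ∀ x, q (q x) = q x
  cont : ∀ O ∈ 𝓝 (0 : V), (fun y : V => (q y : V)) ⁻¹' O ∈ 𝓝 (0 : V)

/-- The family splits off a direct summand of the image of `q`. -/
structure Block.SplitsOff (b : Block τ)
    (q : τ.asModule →ₗ[MonoidAlgebra (ZpZeta p) G] τ.asModule) : Prop where
  q_h : ∀ a x, q (b.h a x) = b.h a x
  π_q : ∀ a x, b.π a (q x) = b.π a x
  dual : ∀ a x, b.π a (b.h a x) = x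
  orth : ∀ a c, a ≠ c → ∀ x, b.π a (b.h c x) = 0
  cont : ∀ a m, {y : V | b.π a y ∈ powMul p m _} ∈ 𝓝 (0 : V)

theorem Block.SplitsOff.π_proj {b : Block τ} {q} (hb : b.SplitsOff q) (a : b.T) (y : τ.asModule) :
    b.π a (b.proj y) = b.π a y := by
  rw [b.proj_apply, map_sum, Finset.sum_eq_single_of_mem a (Finset.mem_univ a), hb.dual]
  intro c _ hca
  exact hb.orth a c hca.symm _

theorem Block.SplitsOff.proj_h {b : Block τ} {q} (hb : b.SplitsOff q) (a : b.T) (x) :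
    b.proj (b.h a x) = b.h a x := by
  rw [b.proj_apply, Finset.sum_eq_single_of_mem a (Finset.mem_univ a), hb.dual]
  intro c _ hca
  rw [hb.orth c a hca, map_zero]

theorem Block.SplitsOff.q_proj {b : Block τ} {q} (hb : b.SplitsOff q) (y : τ.asModule) :
    q (b.proj y) = b.proj y := by
  rw [b.proj_apply, map_sum]
  exact Finset.sum_congr rfl fun a _ => hb.q_h a _

theorem Block.SplitsOff.proj_q {b : Block τ} {q} (hb : b.SplitsOff q) (y : τ.asModule) :
    b.proj (q y) = b.proj y := by
  rw [b.proj_apply, b.proj_apply]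
  exact Finset.sum_congr rfl fun a _ => by rw [hb.π_q]

theorem Block.SplitsOff.sub_proj [Finite G] (hτ : IsGenPerm.{u, v, w} τ) {b : Block τ} {q}
    (hq : IsContinuousProjection q) (hb : b.SplitsOff q) :
    IsContinuousProjection (q - b.proj) := by
  constructor
  · intro x
    have h1 : b.proj (b.proj x) = b.proj x := by
      conv_lhs => rw [b.proj_apply]
      conv_rhs => rw [b.proj_apply]
      exact Finset.sum_congr rfl fun a _ => by rw [hb.π_proj]
    simp only [LinearMap.sub_apply, map_sub, hq.idem, hb.q_proj, hb.proj_q, h1]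
    abel
  · intro O hO
    obtain ⟨B, hB, hBO, ⟨m, hm⟩, -⟩ := hτ.exists_approximation hO
    have h1 : ∀ a, {y : V | b.π a y ∈ powMul p m _} ∈ 𝓝 (0 : V) := fun a => hb.cont a m
    filter_upwards [hq.cont B hB, Filter.iInter_mem.2 h1] with y hy hy'
    apply hBO
    refine B.sub_mem hy ?_
    have h2 : (b.proj y : V) = ∑ a, (b.h a (b.π a y) : V) := b.proj_apply y
    rw [h2]
    refine B.sum_mem fun a _ => hm ?_
    obtain ⟨z, hz⟩ := mem_powMul.1 (Set.mem_iInter.1 hy' a)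
    rw [hz, map_nsmul]
    exact mem_powMul.2 ⟨_, rfl⟩

/-- Modulo any neighbourhood of zero, the image of a continuous projection is exhausted by a
finite family of induced modules. -/
theorem exists_block [Finite G] (hG : IsPGroup p G) (hτ : IsGenPerm.{u, v, w} τ)
    {q : τ.asModule →ₗ[MonoidAlgebra (ZpZeta p) G] τ.asModule} (hq : IsContinuousProjection q)
    {O : Set V} (hO : O ∈ 𝓝 (0 : V)) :
    ∃ b : Block τ, b.SplitsOff q ∧ ∀ y : V, ((q - b.proj) y : V) ∈ O := by
  obtain ⟨B, hB, hBO, -, -⟩ := hτ.exists_approximation hO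
  obtain ⟨B', hB', hBO', -, n, H, φ, h, π, hh, hπ, hcont, happrox⟩ :=
    hτ.exists_approximation (hq.cont B hB)
  let hA : ∀ a, (indRep (H a) (φ a)).asModule →ₗ[MonoidAlgebra (ZpZeta p) G] τ.asModule := fun a =>
    Representation.IntertwiningMap.equivLinearMapAsModule _ _
      ((h a).intertwiningMap_of_isIntertwiningMap _ _ (hh a))
  let πA : ∀ a, τ.asModule →ₗ[MonoidAlgebra (ZpZeta p) G] (indRep (H a) (φ a)).asModule := fun a =>
    Representation.IntertwiningMap.equivLinearMapAsModule _ _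
      ((π a).intertwiningMap_of_isIntertwiningMap _ _ (hπ a))
  let C : ∀ a, AddSubgroup (τ.asModule →ₗ[MonoidAlgebra (ZpZeta p) G]
      (indRep (H a) (φ a)).asModule) := fun a =>
    { carrier := {f | ∀ m, {y : V | f y ∈ powMul p m _} ∈ 𝓝 (0 : V)}
      zero_mem' := by
        intro m
        exact Filter.mem_of_superset Filter.univ_mem fun y _ => zero_mem (powMul p m _)
      add_mem' := by
        intro f g hf hg m
        filter_upwards [hf m, hg m] with y h1 h2
        exact add_mem h1 h2
      neg_mem' := by
        intro f hf m
        filter_upwards [hf m] with y h1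
        exact neg_mem h1 }
  obtain ⟨t, h', π', h1, h2, h3, h4, h5⟩ := exists_orthogonal_approximation
    (fun a => hasLocalEnd_indRep (φ a) hG) C
    (by
      intro a b f g hg m
      filter_upwards [hg m] with y hy
      obtain ⟨z, hz⟩ := mem_powMul.1 hy
      exact mem_powMul.2 ⟨f z, (congrArg f hz).trans (map_nsmul f _ _)⟩)
    (B : AddSubgroup V) q hq.idem Finset.univ (fun a => q ∘ₗ hA a) (fun a => πA a ∘ₗ q)
    (fun a _ x => hq.idem _) (fun a _ x => by simp [hq.idem])
    (by
      intro a _ m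
      filter_upwards [hq.cont _ (hcont a m)] with y hy
      exact hy)
    (by
      intro y
      have h1 := hBO' (happrox (q y : V))
      have h2 : (q (q y - ∑ a, hA a (πA a (q y))) : V) ∈ B := h1
      rw [map_sub, hq.idem, map_sum] at h2
      exact h2)
  refine ⟨{ T := {a // a ∈ t}, H := fun a => H a, φ := fun a => φ a, h := fun a => h' a,
            π := fun a => π' a }, ⟨?_, ?_, ?_, ?_, ?_⟩, ?_⟩
  · exact fun a x => h1 a a.2 x
  · exact fun a x => h2 a a.2 x
  · intro a x
    have := h4 a a.2 a a.2 x
    simpa using this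
  · intro a c hac x
    have := h4 a a.2 c c.2 x
    rwa [Pi.single_eq_of_ne (fun h => hac (Subtype.ext h))] at this
  · exact fun a m => h3 a a.2 m
  · intro y
    apply hBO
    have h6 := h5 y
    rw [← Finset.sum_coe_sort t] at h6
    refine Set.mem_of_eq_of_mem ?_ h6
    exact congrArg (q y - ·) (Block.proj_apply _ _)

open Classical in
/-- A profinite generalized permutation lattice with countable basis of neighbourhoods of zero is
a product of induced modules. This is expressed by a null family of generators `v j` of these
modules and by the dual functionals `l j`. -/
theorem IsGenPerm.exists_generators [Finite G] (hG : IsPGroup p G) (hτ : IsGenPerm.{u, v, w} τ)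
    [(𝓝 (0 : V)).IsCountablyGenerated] :
    ∃ (J : Type) (H : J → Subgroup G) (φ : ∀ j, H j →* Subgroup.zpowers (zeta p))
      (v : J → V) (l : J → (V →ₗ[ZpZeta p] ZpZeta p)),
      (∀ j, v j ∈ eigenspace τ (H j) (φ j)) ∧ Tendsto v cofinite (𝓝 0) ∧
      (∀ y, ∀ O ∈ 𝓝 (0 : V), ∃ s ∈ Submodule.span (ZpZeta p)
        (Set.range fun i : J × G => τ i.2 (v i.1)), y - s ∈ O) ∧
      (∀ j k g, j ≠ k → l j (τ g (v k)) = 0) ∧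
      (∀ j g, l j (τ g (v j)) =
        if hg : g ∈ H j then ((φ j ⟨g, hg⟩ : (ZpZeta p)ˣ) : ZpZeta p) else 0) ∧
      ∀ j m, {y | (p : ZpZeta p) ^ m ∣ l j y} ∈ 𝓝 (0 : V) := by
  obtain ⟨W, hW⟩ := (𝓝 (0 : V)).exists_antitone_basis
  have hWn : ∀ n, W n ∈ 𝓝 (0 : V) := fun n => hW.1.mem_of_mem trivial
  -- `Q n` is the projection that remains after `n` splittings, `b n` the family split off from it
  choose blk hblk hblkW using fun (q : {q : τ.asModule →ₗ[MonoidAlgebra (ZpZeta p) G] τ.asModule //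
    IsContinuousProjection q}) (n : ℕ) => exists_block hG hτ q.2 (hWn n)
  let q : ℕ → {q : τ.asModule →ₗ[MonoidAlgebra (ZpZeta p) G] τ.asModule //
      IsContinuousProjection q} := fun n =>
    Nat.rec ⟨LinearMap.id, ⟨fun _ => rfl, fun _ h => h⟩⟩
      (fun n q => ⟨q.1 - (blk q n).proj, (hblk q n).sub_proj hτ q.2⟩) n
  let Q : ℕ → τ.asModule →ₗ[MonoidAlgebra (ZpZeta p) G] τ.asModule := fun n => (q n).1
  let b : ℕ → Block τ := fun n => blk (q n) n
  have hb : ∀ n, (b n).SplitsOff (Q n) := fun n => hblk _ _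
  have hQs : ∀ n y, Q (n + 1) y = Q n y - (b n).proj y := fun n y => rfl
  have hQW : ∀ n (y : V), (Q (n + 1) y : V) ∈ W n := fun n y => hblkW _ _ y
  have hQQ : ∀ m n, m ≤ n → ∀ y, Q n (Q m y) = Q n y ∧ Q m (Q n y) = Q n y := by
    intro m n hmn
    induction n, hmn using Nat.le_induction with
    | base => exact fun y => ⟨(q m).2.idem y, (q m).2.idem y⟩
    | succ n hmn ih =>
      intro y
      constructor
      · rw [hQs, hQs, (ih y).1, ← (hb n).proj_q (Q m y), (ih y).1, (hb n).proj_q]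
      · rw [hQs, map_sub, (ih y).2]
        congr 1
        rw [← (hb n).q_proj, (ih _).2]
  have hQh : ∀ n a x, Q (n + 1) ((b n).h a x) = 0 := by
    intro n a x
    rw [hQs, (hb n).q_h, (hb n).proj_h, sub_self]
  have hπQ : ∀ n a y, (b n).π a (Q (n + 1) y) = 0 := by
    intro n a y
    rw [hQs, map_sub, (hb n).π_q, (hb n).π_proj, sub_self]
  have hcross : ∀ n m a c x, n ≠ m → (b n).π a ((b m).h c x) = 0 := by
    intro n m a c x hnm
    rcases lt_or_gt_of_ne hnm with h | h
    · rw [← (hb m).q_h, ← (hQQ (n + 1) m h _).2, hπQ]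
    · rw [← (hb n).π_q, ← (hQQ (m + 1) n h _).1, hQh, map_zero, map_zero]
  choose l hl using fun (j : Σ n, (b n).T) => exists_coordinate ((b j.1).φ j.2)
  let v : (Σ n, (b n).T) → V := fun j => (b j.1).h j.2 (indGen ((b j.1).H j.2) ((b j.1).φ j.2))
  have hτv : ∀ j g, τ g (v j) = (b j.1).h j.2
      (indRep ((b j.1).H j.2) ((b j.1).φ j.2) g (indGen ((b j.1).H j.2) ((b j.1).φ j.2))) :=
    fun j g => (asModule_map_rep _ _ _).symm
  let πR : ∀ j : Σ n, (b n).T, V →ₗ[ZpZeta p]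
      Representation.IndV ((b j.1).H j.2).subtype (rankOne ((b j.1).φ j.2)) := fun j =>
    ((Representation.IntertwiningMap.equivLinearMapAsModule _ _).symm ((b j.1).π j.2)).toLinearMap
  have hπR : ∀ j y, πR j y = (b j.1).π j.2 y := fun j y => rfl
  refine ⟨Σ n, (b n).T, fun j => (b j.1).H j.2, fun j => (b j.1).φ j.2, v,
    fun j => l j ∘ₗ πR j, ?_, ?_, ?_, ?_, ?_, ?_⟩
  · intro j h
    rw [hτv, indRep_mem]
    exact asModule_map_smul _ _ _
  · rw [hW.1.tendsto_right_iff]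
    intro n _
    rw [Filter.eventually_cofinite]
    have hfin : (⋃ m ∈ Finset.range (n + 1), Set.range (Sigma.mk (β := fun n => (b n).T) m)).Finite :=
      Set.Finite.biUnion (Finset.finite_toSet _) fun m _ => Set.finite_range _
    refine hfin.subset ?_
    rintro ⟨m, a⟩ hma
    simp only [Set.mem_iUnion]
    refine ⟨m, ?_, ⟨a, rfl⟩⟩
    by_contra hcon
    apply hma
    rw [Finset.mem_range, not_lt] at hcon
    have h1 : (v ⟨m, a⟩ : V) = Q (n + 1) (v ⟨m, a⟩) := by
      have h2 : Q m (v ⟨m, a⟩) = v ⟨m, a⟩ := (hb m).q_h _ _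
      have h3 := (hQQ (n + 1) m hcon (v ⟨m, a⟩)).2
      rw [h2] at h3
      exact h3.symm
    rw [h1]
    exact hQW n _
  · intro y O hO
    obtain ⟨n, -, hn⟩ := hW.1.mem_iff.1 hO
    have key : ∀ n, ∃ s ∈ Submodule.span (ZpZeta p)
        (Set.range fun i : (Σ n, (b n).T) × G => τ i.2 (v i.1)), (Q n y : V) = y - s := by
      intro n
      induction n with
      | zero => exact ⟨0, zero_mem _, (sub_zero y).symm⟩
      | succ n ih =>
        obtain ⟨s, hs, hsy⟩ := ih
        let z : V := (b n).proj y
        refine ⟨s + z, add_mem hs ?_, ?_⟩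
        · have h2 : z = ∑ a, ((b n).h a ((b n).π a y) : V) := (b n).proj_apply y
          rw [h2]
          refine sum_mem fun a _ => ?_
          have key2 : ∀ s : Representation.IndV ((b n).H a).subtype (rankOne ((b n).φ a)),
              ((b n).h a s : V) ∈ Submodule.span (ZpZeta p)
                (Set.range fun i : (Σ n, (b n).T) × G => τ i.2 (v i.1)) := by
            intro s
            induction mem_span_indGen ((b n).φ a) s using Submodule.span_induction with
            | mem s hs =>
              obtain ⟨g, rfl⟩ := hs
              exact Submodule.subset_span ⟨(⟨n, a⟩, g), hτv ⟨n, a⟩ g⟩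
            | zero =>
              have : ((b n).h a (0 : Representation.IndV ((b n).H a).subtype
                (rankOne ((b n).φ a))) : V) = 0 := map_zero ((b n).h a)
              rw [this]
              exact zero_mem _
            | add s t _ _ hs ht =>
              have : ((b n).h a (s + t : Representation.IndV ((b n).H a).subtype
                (rankOne ((b n).φ a))) : V) = ((b n).h a s : V) + ((b n).h a t : V) :=
                  map_add ((b n).h a) s t
              rw [this]
              exact add_mem hs ht
            | smul r s _ hs =>
              rw [asModule_map_smul]
              exact Submodule.smul_mem _ _ hs
          exact key2 _
        · exact (hQs n y).trans
            ((congrArg (fun x : V => x - z) hsy).trans (sub_sub _ _ _))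
    obtain ⟨s, hs, hsy⟩ := key (n + 1)
    refine ⟨s, hs, hn ?_⟩
    rw [← hsy]
    exact hQW n y
  · rintro ⟨n, a⟩ ⟨m, c⟩ g hjk
    rw [LinearMap.comp_apply, hπR, hτv]
    by_cases hnm : n = m
    · subst hnm
      have h1 := (hb n).orth a c (fun h => hjk (by rw [h])) (indRep ((b n).H c) ((b n).φ c) g
        (indGen ((b n).H c) ((b n).φ c)))
      exact (congrArg _ h1).trans (map_zero _)
    · have h1 := hcross n m a c (indRep ((b m).H c) ((b m).φ c) g
        (indGen ((b m).H c) ((b m).φ c))) hnm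
      exact (congrArg _ h1).trans (map_zero _)
  · intro j g
    rw [LinearMap.comp_apply, hπR, hτv]
    have h1 := (hb j.1).dual j.2 (indRep ((b j.1).H j.2) ((b j.1).φ j.2) g
      (indGen ((b j.1).H j.2) ((b j.1).φ j.2)))
    exact (congrArg (l j) h1).trans (hl j g)
  · intro j m
    filter_upwards [(hb j.1).cont j.2 m] with y hy
    obtain ⟨z, hz⟩ := mem_powMul.1 hy
    rw [LinearMap.comp_apply, hπR, hz]
    have : l j (p ^ m • z) = p ^ m • l j z := map_nsmul _ _ _
    refine ⟨l j z, ?_⟩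
    refine this.trans ?_
    rw [nsmul_eq_mul, Nat.cast_pow]

end Decomposition

/-! ### Open submodules of profinite modules -/

section OpenSubmodules

variable {p : ℕ} [Fact p.Prime] {M : Type*} [AddCommGroup M] [Module ℤ_[p] M] [TopologicalSpace M]

theorem IsProfiniteModule.nonarchimedeanAddGroup (hM : IsProfiniteModule ℤ_[p] M) :
    NonarchimedeanAddGroup M := by
  have := hM.isTopologicalAddGroup
  have := hM.compactSpace
  have := hM.t2Space
  have := hM.totallyDisconnectedSpace
  refine { is_nonarchimedean := fun U hU => ?_ }
  obtain ⟨W, ⟨hW0, hW⟩, hWU⟩ := (nhds_basis_clopen (0 : M)).mem_iff.1 hU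
  obtain ⟨H, hH⟩ :=
    IsTopologicalAddGroup.exist_openAddSubgroup_sub_clopen_nhds_of_zero hW hW0
  exact ⟨H, hH.trans hWU⟩

theorem IsProfiniteModule.exists_open_submodule (hM : IsProfiniteModule ℤ_[p] M) {W : Set M}
    (hW : W ∈ 𝓝 (0 : M)) : ∃ O : Submodule ℤ_[p] M, IsOpen (O : Set M) ∧ (O : Set M) ⊆ W := by
  have := hM.isTopologicalAddGroup
  have := hM.continuousSMul
  have := hM.nonarchimedeanAddGroup
  obtain ⟨H, hH⟩ := NonarchimedeanAddGroup.is_nonarchimedean W hW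
  -- an open subgroup is closed, hence stable under the closure of `ℕ` in `ℤ_p`
  refine ⟨{ H.toAddSubgroup with
    smul_mem' := fun r x hx => ?_ }, H.isOpen, hH⟩
  have hcl : IsClosed {r : ℤ_[p] | r • x ∈ H} :=
    H.isClosed.preimage (f := fun r : ℤ_[p] => r • x) (continuous_id.smul continuous_const)
  have hsub : closure (Set.range (Nat.cast : ℕ → ℤ_[p])) ⊆ {r : ℤ_[p] | r • x ∈ H} := by
    refine closure_minimal ?_ hcl
    rintro _ ⟨n, rfl⟩
    change (n : ℤ_[p]) • x ∈ H
    rw [Nat.cast_smul_eq_nsmul]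
    exact nsmul_mem hx n
  exact hsub (PadicInt.denseRange_natCast r)

theorem discreteTopology_quotient [IsTopologicalAddGroup M] {O : Submodule ℤ_[p] M}
    (hO : IsOpen (O : Set M)) : DiscreteTopology (M ⧸ O) :=
  QuotientAddGroup.discreteTopology (N := O.toAddSubgroup) hO

theorem IsProfiniteModule.quotient (hM : IsProfiniteModule ℤ_[p] M) {O : Submodule ℤ_[p] M}
    (hO : IsOpen (O : Set M)) : IsProfiniteModule ℤ_[p] (M ⧸ O) := by
  have := hM.isTopologicalAddGroup
  have := hM.continuousSMul
  have := hM.compactSpace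
  have := discreteTopology_quotient hO
  have hc : CompactSpace (M ⧸ O) := Quotient.compactSpace
  exact ⟨inferInstance, inferInstance, hc, inferInstance, inferInstance⟩

theorem isProfiniteModule_pi (ι : Type*) : IsProfiniteModule ℤ_[p] (ι → ℤ_[p]) :=
  ⟨inferInstance, inferInstance, inferInstance, inferInstance, inferInstance⟩

/-- Continuous homomorphisms that agree on a profinite basis are equal. -/
theorem IsProfiniteBasis.hom_ext {M : Type u} [AddCommGroup M] [Module ℤ_[p] M]
    [TopologicalSpace M] {X : Set M} (hX : IsProfiniteBasis p X) {L : Type u}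
    [AddCommGroup L] [Module ℤ_[p] L] [TopologicalSpace L] (hL : IsProfiniteModule ℤ_[p] L)
    (f g : M →L[ℤ_[p]] L) (h : ∀ x ∈ X, f x = g x) : f = g :=
  (hX.2 L hL (fun x => f x) (f.continuous.comp continuous_subtype_val)).unique
    (fun _ => rfl) (fun x => (h x x.2).symm)

end OpenSubmodules

/-! ### The first cohomology of permutation lattices -/

section Cohomology

variable {p : ℕ} [Fact p.Prime] {K : Type v} [Group K] [Finite K]

/-- `H¹` of a finite permutation lattice vanishes: the sum of the values of a cocycle is
invariant modulo the order of the group, and invariants lift. -/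
theorem exists_coboundary_of_finite {Ξ : Type*} [MulAction K Ξ] (c : K → Ξ → ℤ_[p])
    (hc : ∀ k l ξ, c (k * l) ξ = c k ξ + c l (k⁻¹ • ξ)) :
    ∃ F : Ξ → ℤ_[p], ∀ k ξ, c k ξ = F (k⁻¹ • ξ) - F ξ := by
  have := Fintype.ofFinite K
  let s : Ξ → ℤ_[p] := fun ξ => ∑ l, c l ξ
  have hs : ∀ k ξ, s ξ - s (k⁻¹ • ξ) = (Fintype.card K : ℤ_[p]) * c k ξ := by
    intro k ξ
    have h1 : s ξ = ∑ l, c (k * l) ξ := (Equiv.sum_comp (Equiv.mulLeft k) fun l => c l ξ).symm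
    rw [h1]
    simp only [hc, Finset.sum_add_distrib, Finset.sum_const, Finset.card_univ, nsmul_eq_mul]
    ring
  let r : Ξ → Ξ := fun ξ => (Quotient.mk (MulAction.orbitRel K Ξ) ξ).out
  have hr : ∀ ξ, ∃ g : K, r ξ = g⁻¹ • ξ := by
    intro ξ
    have h1 : MulAction.orbitRel K Ξ (r ξ) ξ := Quotient.mk_out (s := MulAction.orbitRel K Ξ) ξ
    obtain ⟨g, hg⟩ := MulAction.orbitRel_apply.1 h1
    exact ⟨g⁻¹, by rw [inv_inv]; exact hg.symm⟩
  have hrk : ∀ (k : K) ξ, r (k • ξ) = r ξ := by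
    intro k ξ
    have : (Quotient.mk (MulAction.orbitRel K Ξ) (k • ξ)) = Quotient.mk _ ξ :=
      Quotient.sound (MulAction.orbitRel_apply.2 ⟨k, rfl⟩)
    simp only [r, this]
  choose g hg using hr
  have hF : ∀ ξ, (Fintype.card K : ℤ_[p]) * (- c (g ξ) ξ) = s (r ξ) - s ξ := by
    intro ξ
    rw [mul_neg, ← hs, hg]
    ring
  refine ⟨fun ξ => - c (g ξ) ξ, fun k ξ => ?_⟩
  have h0 : (Fintype.card K : ℤ_[p]) ≠ 0 := by
    exact_mod_cast Fintype.card_ne_zero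
  apply mul_left_cancel₀ h0
  rw [mul_sub, hF, hF, hrk, ← hs]
  ring

variable {W : Type u} [AddCommGroup W] [Module ℤ_[p] W] [TopologicalSpace W]

/-- Each finite quotient of a permutation lattice factors through a finite permutation lattice, so
that a cocycle becomes a coboundary in it. -/
theorem exists_coboundary_mod {ρ : Representation ℤ_[p] K W} (hρ : IsPermutationLattice ρ)
    (c : K → W) (hc : ∀ k l, c (k * l) = c k + ρ k (c l)) (O : Submodule ℤ_[p] W)
    (hO : IsOpen (O : Set W)) : ∃ w, ∀ k, c k - (ρ k w - w) ∈ O := by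
  classical
  obtain ⟨⟨hW, hρc⟩, X, hX, hGX⟩ := hρ
  have := hW.isTopologicalAddGroup
  have := hW.continuousSMul
  have := discreteTopology_quotient hO
  have hQ := hW.quotient hO
  have := hQ.compactSpace
  have hQfin : Finite (W ⧸ O) := finite_of_compact_of_discrete
  let Φ : X → (K → W ⧸ O) := fun x k => O.mkQ (ρ k x)
  have hΦ : Continuous Φ := continuous_pi fun k =>
    continuous_quot_mk.comp ((hρc k).comp continuous_subtype_val)
  let S : Setoid X := Setoid.ker Φ
  let Ξ := Quotient S
  have hΞ : ∀ x y : X, (Quotient.mk S x = Quotient.mk S y) ↔ Φ x = Φ y := fun x y =>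
    Quotient.eq (r := S)
  -- two basis elements are identified if all their translates agree modulo `O`
  have hΞfin : Finite Ξ := Finite.of_injective (Quotient.lift Φ fun _ _ h => h)
    (fun a b => by
      induction a, b using Quotient.inductionOn₂ with
      | h x y => exact fun h => (hΞ x y).2 h)
  have := Fintype.ofFinite Ξ
  let act : K → X → X := fun k x => ⟨ρ k x, hGX k x x.2⟩
  have hact : ∀ k x l, Φ (act k x) l = Φ x (l * k) := by
    intro k x l
    simp only [Φ, act, map_mul, Module.End.mul_apply]
  let inst : MulAction K Ξ :=
    { smul k := Quotient.map (act k) (fun x y h => by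
        change Φ _ = Φ _
        ext l
        rw [hact, hact]
        exact congrFun h _)
      one_smul := by
        intro ξ
        induction ξ using Quotient.inductionOn with
        | h x => exact congrArg (Quotient.mk S) (Subtype.ext (by simp [act]))
      mul_smul := by
        intro k l ξ
        induction ξ using Quotient.inductionOn with
        | h x => exact congrArg (Quotient.mk S) (Subtype.ext (by simp [act])) }
  have hsmul : ∀ k x, k • (Quotient.mk S x : Ξ) = Quotient.mk S (act k x) := fun k x => rfl
  let δ : X → (Ξ → ℤ_[p]) := fun x => Pi.single (Quotient.mk S x) 1
  have hδ : Continuous δ := by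
    refine IsLocallyConstant.continuous ((IsLocallyConstant.iff_exists_open _).2 fun x => ?_)
    refine ⟨Φ ⁻¹' {Φ x}, (isOpen_discrete _).preimage hΦ, rfl, fun y hy => ?_⟩
    have : Quotient.mk S y = Quotient.mk S x := (hΞ y x).2 hy
    simp only [δ, this]
  obtain ⟨α, hα, -⟩ := hX.2 (Ξ → ℤ_[p]) (isProfiniteModule_pi Ξ) δ hδ
  have hαk : ∀ k w ξ, α (ρ k w) ξ = α w (k⁻¹ • ξ) := by
    intro k w ξ
    let α₁ : W →L[ℤ_[p]] (Ξ → ℤ_[p]) := α.comp ⟨ρ k, hρc k⟩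
    let α₂ : W →L[ℤ_[p]] (Ξ → ℤ_[p]) :=
      (⟨LinearMap.funLeft ℤ_[p] ℤ_[p] (fun ξ : Ξ => k⁻¹ • ξ),
        continuous_pi fun ξ => continuous_apply _⟩ : (Ξ → ℤ_[p]) →L[ℤ_[p]] (Ξ → ℤ_[p])).comp α
    have h12 : α₁ = α₂ := hX.hom_ext (isProfiniteModule_pi Ξ) _ _ (by
      intro x hx
      ext ξ
      change α (ρ k x) ξ = α x (k⁻¹ • ξ)
      rw [hα ⟨x, hx⟩, hα (act k ⟨x, hx⟩)]
      simp only [δ, Pi.single_apply, ← hsmul, inv_smul_eq_iff])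
    exact congrFun (DFunLike.congr_fun h12 w) ξ
  have := hQ.continuousSMul
  let β : (Ξ → ℤ_[p]) →L[ℤ_[p]] (W ⧸ O) :=
    ∑ ξ, (ContinuousLinearMap.proj (R := ℤ_[p]) (φ := fun _ : Ξ => ℤ_[p]) ξ).smulRight
      (O.mkQ (ξ.out : X))
  have hβα : β.comp α = ⟨O.mkQ, continuous_quot_mk⟩ := hX.hom_ext hQ _ _ (by
    intro x hx
    change β (α x) = O.mkQ x
    rw [hα ⟨x, hx⟩]
    have h1 : β (δ ⟨x, hx⟩) = ∑ ξ, (δ ⟨x, hx⟩ ξ) • O.mkQ (ξ.out : X) := by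
      simp [β]
    rw [h1, Finset.sum_eq_single_of_mem (Quotient.mk S ⟨x, hx⟩) (Finset.mem_univ _)]
    · have h2 : Φ (Quotient.mk S ⟨x, hx⟩).out = Φ ⟨x, hx⟩ := Quotient.mk_out (s := S) _
      have h3 := congrFun h2 1
      simp only [Φ, map_one, Module.End.one_apply] at h3
      simp only [δ, Pi.single_eq_same, one_smul, h3]
    · intro ξ _ hξ
      simp [δ, Pi.single_eq_of_ne hξ])
  obtain ⟨F, hF⟩ := exists_coboundary_of_finite (fun k => α (c k)) (by
    intro k l ξ
    rw [hc, map_add, Pi.add_apply, hαk])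
  have hsurj : ∃ w, α w = F := by
    refine ⟨∑ ξ : Ξ, F ξ • (ξ.out : X), ?_⟩
    rw [map_sum]
    ext η
    simp only [map_smul, Finset.sum_apply, Pi.smul_apply, hα, δ, Quotient.out_eq, smul_eq_mul]
    rw [Finset.sum_eq_single_of_mem η (Finset.mem_univ _)]
    · simp
    · intro ξ _ hξ
      rw [Pi.single_eq_of_ne hξ.symm, mul_zero]
  obtain ⟨w, rfl⟩ := hsurj
  refine ⟨w, fun k => ?_⟩
  have h0 : α (c k - (ρ k w - w)) = 0 := by
    ext ξ
    rw [map_sub, map_sub, Pi.sub_apply, Pi.sub_apply, hαk, hF]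
    simp
  have h1 := DFunLike.congr_fun hβα (c k - (ρ k w - w))
  rw [ContinuousLinearMap.comp_apply, h0, map_zero] at h1
  exact (Submodule.Quotient.mk_eq_zero O).1 h1.symm

/-- `H¹` of a profinite permutation lattice vanishes. -/
theorem IsPermutationLattice.exists_coboundary {ρ : Representation ℤ_[p] K W}
    (hρ : IsPermutationLattice ρ) (c : K → W) (hc : ∀ k l, c (k * l) = c k + ρ k (c l)) :
    ∃ w, ∀ k, c k = ρ k w - w := by
  have hW := hρ.1.isProfiniteModule
  have := hW.isTopologicalAddGroup
  have := hW.compactSpace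
  have := hW.t2Space
  let B : {O : Submodule ℤ_[p] W // IsOpen (O : Set W)} → Set W := fun O =>
    {w | ∀ k, c k - (ρ k w - w) ∈ O.1}
  have hclosed : ∀ O, IsClosed (B O) := by
    intro O
    have h1 : IsClosed (O.1 : Set W) := O.1.toAddSubgroup.isClosed_of_isOpen O.2
    have e : B O = ⋂ k, {w | c k - (ρ k w - w) ∈ O.1} := by ext; simp [B]
    rw [e]
    exact isClosed_iInter fun k => h1.preimage
      (continuous_const.sub ((hρ.1.continuous k).sub continuous_id))
  have : Nonempty {O : Submodule ℤ_[p] W // IsOpen (O : Set W)} := ⟨⟨⊤, isOpen_univ⟩⟩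
  obtain ⟨w, hw⟩ := IsCompact.nonempty_iInter_of_directed_nonempty_isCompact_isClosed B
    (fun O O' => ⟨⟨O.1 ⊓ O'.1, O.2.inter O'.2⟩, fun w hw k => (hw k).1, fun w hw k => (hw k).2⟩)
    (fun O => exists_coboundary_mod hρ c hc O.1 O.2) (fun O => (hclosed O).isCompact) hclosed
  refine ⟨w, fun k => ?_⟩
  by_contra hne
  rw [← sub_eq_zero] at hne
  obtain ⟨O, hO, hOsub⟩ := hW.exists_open_submodule (isOpen_compl_singleton.mem_nhds
    (show (0 : W) ∈ ({c k - (ρ k w - w)} : Set W)ᶜ from fun h => hne h.symm))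
  exact hOsub (Set.mem_iInter.1 hw ⟨O, hO⟩ k) rfl

end Cohomology

/-! ### Null families and profinite bases -/

section NullFamilies

variable {p : ℕ} [Fact p.Prime]

open Classical in
theorem hom_ext_pi {I : Type*} {M : Type*} [AddCommGroup M] [Module ℤ_[p] M] [TopologicalSpace M]
    [T2Space M] {f g : (I → ℤ_[p]) →L[ℤ_[p]] M}
    (h : ∀ i, f (Pi.single i 1) = g (Pi.single i 1)) : f = g := by
  ext c
  have hc : HasSum (fun i => c i • (Pi.single i 1 : I → ℤ_[p])) c := by
    rw [Pi.hasSum]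
    intro j
    have h1 := hasSum_single (f := fun i => (c i • (Pi.single i 1 : I → ℤ_[p])) j) j
      (fun i hij => by simp [Pi.single_eq_of_ne hij.symm])
    simpa using h1
  have hf := hc.mapL f
  have hg := hc.mapL g
  simp only [map_smul, h] at hf hg
  exact hf.unique hg

open Classical in
/-- A null family in a profinite `ℤ_p`-module is the image of the unit vectors under a continuous
homomorphism from a product of copies of `ℤ_p`. -/
theorem IsProfiniteModule.exists_hom_pi {I : Type*} {M : Type*} [AddCommGroup M] [Module ℤ_[p] M]
    [TopologicalSpace M] (hM : IsProfiniteModule ℤ_[p] M) (e : I → M)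
    (he : Tendsto e cofinite (𝓝 0)) :
    ∃ f : (I → ℤ_[p]) →L[ℤ_[p]] M, ∀ i, f (Pi.single i 1) = e i := by
  have := hM.isTopologicalAddGroup
  have := hM.continuousSMul
  have := hM.compactSpace
  have := hM.t2Space
  have := hM.nonarchimedeanAddGroup
  let : UniformSpace M := IsTopologicalAddGroup.rightUniformSpace M
  have : IsUniformAddGroup M := isUniformAddGroup_of_addCommGroup
  have hsum : ∀ c : I → ℤ_[p], Summable fun i => c i • e i := by
    intro c
    refine NonarchimedeanAddGroup.summable_of_tendsto_cofinite_zero ?_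
    intro W hW
    obtain ⟨O, hO, hOW⟩ := hM.exists_open_submodule hW
    refine Filter.mem_map.2 ?_
    filter_upwards [he (hO.mem_nhds O.zero_mem)] with i hi
    exact hOW (O.smul_mem _ hi)
  let f : (I → ℤ_[p]) →ₗ[ℤ_[p]] M :=
    { toFun c := ∑' i, c i • e i
      map_add' c d := by
        simp only [Pi.add_apply, add_smul]
        exact (hsum c).tsum_add (hsum d)
      map_smul' r c := by
        simp only [Pi.smul_apply, smul_eq_mul, mul_smul, RingHom.id_apply]
        exact (hsum c).tsum_const_smul r }
  have hf : ∀ c, f c = ∑' i, c i • e i := fun c => rfl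
  refine ⟨⟨f, ?_⟩, fun i => ?_⟩
  · refine continuous_of_continuousAt_zero f.toAddMonoidHom ?_
    intro W hW
    change W ∈ 𝓝 (f 0) at hW
    rw [map_zero] at hW
    obtain ⟨O, hO, hOW⟩ := hM.exists_open_submodule hW
    have hfin : {i | e i ∉ O}.Finite := he (hO.mem_nhds O.zero_mem)
    have hn : ∀ i ∈ {i | e i ∉ O}, {c : I → ℤ_[p] | c i • e i ∈ O} ∈ 𝓝 0 := by
      intro i _
      have h1 : Continuous fun c : I → ℤ_[p] => c i • e i :=
        (continuous_apply i).smul continuous_const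
      refine (hO.preimage h1).mem_nhds ?_
      simp
    refine Filter.mem_map.2 ?_
    filter_upwards [(Filter.biInter_mem hfin).2 hn] with c hc
    apply hOW
    have hcl : IsClosed (O : Set M) := O.toAddSubgroup.isClosed_of_isOpen hO
    change f c ∈ O
    rw [hf]
    refine hcl.mem_of_tendsto (hsum c).hasSum (Eventually.of_forall fun s => ?_)
    refine O.sum_mem fun i _ => ?_
    by_cases hi : e i ∈ O
    · exact O.smul_mem _ hi
    · exact Set.mem_iInter₂.1 hc i hi
  · change f _ = _
    rw [hf, tsum_eq_single i]
    · simp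
    · intro j hj
      simp [Pi.single_eq_of_ne hj]

open Classical in
/-- A null family that is a topological basis does not itself form a profinite basis, since zero is
a limit point; but it does after the members of each of finitely many classes have been translated
by one member of the class. The class of `i` is represented by `b i`. -/
theorem isProfiniteBasis_of_null {I : Type*} {M : Type u} [AddCommGroup M] [Module ℤ_[p] M]
    [TopologicalSpace M] (hM : IsProfiniteModule ℤ_[p] M) (e : I → M)
    (he : Tendsto e cofinite (𝓝 0)) (φ : (I → ℤ_[p]) →L[ℤ_[p]] M)
    (hφ : ∀ i, φ (Pi.single i 1) = e i) (hbij : Function.Bijective φ)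
    (b : I → I) (hb : (Set.range b).Finite) (hbb : ∀ i, b (b i) = b i) :
    IsProfiniteBasis p (Set.range fun i => if b i = i then e i else e i + e (b i)) := by
  have := hM.isTopologicalAddGroup
  have := hM.t2Space
  set x : I → M := fun i => if b i = i then e i else e i + e (b i) with hx
  have hxb : ∀ i, x (b i) = e (b i) := fun i => by simp [hx, hbb]
  have hxlim : ∀ t ∈ Set.range b, Tendsto (fun i : {i // b i = t} => x i) cofinite (𝓝 (e t)) := by
    rintro _ ⟨t, rfl⟩
    have h1 : Tendsto (fun i : {i // b i = b t} => e i + e (b t)) cofinite (𝓝 (0 + e (b t))) :=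
      (he.comp Subtype.val_injective.tendsto_cofinite).add tendsto_const_nhds
    rw [zero_add] at h1
    refine h1.congr' ?_
    have h2 : {i : {i // b i = b t} | i = ⟨b t, hbb t⟩}.Finite := Set.finite_singleton _
    filter_upwards [h2.compl_mem_cofinite] with i hi
    have h3 : b i ≠ i := by
      intro h
      apply hi
      ext
      rw [← h, i.2]
    simp only [hx, if_neg h3, i.2]
  refine ⟨?_, ?_⟩
  · have e1 : Set.range x = ⋃ t ∈ Set.range b,
        insert (e t) (Set.range fun i : {i // b i = t} => x i) := by
      ext y
      simp only [Set.mem_iUnion, Set.mem_insert_iff, exists_prop]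
      constructor
      · rintro ⟨i, rfl⟩
        exact ⟨b i, ⟨i, rfl⟩, Or.inr ⟨⟨i, rfl⟩, rfl⟩⟩
      · rintro ⟨_, ⟨t, rfl⟩, rfl | ⟨i, rfl⟩⟩
        · exact ⟨b t, hxb t⟩
        · exact ⟨i, rfl⟩
    rw [e1]
    exact (hb.isCompact_biUnion fun t ht => (hxlim t ht).isCompact_insert_range_of_cofinite).isClosed
  · intro L _ _ _ hL f hf
    have := hL.isTopologicalAddGroup
    have := hL.t2Space
    let fx : I → L := fun i => f ⟨x i, i, rfl⟩
    let e' : I → L := fun i => if b i = i then fx i else fx i - fx (b i)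
    have hfxlim : ∀ t ∈ Set.range b,
        Tendsto (fun i : {i // b i = t} => fx i) cofinite (𝓝 (fx t)) := by
      rintro _ ⟨t, rfl⟩
      refine (hf.tendsto ⟨x (b t), b t, rfl⟩).comp ?_
      rw [tendsto_subtype_rng]
      simpa only [hxb] using hxlim (b t) ⟨t, rfl⟩
    have he' : Tendsto e' cofinite (𝓝 0) := by
      intro O hO
      have h1 : ∀ t ∈ Set.range b, {i : {i // b i = t} | e' i ∉ O}.Finite := by
        rintro _ ⟨t, rfl⟩
        have h2 := (hfxlim (b t) ⟨t, rfl⟩).sub_const (fx (b t))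
        rw [sub_self] at h2
        have h3 : {i : {i // b i = b t} | ¬ (fx i - fx (b t) ∈ O)}.Finite := h2 hO
        refine (h3.union (Set.finite_singleton ⟨b t, hbb t⟩)).subset ?_
        intro i hi
        by_cases hbi : b i = i
        · right
          rw [Set.mem_singleton_iff]
          ext
          rw [← hbi, i.2]
        · left
          have : e' i = fx i - fx (b t) := by simp only [e', if_neg hbi, i.2]
          change e' i ∉ O at hi
          rwa [this] at hi
      refine (hb.biUnion fun t ht => (h1 t ht).image Subtype.val).subset ?_
      intro i hi
      simp only [Set.mem_iUnion]
      exact ⟨b i, ⟨i, rfl⟩, ⟨i, rfl⟩, hi, rfl⟩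
    obtain ⟨φ', hφ'⟩ := hL.exists_hom_pi e' he'
    let Φ : (I → ℤ_[p]) ≃ₗ[ℤ_[p]] M := LinearEquiv.ofBijective φ.toLinearMap hbij
    have hΦc : Continuous Φ.symm :=
      (Continuous.homeoOfEquivCompactToT2 (f := Φ.toEquiv) φ.continuous).symm.continuous
    have hΦe : ∀ i, Φ.symm (e i) = Pi.single i 1 := by
      intro i
      rw [LinearEquiv.symm_apply_eq]
      exact (hφ i).symm
    refine ⟨φ'.comp ⟨Φ.symm.toLinearMap, hΦc⟩, ?_, ?_⟩
    · have hψe : ∀ i, φ' (Φ.symm (e i)) = e' i := fun i => by rw [hΦe, hφ']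
      rintro ⟨_, i, rfl⟩
      change φ' (Φ.symm (x i)) = fx i
      by_cases hbi : b i = i
      · have h1 : x i = e i := by simp [hx, hbi]
        rw [h1, hψe]
        simp [e', hbi]
      · have h1 : x i = e i + e (b i) := by simp only [hx, if_neg hbi]
        rw [h1, map_add, map_add, hψe, hψe]
        simp only [e', if_neg hbi, hbb, if_true]
        abel
    · intro ψ hψ
      have hψe : ∀ i, ψ (e i) = e' i := by
        have hψx : ∀ i, ψ (x i) = fx i := fun i => hψ ⟨x i, i, rfl⟩
        intro i
        by_cases hbi : b i = i
        · have h1 : x i = e i := by simp [hx, hbi]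
          rw [← h1, hψx]
          simp [e', hbi]
        · have h1 : e i = x i - x (b i) := by
            rw [hxb]; simp only [hx, if_neg hbi]; abel
          rw [h1, map_sub, hψx, hψx]
          simp only [e', if_neg hbi]
      have h2 : ψ.comp φ = φ' := hom_ext_pi fun i => by
        rw [ContinuousLinearMap.comp_apply, hφ, hψe, hφ']
      ext y
      have h3 : φ (Φ.symm y) = y := Φ.apply_symm_apply y
      change ψ y = φ' (Φ.symm y)
      rw [← h2, ContinuousLinearMap.comp_apply, h3]

end NullFamilies

/-! ### Free modules over a finite group -/

section Trace

variable {p : ℕ} [Fact p.Prime]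

/-- A free module over a finite group is relatively projective over the trivial group: the identity
is the trace of an endomorphism `θ`, namely of the coordinate at the neutral element. -/
theorem IsFree.exists_trace_eq_id {N : Type v} [Group N] [Fintype N] {U : Type u} [AddCommGroup U]
    [Module ℤ_[p] U] [TopologicalSpace U] {ρ : Representation ℤ_[p] N U} (hρ : IsFree ρ) :
    ∃ θ : U →ₗ[ℤ_[p]] U, ∀ x, ∑ n, ρ n (θ (ρ n⁻¹ x)) = x := by
  classical
  obtain ⟨⟨hU, hc⟩, X, -, hX⟩ := hρ
  have := hU.isTopologicalAddGroup
  have := hU.continuousSMul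
  have := hU.compactSpace
  have := hU.t2Space
  have := hU.totallyDisconnectedSpace
  -- the coinduced module, indexed by `Fin (card N)` to stay in the universe of `U`
  let e : N ≃ Fin (Fintype.card N) := Fintype.equivFin N
  let σ : Representation ℤ_[p] N (Fin (Fintype.card N) → U) :=
    { toFun n := LinearMap.funLeft ℤ_[p] U fun i => e (e.symm i * n)
      map_one' := by ext; simp [LinearMap.funLeft]
      map_mul' m n := by ext; simp [LinearMap.funLeft, mul_assoc] }
  have hσ : ∀ n F i, σ n F i = F (e (e.symm i * n)) := fun n F i => rfl
  have hσp : IsProfiniteRep σ :=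
    ⟨⟨inferInstance, inferInstance, inferInstance, inferInstance, inferInstance⟩, fun n =>
      continuous_pi fun i => continuous_apply _⟩
  obtain ⟨φ, ⟨hφσ, hφX⟩, -⟩ := hX _ σ hσp (fun x => Pi.single (e 1) (x : U))
    (continuous_pi fun i => by
      by_cases h : i = e 1
      · subst h
        simpa using continuous_subtype_val
      · simpa [Pi.single_eq_of_ne h] using continuous_const)
  let θ : U →L[ℤ_[p]] U := (ContinuousLinearMap.proj (e 1)).comp φ
  have hθ : ∀ n x, θ (ρ n x) = φ x (e n) := by
    intro n x
    change φ (ρ n x) (e 1) = _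
    rw [hφσ, hσ]
    simp
  let S : U →L[ℤ_[p]] U := ∑ n, (⟨ρ n, hc n⟩ : U →L[ℤ_[p]] U).comp (θ.comp ⟨ρ n⁻¹, hc _⟩)
  have hS : ∀ x, S x = ∑ n, ρ n (θ (ρ n⁻¹ x)) := by
    intro x
    simp only [S, sum_apply]
    rfl
  obtain ⟨_, -, huniq⟩ := hX U ρ ⟨hU, hc⟩ (fun x => (x : U)) continuous_subtype_val
  have h1 := huniq S ⟨fun m x => by
    rw [hS, hS, map_sum, ← Equiv.sum_comp (Equiv.mulLeft m)]
    refine Finset.sum_congr rfl fun n _ => ?_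
    simp only [Equiv.coe_mulLeft, mul_inv_rev, map_mul, Module.End.mul_apply]
    congr 4
    rw [← Module.End.mul_apply, ← map_mul, inv_mul_cancel, map_one, Module.End.one_apply],
    fun x => by
      rw [hS, Finset.sum_eq_single_of_mem 1 (Finset.mem_univ _)]
      · rw [inv_one, hθ, hφX, Pi.single_eq_same, map_one, Module.End.one_apply]
      · intro n _ hn
        rw [hθ, hφX, Pi.single_eq_of_ne, map_zero]
        simpa using hn⟩
  have h2 := huniq (ContinuousLinearMap.id ℤ_[p] U) ⟨fun _ _ => rfl, fun _ => rfl⟩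
  refine ⟨θ.toLinearMap, fun x => ?_⟩
  have h3 := DFunLike.congr_fun (h1.trans h2.symm) x
  rw [hS] at h3
  exact h3

theorem eq_zero_of_forall_eq_pow_nsmul {M : Type*} [AddCommGroup M] [Module ℤ_[p] M]
    [TopologicalSpace M] [ContinuousSMul ℤ_[p] M] [CompactSpace M] [T1Space M] {x : M}
    (h : ∀ m : ℕ, ∃ z, x = p ^ m • z) : x = 0 := by
  by_contra hx
  obtain ⟨m, hm⟩ := exists_pow_nsmul_mem (p := p)
    (isOpen_compl_singleton.mem_nhds (show (0 : M) ∈ ({x} : Set M)ᶜ from fun h => hx h.symm))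
  obtain ⟨z, hz⟩ := h m
  exact hm z hz.symm

/-- A homomorphism `f` to a free module over a group `N` of order `p` is bijective, if it is
surjective modulo the invariants, its kernel is invariant, and each invariant element of its source
is a trace. Indeed both the cokernel and the kernel are then divisible by `p`. -/
theorem bijective_of_trace {N : Type v} [Group N] [Fintype N] (hN : Fintype.card N = p)
    {P : Type w} [AddCommGroup P] [Module ℤ_[p] P] [TopologicalSpace P]
    (hP : IsProfiniteModule ℤ_[p] P) (π : Representation ℤ_[p] N P)
    {U : Type u} [AddCommGroup U] [Module ℤ_[p] U] [TopologicalSpace U]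
    (hU : IsProfiniteModule ℤ_[p] U) (ρ : Representation ℤ_[p] N U)
    {θ : U →ₗ[ℤ_[p]] U} (hθ : ∀ x, ∑ n, ρ n (θ (ρ n⁻¹ x)) = x)
    (f : P →L[ℤ_[p]] U) (hf : ∀ n c, f (π n c) = ρ n (f c))
    (hsurj : ∀ x, ∃ c, ∀ n, ρ n (x - f c) = x - f c)
    (hker : ∀ c, f c = 0 → ∀ n, π n c = c)
    (htrace : ∀ c, (∀ n, π n c = c) → ∃ d, ∑ n, π n d = c) : Function.Bijective f := by
  have := hU.isTopologicalAddGroup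
  have := hU.continuousSMul
  have := hU.compactSpace
  have := hU.t2Space
  have := hP.continuousSMul
  have := hP.compactSpace
  have := hP.t2Space
  have hinv : ∀ x, (∀ n, ρ n x = x) → ∑ n, ρ n (θ x) = x := by
    intro x hx
    conv_rhs => rw [← hθ x]
    exact Finset.sum_congr rfl fun n _ => by rw [hx]
  have hstep : ∀ x, ∃ c z, x = f c + p • z := by
    intro x
    obtain ⟨c, hc⟩ := hsurj x
    obtain ⟨d, hd⟩ := hsurj (θ (x - f c))
    refine ⟨c + ∑ n, π n d, θ (x - f c) - f d, ?_⟩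
    have h1 : ∑ n, ρ n (θ (x - f c) - f d) = p • (θ (x - f c) - f d) := by
      simp only [hd, Finset.sum_const, Finset.card_univ, hN]
    rw [← h1, map_add, map_sum]
    simp only [map_sub _ (θ (x - f c)), Finset.sum_sub_distrib, hf, hinv _ hc]
    abel
  have hpow : ∀ (m : ℕ) x, ∃ c z, x = f c + p ^ m • z := by
    intro m
    induction m with
    | zero => exact fun x => ⟨0, x, by simp⟩
    | succ m ih =>
      intro x
      obtain ⟨c, z, rfl⟩ := ih x
      obtain ⟨d, y, rfl⟩ := hstep z
      refine ⟨c + p ^ m • d, y, ?_⟩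
      rw [map_add, map_nsmul, smul_add, smul_smul, pow_succ]
      abel
  have hs : Function.Surjective f := by
    intro x
    by_contra hx
    have hcl : IsClosed (Set.range f) := (isCompact_range f.continuous).isClosed
    have h0 : {y | x - y ∉ Set.range f} ∈ 𝓝 (0 : U) :=
      (hcl.isOpen_compl.preimage (continuous_const.sub continuous_id)).mem_nhds (by
        change x - 0 ∈ (Set.range f)ᶜ
        rw [sub_zero]
        exact hx)
    obtain ⟨m, hm⟩ := exists_pow_nsmul_mem (p := p) h0
    obtain ⟨c, z, hcz⟩ := hpow m x
    exact hm z ⟨c, by rw [hcz, add_sub_cancel_right]⟩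
  have hk : ∀ c, f c = 0 → ∃ d, f d = 0 ∧ c = p • d := by
    intro c hc
    obtain ⟨d, hd⟩ := htrace c (hker c hc)
    have h1 : ∑ n, ρ n⁻¹ (f d) = 0 := by
      refine (Equiv.sum_comp (Equiv.inv N) fun n => ρ n (f d)).trans ?_
      rw [← hc, ← hd, map_sum]
      exact Finset.sum_congr rfl fun n _ => (hf n d).symm
    choose y hy using fun n : N => hs (θ (ρ n⁻¹ (f d)))
    have h2 : f d = ∑ n, (ρ n (f (y n)) - f (y n)) := by
      rw [Finset.sum_sub_distrib]
      simp only [hy]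
      rw [hθ, ← map_sum, h1, map_zero, sub_zero]
    set d' := d - ∑ n, (π n (y n) - y n) with hd'
    have h3 : f d' = 0 := by
      rw [hd', map_sub, map_sum, h2]
      simp only [map_sub, hf, sub_self]
    refine ⟨d', h3, ?_⟩
    let T : P →ₗ[ℤ_[p]] P := ∑ m, π m
    have hT : ∀ z, T z = ∑ m, π m z := fun z => by simp only [T, LinearMap.sum_apply]
    have h4 : ∀ n z, T (π n z) = T z := by
      intro n z
      rw [hT, hT, ← Equiv.sum_comp (Equiv.mulRight n) fun m => π m z]
      exact Finset.sum_congr rfl fun m _ => by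
        rw [Equiv.coe_mulRight, map_mul, Module.End.mul_apply]
    have h5 : ∑ m, π m d' = c := by
      rw [← hd, ← hT, ← hT, hd', map_sub, map_sum]
      simp only [map_sub, h4, sub_self, Finset.sum_const_zero, sub_zero]
    rw [← h5]
    simp only [hker d' h3, Finset.sum_const, Finset.card_univ, hN]
  refine ⟨(injective_iff_map_eq_zero f).2 fun c hc => ?_, hs⟩
  have hall : ∀ m : ℕ, ∃ z, f z = 0 ∧ c = p ^ m • z := by
    intro m
    induction m with
    | zero => exact ⟨c, hc, by simp⟩
    | succ m ih =>
      obtain ⟨z, hz, rfl⟩ := ih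
      obtain ⟨y, hy, rfl⟩ := hk z hz
      exact ⟨y, hy, by rw [smul_smul, pow_succ]⟩
  exact eq_zero_of_forall_eq_pow_nsmul (p := p) fun m => (hall m).imp fun _ h => h.2

end Trace

/-! ### Coefficients of elements of `ℤ_p(ζ)` -/

section Coefficients

variable {p : ℕ} [Fact p.Prime]

theorem eq_zero_of_forall_pow_dvd {x : ZpZeta p} (h : ∀ m : ℕ, (p : ZpZeta p) ^ m ∣ x) : x = 0 := by
  let B := (AdjoinRoot.powerBasis' (cyclotomic.monic p ℤ_[p])).basis
  apply B.equivFun.injective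
  rw [map_zero]
  refine eq_zero_of_forall_eq_pow_nsmul (p := p) fun m => ?_
  obtain ⟨z, rfl⟩ := h m
  refine ⟨B.equivFun z, ?_⟩
  rw [← map_nsmul, nsmul_eq_mul, Nat.cast_pow]

/-- The linear relations between the powers of `ζ` are the multiples of the sum of all powers. -/
theorem coeff_eq_of_sum_mul_zeta_pow {a : ℕ → ℤ_[p]}
    (ha : ∑ k ∈ Finset.range p,
      algebraMap ℤ_[p] (ZpZeta p) (a k) * ((zeta p : (ZpZeta p)ˣ) : ZpZeta p) ^ k = 0)
    {k : ℕ} (hk : k < p) : a k = a 0 := by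
  let q : ℤ_[p][X] := ∑ k ∈ Finset.range p, C (a k) * X ^ k
  have hcoeff : ∀ {k : ℕ}, k < p → q.coeff k = a k := by
    intro k hk
    simp [q, coeff_C_mul, coeff_X_pow, hk]
  have hq : AdjoinRoot.mk (cyclotomic p ℤ_[p]) q = 0 := by
    rw [← ha, map_sum]
    exact Finset.sum_congr rfl fun k _ => by
      rw [map_mul, map_pow]; rfl
  obtain ⟨s, hs⟩ := AdjoinRoot.mk_eq_zero.1 hq
  have hp := (Fact.out : p.Prime)
  have hdeg : q.natDegree ≤ p - 1 := by
    refine natDegree_sum_le_of_forall_le _ _ fun k hk => ?_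
    refine (natDegree_C_mul_X_pow_le _ _).trans ?_
    have := Finset.mem_range.1 hk
    omega
  have hs0 : s.natDegree = 0 := by
    by_cases h0 : s = 0
    · simp [h0]
    · have h1 := (cyclotomic.monic p ℤ_[p]).natDegree_mul' h0
      rw [← hs, natDegree_cyclotomic, Nat.totient_prime hp] at h1
      omega
  obtain ⟨c, rfl⟩ := natDegree_eq_zero.1 hs0
  have hall : ∀ {k : ℕ}, k < p → a k = c := by
    intro k hk
    rw [← hcoeff hk, hs, mul_comm, coeff_C_mul, cyclotomic_prime]
    simp [coeff_X_pow, hk]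
  rw [hall hk, hall hp.pos]

end Coefficients

/-! ### The quotient by the fixed points -/

section FixedQuotient

variable {p : ℕ} [Fact p.Prime] {G : Type v} [Group G]
  {U : Type u} [AddCommGroup U] [Module ℤ_[p] U]
  (ρ : Representation ℤ_[p] G U) {N : Subgroup G}
  (hN : N ≤ Subgroup.center G) (ψ : N ≃* Subgroup.zpowers (zeta p))

theorem proj_surjective : Function.Surjective (FixedQuotient.proj ρ hN ψ) :=
  Submodule.mkQ_surjective _

theorem proj_eq_zero {x : U} : FixedQuotient.proj ρ hN ψ x = 0 ↔ ∀ n ∈ N, ρ n x = x :=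
  (Submodule.Quotient.mk_eq_zero _).trans ⟨fun h n hn => h ⟨n, hn⟩, fun h n => h n n.2⟩

theorem zetaRep_proj (g : G) (x : U) :
    zetaRep ρ hN ψ g (FixedQuotient.proj ρ hN ψ x) = FixedQuotient.proj ρ hN ψ (ρ g x) := rfl

theorem algebraMap_smul_fixedQuotient (r : ℤ_[p]) (y : FixedQuotient ρ hN ψ) :
    algebraMap ℤ_[p] (ZpZeta p) r • y = r • y := by
  change (AdjoinRoot.mk (cyclotomic p ℤ_[p]) (C r) : ZpZeta p) • y = r • y
  rw [mk_smul, aeval_C]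
  rfl

theorem zeta_smul_fixedQuotient (y : FixedQuotient ρ hN ψ) :
    ((zeta p : (ZpZeta p)ˣ) : ZpZeta p) • y = zetaRep ρ hN ψ (generator ψ : G) y := by
  change (AdjoinRoot.mk (cyclotomic p ℤ_[p]) X : ZpZeta p) • y = _
  rw [mk_smul, aeval_X]
  rfl

theorem exists_generator_pow (n : N) : ∃ k < p, n = generator ψ ^ k := by
  have hfin : IsOfFinOrder (generator ψ) :=
    isOfFinOrder_iff_pow_eq_one.2 ⟨p, (Fact.out : p.Prime).pos, generator_pow ψ⟩
  obtain ⟨k, rfl⟩ := hfin.mem_powers_iff_mem_zpowers.2 (mem_zpowers_generator ψ n)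
  exact ⟨k % p, Nat.mod_lt _ (Fact.out : p.Prime).pos,
    (pow_eq_pow_mod k (generator_pow ψ))⟩

theorem coe_psi_generator_pow (k : ℕ) :
    ((ψ (generator ψ ^ k) : (ZpZeta p)ˣ) : ZpZeta p) = ((zeta p : (ZpZeta p)ˣ) : ZpZeta p) ^ k := by
  rw [map_pow, generator, MulEquiv.apply_symm_apply]
  simp

/-- Each element `n` of `N` acts on `U / U^N` as the scalar `ψ n`. -/
theorem zetaRep_of_mem (n : N) (y : FixedQuotient ρ hN ψ) :
    zetaRep ρ hN ψ (n : G) y = ((ψ n : (ZpZeta p)ˣ) : ZpZeta p) • y := by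
  obtain ⟨k, -, rfl⟩ := exists_generator_pow ψ n
  rw [coe_psi_generator_pow]
  induction k with
  | zero => simp
  | succ k ih =>
    have e : ((generator ψ ^ (k + 1) : N) : G) = (generator ψ ^ k : N) * (generator ψ : G) := by
      rw [pow_succ]; rfl
    rw [e, map_mul, Module.End.mul_apply, ← zeta_smul_fixedQuotient, map_smul, ih, smul_smul,
      pow_succ']

variable [TopologicalSpace U]

theorem isClosed_invariants (hρ : IsProfiniteRep ρ) (K : Subgroup G) :
    IsClosed {x : U | ∀ k ∈ K, ρ k x = x} := by
  have := hρ.isProfiniteModule.t2Space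
  have e : {x : U | ∀ k ∈ K, ρ k x = x} = ⋂ k ∈ K, {x | ρ k x = x} := by ext; simp
  rw [e]
  exact isClosed_biInter fun k _ => isClosed_eq (hρ.continuous k) continuous_id

theorem continuous_proj : Continuous (FixedQuotient.proj ρ hN ψ) := continuous_quot_mk

theorem fixedQuotient_isTopologicalAddGroup (hρ : IsProfiniteRep ρ) :
    IsTopologicalAddGroup (FixedQuotient ρ hN ψ) := by
  have := hρ.isProfiniteModule.isTopologicalAddGroup
  exact inferInstanceAs
    (IsTopologicalAddGroup (U ⧸ Representation.invariants (ρ.comp N.subtype)))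

theorem fixedQuotient_compactSpace (hρ : IsProfiniteRep ρ) :
    CompactSpace (FixedQuotient ρ hN ψ) := by
  have := hρ.isProfiniteModule.compactSpace
  exact Quotient.compactSpace

theorem fixedQuotient_t2Space (hρ : IsProfiniteRep ρ) :
    T2Space (FixedQuotient ρ hN ψ) := by
  have := hρ.isProfiniteModule.isTopologicalAddGroup
  have h : IsClosed (Representation.invariants (ρ.comp N.subtype) : Set U) := by
    convert isClosed_invariants ρ hρ N using 1
    ext x
    exact ⟨fun h n hn => h ⟨n, hn⟩, fun h n => h n n.2⟩
  exact inferInstanceAs (T2Space (U ⧸ Representation.invariants (ρ.comp N.subtype)))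

theorem isOpenMap_proj (hρ : IsProfiniteRep ρ) :
    IsOpenMap (FixedQuotient.proj ρ hN ψ) := by
  have := hρ.isProfiniteModule.isTopologicalAddGroup
  exact Submodule.isOpenMap_mkQ _

theorem fixedQuotient_isCountablyGenerated (hρ : IsProfiniteRep ρ)
    [(𝓝 (0 : U)).IsCountablyGenerated] :
    (𝓝 (0 : FixedQuotient ρ hN ψ)).IsCountablyGenerated := by
  have h := (isOpenMap_proj ρ hN ψ hρ).map_nhds_eq (continuous_proj ρ hN ψ).continuousAt (x := 0)
  rw [map_zero] at h
  rw [← h]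
  infer_instance

theorem continuous_zetaRep (hρ : IsProfiniteRep ρ) (g : G) :
    Continuous (zetaRep ρ hN ψ g) := by
  refine continuous_quot_lift _ ?_
  exact (continuous_proj ρ hN ψ).comp (hρ.continuous g)

variable [N.Normal] [Finite G]

/-- The fixed points of a subgroup lift from `U / U^N` to `U`, since the first cohomology of `U^N`
vanishes. -/
theorem exists_fixed_lift (hperm : IsPermutationLattice (ρ.quotientToInvariants N))
    (K : Subgroup G) (y : FixedQuotient ρ hN ψ) (hy : ∀ k ∈ K, zetaRep ρ hN ψ k y = y) :
    ∃ x, (∀ k ∈ K, ρ k x = x) ∧ FixedQuotient.proj ρ hN ψ x = y := by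
  obtain ⟨x, rfl⟩ := proj_surjective ρ hN ψ y
  let σ : Representation ℤ_[p] K (Representation.invariants (ρ.comp N.subtype)) :=
    (ρ.quotientToInvariants N).comp ((QuotientGroup.mk' N).comp K.subtype)
  have hσ : ∀ (k : K) w, ((σ k w : Representation.invariants (ρ.comp N.subtype)) : U) = ρ k w :=
    fun k w => rfl
  have hσp : IsPermutationLattice σ := by
    obtain ⟨⟨h1, h2⟩, X, h3, h4⟩ := hperm
    exact ⟨⟨h1, fun k => h2 _⟩, X, h3, fun k => h4 _⟩
  have hmem : ∀ k : K, ρ k x - x ∈ Representation.invariants (ρ.comp N.subtype) := by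
    intro k
    refine (Submodule.Quotient.eq _).1 ?_
    exact hy k k.2
  obtain ⟨w, hw⟩ := hσp.exists_coboundary (fun k => ⟨ρ k x - x, hmem k⟩) (by
    intro k l
    apply Subtype.ext
    rw [Submodule.coe_add, hσ]
    simp only [Subgroup.coe_mul, map_mul, Module.End.mul_apply, map_sub]
    abel)
  refine ⟨x - w, fun k hk => ?_, ?_⟩
  · have h1 := congrArg Subtype.val (hw ⟨k, hk⟩)
    rw [Submodule.coe_sub, hσ] at h1
    simp only at h1
    rw [map_sub, sub_eq_sub_iff_sub_eq_sub]
    exact h1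
  · rw [map_sub, (proj_eq_zero ρ hN ψ).2 fun n hn => w.2 ⟨n, hn⟩, sub_zero]

/-- The lifts of fixed points can be chosen to be small. -/
theorem exists_small_fixed_lift (hρ : IsProfiniteRep ρ)
    (hperm : IsPermutationLattice (ρ.quotientToInvariants N))
    (K : Subgroup G) {O : Set U} (hO : O ∈ 𝓝 (0 : U)) :
    ∃ Q ∈ 𝓝 (0 : FixedQuotient ρ hN ψ), ∀ y ∈ Q, (∀ k ∈ K, zetaRep ρ hN ψ k y = y) →
      ∃ x ∈ O, (∀ k ∈ K, ρ k x = x) ∧ FixedQuotient.proj ρ hN ψ x = y := by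
  have := hρ.isProfiniteModule.isTopologicalAddGroup
  have := hρ.isProfiniteModule.compactSpace
  have := hρ.isProfiniteModule.t2Space
  have := fixedQuotient_isTopologicalAddGroup ρ hN ψ hρ
  have := fixedQuotient_compactSpace ρ hN ψ hρ
  have := fixedQuotient_t2Space ρ hN ψ hρ
  let A : AddSubgroup U :=
    { carrier := {x | ∀ k ∈ K, ρ k x = x}
      zero_mem' := fun k _ => map_zero _
      add_mem' := fun {a b} ha hb k hk => by rw [map_add, ha k hk, hb k hk]
      neg_mem' := fun {a} ha k hk => by rw [map_neg, ha k hk] }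
  let B : AddSubgroup (FixedQuotient ρ hN ψ) :=
    { carrier := {y | ∀ k ∈ K, zetaRep ρ hN ψ k y = y}
      zero_mem' := fun k _ => map_zero _
      add_mem' := fun {a b} ha hb k hk => by rw [map_add, ha k hk, hb k hk]
      neg_mem' := fun {a} ha k hk => by rw [map_neg, ha k hk] }
  have hA : CompactSpace A := isCompact_iff_compactSpace.1 (isClosed_invariants ρ hρ K).isCompact
  have hBcl : IsClosed (B : Set (FixedQuotient ρ hN ψ)) := by
    have e : (B : Set (FixedQuotient ρ hN ψ)) = ⋂ k ∈ K, {x | zetaRep ρ hN ψ k x = x} := by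
      ext; simp [B]
    rw [e]
    exact isClosed_biInter fun k _ => isClosed_eq (continuous_zetaRep ρ hN ψ hρ k) continuous_id
  have hB : CompactSpace B := isCompact_iff_compactSpace.1 hBcl.isCompact
  let f : A →+ B := AddMonoidHom.mk' (fun x => ⟨FixedQuotient.proj ρ hN ψ x, fun k hk => by
    rw [zetaRep_proj, x.2 k hk]⟩) (fun x y => Subtype.ext (map_add _ _ _))
  have hf : Function.Surjective f := by
    rintro ⟨y, hy⟩
    obtain ⟨x, hx, rfl⟩ := exists_fixed_lift ρ hN ψ hperm K y hy
    exact ⟨⟨x, hx⟩, rfl⟩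
  have hfc : Continuous f :=
    ((continuous_proj ρ hN ψ).comp continuous_subtype_val).subtype_mk _
  have hopen := AddMonoidHom.isOpenMap_of_sigmaCompact f hf hfc
  have hO' : Subtype.val ⁻¹' O ∈ 𝓝 (0 : A) := continuous_subtype_val.continuousAt hO
  have h1 := hopen.image_mem_nhds hO'
  rw [map_zero, nhds_subtype_eq_comap] at h1
  obtain ⟨Q, hQ, hQf⟩ := Filter.mem_comap.1 h1
  refine ⟨Q, hQ, fun y hyQ hy => ?_⟩
  obtain ⟨x, hxO, hx⟩ := hQf (show (⟨y, hy⟩ : B) ∈ Subtype.val ⁻¹' Q from hyQ)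
  exact ⟨x, hxO, x.2, congrArg Subtype.val hx⟩

end FixedQuotient

/-- From closed sets that approach zero a family can be chosen that tends to zero. -/
theorem exists_null_selection {J X : Type*} [TopologicalSpace X] [Zero X]
    [(𝓝 (0 : X)).IsCountablyGenerated] (A : J → Set X) (hA : ∀ j, IsClosed (A j))
    (hne : ∀ j, (A j).Nonempty) (h : ∀ O ∈ 𝓝 (0 : X), ∀ᶠ j in cofinite, (A j ∩ O).Nonempty) :
    ∃ x : J → X, (∀ j, x j ∈ A j) ∧ Tendsto x cofinite (𝓝 0) := by
  classical
  obtain ⟨B, hB⟩ := (𝓝 (0 : X)).exists_antitone_basis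
  have hsel : ∀ j, ∃ x ∈ A j, ∀ n, (A j ∩ B n).Nonempty → x ∈ B n := by
    intro j
    by_cases hall : ∀ n, (A j ∩ B n).Nonempty
    · refine ⟨0, ?_, fun n _ => mem_of_mem_nhds (hB.mem n)⟩
      refine (hA j).closure_subset (mem_closure_iff_nhds.2 fun O hO => ?_)
      obtain ⟨n, hn⟩ := hB.mem_iff.1 hO
      obtain ⟨x, hxA, hxB⟩ := hall n
      exact ⟨x, hn hxB, hxA⟩
    · push Not at hall
      -- the last basic neighbourhood that `A j` meets
      have hfind := Nat.find_spec hall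
      have hlt : ∀ n, (A j ∩ B n).Nonempty → n < Nat.find hall := by
        intro n hn
        by_contra hle
        obtain ⟨x, hxA, hxB⟩ := hn
        have : x ∈ A j ∩ B (Nat.find hall) := ⟨hxA, hB.antitone (not_lt.1 hle) hxB⟩
        rw [hfind] at this
        exact this
      rcases Nat.eq_zero_or_pos (Nat.find hall) with h0 | h0
      · obtain ⟨x, hx⟩ := hne j
        exact ⟨x, hx, fun n hn => absurd (hlt n hn) (by omega)⟩
      · have h1 := Nat.find_min hall (m := Nat.find hall - 1) (by omega)
        obtain ⟨x, hxA, hxB⟩ := Set.nonempty_iff_ne_empty.2 h1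
        exact ⟨x, hxA, fun n hn => hB.antitone (by have := hlt n hn; omega) hxB⟩
  choose x hxA hxB using hsel
  refine ⟨x, hxA, hB.tendsto_right_iff.2 fun n _ => ?_⟩
  filter_upwards [h (B n) (hB.mem n)] with j hj
  exact hxB j n hj

/-! ### Permutation lattices on coset spaces -/

section CosetIndex

variable {G : Type v} [Group G] {J : Type w}

/-- The disjoint union of the `G`-sets `G ⧸ K j`. It is stored by the value `S` of the subgroup, so
that the indices `j` with `K j = S` can be exchanged without transporting cosets. -/
def CosetIndex (K : J → Subgroup G) : Type (max v w) :=
  Σ S : Subgroup G, {j // K j = S} × (G ⧸ S)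

namespace CosetIndex

variable {K : J → Subgroup G}

/-- The coset `g K_j`, as an element of the copy of `G ⧸ K j` with index `j`. -/
def mk (j : J) (g : G) : CosetIndex K := ⟨K j, ⟨j, rfl⟩, (g : G ⧸ K j)⟩

theorem exists_mk (i : CosetIndex K) : ∃ j g, i = mk j g := by
  obtain ⟨S, ⟨j, rfl⟩, q⟩ := i
  induction q using QuotientGroup.induction_on with
  | H g => exact ⟨j, g, rfl⟩

theorem mk_eq_mk {j j' : J} {g g' : G} :
    (mk j g : CosetIndex K) = mk j' g' ↔ j = j' ∧ g⁻¹ * g' ∈ K j := by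
  constructor
  · intro h
    have hj : j = j' := by
      have h1 := congrArg (fun i : CosetIndex K => (i.2.1 : J)) h
      exact h1
    subst hj
    refine ⟨rfl, ?_⟩
    have h1 := eq_of_heq (Sigma.mk.inj h).2
    exact QuotientGroup.eq.1 (congrArg Prod.snd h1)
  · rintro ⟨rfl, h⟩
    have h1 : (g : G ⧸ K j) = g' := QuotientGroup.eq.2 h
    change (⟨K j, ⟨j, rfl⟩, (g : G ⧸ K j)⟩ : CosetIndex K) = ⟨K j, ⟨j, rfl⟩, (g' : G ⧸ K j)⟩
    rw [h1]

instance : MulAction G (CosetIndex K) where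
  smul g i := ⟨i.1, i.2.1, g • i.2.2⟩
  one_smul i := by
    change (⟨i.1, i.2.1, (1 : G) • i.2.2⟩ : CosetIndex K) = i
    rw [one_smul]
    rfl
  mul_smul g h i := by
    change (⟨i.1, i.2.1, (g * h) • i.2.2⟩ : CosetIndex K) = ⟨i.1, i.2.1, g • h • i.2.2⟩
    rw [mul_smul]

theorem smul_mk (g h : G) (j : J) : g • (mk j h : CosetIndex K) = mk j (g * h) := rfl

/-- The chosen member of the class of `i`: the index `j` is replaced by a fixed one with the same
subgroup `K j`, and the coset is kept. -/
noncomputable def base (i : CosetIndex K) : CosetIndex K :=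
  ⟨i.1, Classical.choice ⟨i.2.1⟩, i.2.2⟩

theorem base_base (i : CosetIndex K) : base (base i) = base i := rfl

theorem base_smul (g : G) (i : CosetIndex K) : base (g • i) = g • base i := rfl

theorem finite_range_base [Finite G] : (Set.range (base (K := K))).Finite := by
  have : Finite (Σ S : Subgroup G, G ⧸ S) := inferInstance
  let c : CosetIndex K → Σ S : Subgroup G, G ⧸ S := fun i => ⟨i.1, i.2.2⟩
  refine Set.Finite.of_finite_image (f := c) (Set.toFinite _) ?_
  rintro _ ⟨⟨S, j, q⟩, rfl⟩ _ ⟨⟨S', j', q'⟩, rfl⟩ h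
  have hS : S = S' := congrArg Sigma.fst h
  subst hS
  have hq : q = q' := eq_of_heq (Sigma.mk.inj h).2
  subst hq
  rfl

end CosetIndex

variable {p : ℕ} [Fact p.Prime]

variable (G p) in
/-- The action of `G` on the functions on a `G`-set. -/
noncomputable def permRep (I : Type*) [MulAction G I] : Representation ℤ_[p] G (I → ℤ_[p]) where
  toFun g := LinearMap.funLeft ℤ_[p] ℤ_[p] fun i => g⁻¹ • i
  map_one' := by ext; simp [LinearMap.funLeft]
  map_mul' g h := by ext; simp [LinearMap.funLeft, mul_smul]

theorem permRep_apply {I : Type*} [MulAction G I] (g : G) (c : I → ℤ_[p]) (i : I) :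
    permRep G p I g c i = c (g⁻¹ • i) := rfl

open Classical in
theorem permRep_single {I : Type*} [MulAction G I] (g : G) (i : I) :
    permRep G p I g (Pi.single i 1) = Pi.single (g • i) 1 := by
  ext k
  simp only [permRep_apply, Pi.single_apply, inv_smul_eq_iff]

theorem continuous_permRep {I : Type*} [MulAction G I] (g : G) : Continuous (permRep G p I g) :=
  continuous_pi fun _ => continuous_apply _

/-- An invariant function on a free `G`-set is the trace of its restriction to a set of
representatives of the orbits. -/
theorem exists_sum_permRep_eq [Fintype G] {I : Type*} [MulAction G I]
    (hfree : ∀ (g : G) (i : I), g • i = i → g = 1) (c : I → ℤ_[p])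
    (hc : ∀ g, permRep G p I g c = c) : ∃ d, ∑ g, permRep G p I g d = c := by
  classical
  let r : I → I := fun i => (Quotient.mk (MulAction.orbitRel G I) i).out
  have hr : ∀ i, ∃ g : G, g⁻¹ • i = r i := by
    intro i
    have h1 : MulAction.orbitRel G I (r i) i := Quotient.mk_out (s := MulAction.orbitRel G I) i
    obtain ⟨g, hg⟩ := MulAction.orbitRel_apply.1 h1
    exact ⟨g⁻¹, by rw [inv_inv]; exact hg⟩
  have hrg : ∀ (g : G) i, r (g • i) = r i := by
    intro g i
    have : (Quotient.mk (MulAction.orbitRel G I) (g • i)) = Quotient.mk _ i :=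
      Quotient.sound (MulAction.orbitRel_apply.2 ⟨g, rfl⟩)
    simp only [r, this]
  refine ⟨fun i => if r i = i then c i else 0, ?_⟩
  ext i
  rw [Finset.sum_apply]
  simp only [permRep_apply, hrg]
  obtain ⟨g, hg⟩ := hr i
  rw [Finset.sum_eq_single_of_mem g (Finset.mem_univ _)]
  · rw [if_pos hg.symm, ← permRep_apply g c i, hc]
  · intro h _ hne
    refine if_neg fun h1 => hne ?_
    have h2 : h⁻¹ • i = g⁻¹ • i := h1.symm.trans hg.symm
    have h3 := hfree (g * h⁻¹) i (by rw [mul_smul, h2, smul_inv_smul])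
    exact (mul_inv_eq_one.1 h3).symm

open Classical in
/-- A lattice with an equivariant null family `e` that is a topological basis is a permutation
lattice. -/
theorem isPermutationLattice_of_null [Finite G] {U : Type u} [AddCommGroup U] [Module ℤ_[p] U]
    [TopologicalSpace U] {ρ : Representation ℤ_[p] G U} (hρ : IsProfiniteRep ρ)
    {K : J → Subgroup G} (e : CosetIndex K → U) (he : Tendsto e cofinite (𝓝 0))
    (heρ : ∀ g i, ρ g (e i) = e (g • i))
    (f : (CosetIndex K → ℤ_[p]) →L[ℤ_[p]] U) (hf : ∀ i, f (Pi.single i 1) = e i)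
    (hbij : Function.Bijective f) : IsPermutationLattice ρ := by
  refine ⟨hρ, _, isProfiniteBasis_of_null hρ.isProfiniteModule e he f hf hbij CosetIndex.base
    CosetIndex.finite_range_base CosetIndex.base_base, ?_⟩
  rintro g _ ⟨i, rfl⟩
  refine ⟨g • i, ?_⟩
  simp only [CosetIndex.base_smul, smul_left_cancel_iff]
  split_ifs
  · rw [heρ]
  · rw [map_add, heρ, heρ]

/-- If the vectors `x j` are fixed by the subgroups `K j` and tend to zero, then so do their
translates, which are indexed by the cosets of the `K j`. -/
theorem exists_cosetIndex_family [Finite G] {U : Type u} [AddCommGroup U] [Module ℤ_[p] U]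
    [TopologicalSpace U] {ρ : Representation ℤ_[p] G U} (hρ : IsProfiniteRep ρ)
    {K : J → Subgroup G} (x : J → U) (hx : ∀ j, ∀ k ∈ K j, ρ k (x j) = x j)
    (hx0 : Tendsto x cofinite (𝓝 0)) :
    ∃ e : CosetIndex K → U, (∀ j g, e (CosetIndex.mk j g) = ρ g (x j)) ∧
      Tendsto e cofinite (𝓝 0) := by
  have hex : ∀ i : CosetIndex K, ∃ y, ∀ j g, i = CosetIndex.mk j g → y = ρ g (x j) := by
    intro i
    obtain ⟨j, g, rfl⟩ := i.exists_mk
    refine ⟨ρ g (x j), fun j' g' h => ?_⟩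
    obtain ⟨rfl, h3⟩ := CosetIndex.mk_eq_mk.1 h
    have h4 := hx j _ h3
    rw [← h4, ← Module.End.mul_apply, ← map_mul, mul_inv_cancel_left, h4]
  choose e he' using hex
  have he : ∀ j g, e (CosetIndex.mk j g) = ρ g (x j) := fun j g => he' _ j g rfl
  refine ⟨e, he, ?_⟩
  intro O hO
  have h1 : ∀ g : G, {j | ρ g (x j) ∉ O}.Finite := by
    intro g
    have h2 : Tendsto (fun j => ρ g (x j)) cofinite (𝓝 (ρ g 0)) :=
      ((hρ.continuous g).tendsto 0).comp hx0
    rw [map_zero] at h2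
    exact h2 hO
  refine (Set.finite_iUnion fun g : G => (h1 g).image fun j => CosetIndex.mk (K := K) j g).subset ?_
  intro i hi
  obtain ⟨j, g, rfl⟩ := i.exists_mk
  refine Set.mem_iUnion.2 ⟨g, j, ?_, rfl⟩
  change e _ ∉ O at hi
  rwa [he] at hi

end CosetIndex

/-! ### Comparison with the quotient by the fixed points -/

section Comparison

variable {p : ℕ} [Fact p.Prime]

/-- A `ℤ_p`-linear map on functions with values in `ℤ_p(ζ)` vanishes if it is `p`-adically
continuous and vanishes on the unit vectors. -/
theorem eq_zero_of_single {I : Type*} [DecidableEq I] (D : (I → ℤ_[p]) →ₗ[ℤ_[p]] ZpZeta p)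
    (hD : ∀ m : ℕ, {c | (p : ZpZeta p) ^ m ∣ D c} ∈ 𝓝 0) (h : ∀ i, D (Pi.single i 1) = 0)
    (c : I → ℤ_[p]) : D c = 0 := by
  refine eq_zero_of_forall_pow_dvd fun m => ?_
  obtain ⟨s, t, hs, ht, hst⟩ : ∃ (s : Set I) (t : I → Set ℤ_[p]), s.Finite ∧
      (∀ i, t i ∈ 𝓝 0) ∧ s.pi t ⊆ {c | (p : ZpZeta p) ^ m ∣ D c} := by
    have h1 := hD m
    rw [nhds_pi, Filter.mem_pi] at h1
    obtain ⟨s, hs, t, ht, hst⟩ := h1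
    exact ⟨s, t, hs, ht, hst⟩
  set a : I → ℤ_[p] := ∑ i ∈ hs.toFinset, c i • Pi.single i 1 with ha
  have h1 : D a = 0 := by
    rw [ha, map_sum]
    exact Finset.sum_eq_zero fun i _ => by rw [map_smul, h, smul_zero]
  have h2 : c - a ∈ s.pi t := by
    intro i hi
    have h3 : a i = c i := by
      rw [ha, Finset.sum_apply, Finset.sum_eq_single_of_mem i (hs.mem_toFinset.2 hi)]
      · simp
      · intro k _ hk
        simp [Pi.single_eq_of_ne hk.symm]
    rw [Pi.sub_apply, h3, sub_self]
    exact mem_of_mem_nhds (ht i)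
  have h4 : (p : ZpZeta p) ^ m ∣ D (c - a) := hst h2
  rwa [map_sub, h1, sub_zero] at h4

variable {G : Type v} [Group G] {N : Subgroup G} (ψ : N ≃* Subgroup.zpowers (zeta p))

theorem zpowers_coe_injective (z z' : Subgroup.zpowers (zeta p))
    (h : ((z : (ZpZeta p)ˣ) : ZpZeta p) = (z' : (ZpZeta p)ˣ)) : z = z' :=
  Subtype.ext (Units.ext h)

theorem zpowers_coe_ne_zero (z : Subgroup.zpowers (zeta p)) :
    ((z : (ZpZeta p)ˣ) : ZpZeta p) ≠ 0 := by
  have : Nontrivial (ZpZeta p) := (residue p).domain_nontrivial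
  exact Units.ne_zero _

/-- The linear relations between the values of the faithful character `ψ` are the multiples of the
sum of all values. -/
theorem eq_of_sum_mul_psi [Fintype N] {a : N → ℤ_[p]}
    (ha : ∑ n, algebraMap ℤ_[p] (ZpZeta p) (a n) * ((ψ n : (ZpZeta p)ˣ) : ZpZeta p) = 0)
    (hN : Fintype.card N = p) (n : N) : a n = a 1 := by
  have hbij : Function.Bijective fun k : Fin p => generator ψ ^ (k : ℕ) := by
    rw [Fintype.bijective_iff_surjective_and_card, Fintype.card_fin, hN]
    refine ⟨fun n => ?_, rfl⟩
    obtain ⟨k, hk, rfl⟩ := exists_generator_pow ψ n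
    exact ⟨⟨k, hk⟩, rfl⟩
  rw [← hbij.sum_comp] at ha
  simp only [coe_psi_generator_pow] at ha
  rw [Fin.sum_univ_eq_sum_range (fun k => algebraMap ℤ_[p] (ZpZeta p) (a (generator ψ ^ k)) *
    ((zeta p : (ZpZeta p)ˣ) : ZpZeta p) ^ k)] at ha
  obtain ⟨k, hk, rfl⟩ := exists_generator_pow ψ n
  have h1 := coeff_eq_of_sum_mul_zeta_pow ha hk
  simpa using h1

variable {U : Type u} [AddCommGroup U] [Module ℤ_[p] U] [TopologicalSpace U]
  {ρ : Representation ℤ_[p] G U} {hN : N ≤ Subgroup.center G} {ψ}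

open Classical in
/-- If the images of the family `x j` in `U / U^N` admit coordinate functionals `l j` as in the
decomposition of a generalized permutation lattice, then a relation between the translates of the
`x j` has coefficients that are constant on the orbits of `N`. -/
theorem permRep_eq_of_map_eq_zero [Finite G] (hcard : Nat.card N = p) (hρ : IsProfiniteRep ρ)
    {J : Type} {H : J → Subgroup G} {φ : ∀ j, H j →* Subgroup.zpowers (zeta p)}
    {K : J → Subgroup G} (hK : ∀ j g, g ∈ K j ↔ ∃ h : g ∈ H j, φ j ⟨g, h⟩ = 1)
    (hNH : ∀ j n (hn : n ∈ N), ∃ h : n ∈ H j, φ j ⟨n, h⟩ = ψ ⟨n, hn⟩)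
    {x : J → U} {l : J → (FixedQuotient ρ hN ψ →ₗ[ZpZeta p] ZpZeta p)}
    (hl : ∀ j k g, j ≠ k →
      l j (zetaRep ρ hN ψ g (FixedQuotient.proj ρ hN ψ (x k))) = 0)
    (hl1 : ∀ j g, l j (zetaRep ρ hN ψ g (FixedQuotient.proj ρ hN ψ (x j))) =
      if hg : g ∈ H j then ((φ j ⟨g, hg⟩ : (ZpZeta p)ˣ) : ZpZeta p) else 0)
    (hlc : ∀ (j) (m : ℕ), {y | (p : ZpZeta p) ^ m ∣ l j y} ∈ 𝓝 0)
    (f : (CosetIndex K → ℤ_[p]) →L[ℤ_[p]] U)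
    (hf : ∀ j g, f (Pi.single (CosetIndex.mk j g) 1) = ρ g (x j))
    {c : CosetIndex K → ℤ_[p]} (hc : f c = 0) (n : N) :
    permRep G p (CosetIndex K) (n : G) c = c := by
  have := Fintype.ofFinite N
  have hcard' : Fintype.card N = p := by rw [← hcard, Nat.card_eq_fintype_card]
  -- the coordinate of `f c` at the translate of `x j` by `g`
  let D₁ : J → G → (CosetIndex K → ℤ_[p]) →ₗ[ℤ_[p]] ZpZeta p := fun j g =>
    { toFun c := l j (zetaRep ρ hN ψ g⁻¹ (FixedQuotient.proj ρ hN ψ (f c)))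
      map_add' c d := by simp only [map_add]
      map_smul' r c := by
        rw [map_smul, map_smul, ← algebraMap_smul_fixedQuotient, map_smul, map_smul, smul_eq_mul,
          RingHom.id_apply, Algebra.smul_def] }
  let D₂ : J → G → (CosetIndex K → ℤ_[p]) →ₗ[ℤ_[p]] ZpZeta p := fun j g =>
    ∑ n : N, (LinearMap.mulRight ℤ_[p] ((ψ n : (ZpZeta p)ˣ) : ZpZeta p) ∘ₗ
      Algebra.linearMap ℤ_[p] (ZpZeta p)) ∘ₗ LinearMap.proj (CosetIndex.mk j (g * n))
  have hD₁ : ∀ j g c, D₁ j g c = l j (zetaRep ρ hN ψ g⁻¹ (FixedQuotient.proj ρ hN ψ (f c))) :=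
    fun _ _ _ => rfl
  have hD₂ : ∀ j g c, D₂ j g c = ∑ n : N, algebraMap ℤ_[p] (ZpZeta p)
      (c (CosetIndex.mk j (g * n))) * ((ψ n : (ZpZeta p)ˣ) : ZpZeta p) := by
    intro j g c
    simp only [D₂, LinearMap.sum_apply]
    rfl
  have hsingle : ∀ j g i, D₁ j g (Pi.single i 1) = D₂ j g (Pi.single i 1) := by
    intro j g i
    obtain ⟨k, t, rfl⟩ := i.exists_mk
    rw [hD₁, hD₂, hf, ← zetaRep_proj, ← Module.End.mul_apply, ← map_mul]
    by_cases hjk : j = k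
    · subst hjk
      rw [hl1]
      simp only [Pi.single_apply, CosetIndex.mk_eq_mk, true_and]
      have hmem : ∀ n : N, (n : G) ∈ H j := fun n => (hNH j n n.2).1
      split_ifs with hg
      · -- the only contribution comes from the `n` for which `ψ n` is the value of the character
        set n := ψ.symm (φ j ⟨_, hg⟩) with hn
        have hψn : ψ n = φ j ⟨_, hg⟩ := by rw [hn, MulEquiv.apply_symm_apply]
        have hiff : ∀ m : N, (g * (m : G))⁻¹ * t ∈ K j ↔ m = n := by
          intro m
          have e : (g * (m : G))⁻¹ * t = (m : G)⁻¹ * (g⁻¹ * t) := by group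
          rw [e, hK]
          have hmH : (m : G)⁻¹ * (g⁻¹ * t) ∈ H j := mul_mem (inv_mem (hmem m)) hg
          have hval : φ j ⟨_, hmH⟩ = (ψ m)⁻¹ * ψ n := by
            obtain ⟨h2, h3⟩ := hNH j m m.2
            rw [hψn, ← show φ j ⟨m, h2⟩ = ψ m from h3, ← map_inv, ← map_mul]
            rfl
          constructor
          · rintro ⟨h1, h2⟩
            have h3 : (ψ m)⁻¹ * ψ n = 1 := hval.symm.trans h2
            exact ψ.injective (inv_mul_eq_one.1 h3)
          · rintro rfl
            exact ⟨hmH, by rw [hval, inv_mul_cancel]⟩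
        rw [Finset.sum_eq_single_of_mem n (Finset.mem_univ _)]
        · rw [if_pos ((hiff n).2 rfl), map_one, one_mul, hψn]
        · intro m _ hm
          rw [if_neg (fun h => hm ((hiff m).1 h)), map_zero, zero_mul]
      · symm
        refine Finset.sum_eq_zero fun m _ => ?_
        rw [if_neg, map_zero, zero_mul]
        intro h1
        obtain ⟨h2, -⟩ := (hK j _).1 h1
        apply hg
        have e : g⁻¹ * t = (m : G) * ((g * (m : G))⁻¹ * t) := by group
        rw [e]
        exact mul_mem (hmem m) h2
    · rw [hl j k _ hjk]
      symm
      refine Finset.sum_eq_zero fun m _ => ?_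
      rw [Pi.single_eq_of_ne, map_zero, zero_mul]
      intro h
      exact hjk (CosetIndex.mk_eq_mk.1 h).1
  have hcont₁ : ∀ j g (m : ℕ), {c | (p : ZpZeta p) ^ m ∣ D₁ j g c} ∈ 𝓝 0 := by
    intro j g m
    have h1 : Continuous fun c => zetaRep ρ hN ψ g⁻¹ (FixedQuotient.proj ρ hN ψ (f c)) :=
      (continuous_zetaRep ρ hN ψ hρ g⁻¹).comp ((continuous_proj ρ hN ψ).comp f.continuous)
    have h2 := h1.tendsto 0
    simp only [map_zero] at h2
    exact h2 (hlc j m)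
  have hcont₂ : ∀ j g (m : ℕ), {c | (p : ZpZeta p) ^ m ∣ D₂ j g c} ∈ 𝓝 0 := by
    intro j g m
    have h1 : ∀ n : N, {c : CosetIndex K → ℤ_[p] | (p : ℤ_[p]) ^ m ∣ c (CosetIndex.mk j (g * n))} ∈
        𝓝 0 := fun n =>
      ((isOpen_setOf_pow_dvd m).preimage (continuous_apply (A := fun _ => ℤ_[p])
        (CosetIndex.mk (K := K) j (g * n)))).mem_nhds (dvd_zero _)
    filter_upwards [Filter.iInter_mem.2 h1] with c hc
    rw [hD₂]
    refine Finset.dvd_sum fun n _ => Dvd.dvd.mul_right ?_ _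
    have h2 := map_dvd (algebraMap ℤ_[p] (ZpZeta p)) (Set.mem_iInter.1 hc n)
    rwa [map_pow, map_natCast] at h2
  have heq : ∀ j g, D₂ j g c = 0 := by
    intro j g
    have h1 := eq_zero_of_single (D₁ j g - D₂ j g) (fun m => by
      filter_upwards [hcont₁ j g m, hcont₂ j g m] with c h1 h2 using dvd_sub h1 h2)
      (fun i => by rw [LinearMap.sub_apply, hsingle, sub_self]) c
    rw [LinearMap.sub_apply, sub_eq_zero] at h1
    rw [← h1, hD₁, hc, map_zero, map_zero, map_zero]
  ext i
  obtain ⟨j, g, rfl⟩ := i.exists_mk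
  have h1 := heq j g
  rw [hD₂] at h1
  have h2 := eq_of_sum_mul_psi ψ h1 hcard' n⁻¹
  rw [permRep_apply, CosetIndex.smul_mk]
  have e : ((n : G)⁻¹ * g) = g * (n⁻¹ : N) :=
    (Subgroup.mem_center_iff.1 (hN (n⁻¹).2) g).symm
  rw [e, h2, OneMemClass.coe_one, mul_one]

/-- If the translates of the images of the `x j` span a dense submodule of `U / U^N`, then the
closed submodule of `U` generated by the translates of the `x j` maps onto `U / U^N`. -/
theorem exists_proj_eq [Finite G] (hρ : IsProfiniteRep ρ) {J : Type} {K : J → Subgroup G} {x : J → U}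
    (hdense : ∀ y, ∀ O ∈ 𝓝 (0 : FixedQuotient ρ hN ψ), ∃ s ∈ Submodule.span (ZpZeta p)
      (Set.range fun i : J × G => zetaRep ρ hN ψ i.2 (FixedQuotient.proj ρ hN ψ (x i.1))),
      y - s ∈ O)
    (f : (CosetIndex K → ℤ_[p]) →L[ℤ_[p]] U)
    (hfρ : ∀ g c, f (permRep G p (CosetIndex K) g c) = ρ g (f c))
    (hfx : ∀ j g, ∃ c, f c = ρ g (x j)) (y : FixedQuotient ρ hN ψ) :
    ∃ c, FixedQuotient.proj ρ hN ψ (f c) = y := by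
  have := hρ.isProfiniteModule.isTopologicalAddGroup
  have := fixedQuotient_isTopologicalAddGroup ρ hN ψ hρ
  have := fixedQuotient_t2Space ρ hN ψ hρ
  let R : Submodule ℤ_[p] (FixedQuotient ρ hN ψ) :=
    LinearMap.range (FixedQuotient.proj ρ hN ψ ∘ₗ f.toLinearMap)
  have hR : ∀ z, z ∈ R ↔ ∃ c, FixedQuotient.proj ρ hN ψ (f c) = z := fun z => Iff.rfl
  have hzeta : ∀ z ∈ R, quotientRep ρ hN ψ (generator ψ : G) z ∈ R := by
    intro z hz
    obtain ⟨c, rfl⟩ := (hR z).1 hz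
    refine (hR _).2 ⟨permRep G p (CosetIndex K) (generator ψ : G) c, ?_⟩
    rw [hfρ]
    rfl
  have hsmul : ∀ (r : ZpZeta p), ∀ z ∈ R, r • z ∈ R := by
    intro r z hz
    obtain ⟨q, rfl⟩ := AdjoinRoot.mk_surjective r
    rw [mk_smul]
    induction q using Polynomial.induction_on with
    | C a => rw [aeval_C]; exact R.smul_mem a hz
    | add q s hq hs => rw [map_add]; exact R.add_mem hq hs
    | monomial k a h =>
      rw [pow_succ', mul_left_comm, map_mul, aeval_X, Module.End.mul_apply]
      exact hzeta _ h
  let R' : Submodule (ZpZeta p) (FixedQuotient ρ hN ψ) :=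
    { R with smul_mem' := fun r z hz => hsmul r z hz }
  have hspan : Submodule.span (ZpZeta p)
      (Set.range fun i : J × G => zetaRep ρ hN ψ i.2 (FixedQuotient.proj ρ hN ψ (x i.1))) ≤ R' := by
    refine Submodule.span_le.2 ?_
    rintro _ ⟨⟨j, g⟩, rfl⟩
    obtain ⟨c, hc⟩ := hfx j g
    exact (hR _).2 ⟨c, by rw [hc]; rfl⟩
  have hcl : IsClosed (Set.range fun c => FixedQuotient.proj ρ hN ψ (f c)) :=
    (isCompact_range ((continuous_proj ρ hN ψ).comp f.continuous)).isClosed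
  refine hcl.closure_subset (mem_closure_iff_nhds.2 fun O hO => ?_)
  have h0 : {z | y - z ∈ O} ∈ 𝓝 (0 : FixedQuotient ρ hN ψ) := by
    refine (continuous_const.sub continuous_id).continuousAt.preimage_mem_nhds ?_
    simpa using hO
  obtain ⟨s, hs, hsO⟩ := hdense y _ h0
  refine ⟨s, ?_, hspan hs⟩
  have h1 : y - (y - s) ∈ O := hsO
  rwa [sub_sub_cancel] at h1

end Comparison

end ProfiniteLattice

open Topology Filter ProfiniteLattice
theorem theorem2p7 (p : ℕ) [Fact p.Prime] {G : Type v} [Group G] [Finite G] (hG : IsPGroup p G)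
    {U : Type u} [AddCommGroup U] [Module ℤ_[p] U] [TopologicalSpace U]
    [SecondCountableTopology U]
    (ρ : Representation ℤ_[p] G U) (hU : ProfiniteLattice.IsLattice ρ)
    (N : Subgroup G) [N.Normal] (hN : N ≤ Subgroup.center G) (hcard : Nat.card N = p)
    (hfree : ProfiniteLattice.IsFree (ρ.comp N.subtype))
    (hperm : ProfiniteLattice.IsPermutationLattice (ρ.quotientToInvariants N))
    (ψ : N ≃* Subgroup.zpowers (ProfiniteLattice.zeta p))
    (hgen : ProfiniteLattice.IsGenPerm.{u, v, w} (ProfiniteLattice.zetaRep ρ hN ψ)) :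
    ProfiniteLattice.IsPermutationLattice ρ := by
  classical
  have := Fintype.ofFinite N
  have hρ := hU.1
  obtain ⟨θ, hθ⟩ := hfree.exists_trace_eq_id
  have := hρ.isProfiniteModule.t2Space
  have := fixedQuotient_t2Space ρ hN ψ hρ
  have := fixedQuotient_isCountablyGenerated ρ hN ψ hρ
  obtain ⟨J, H, φ, y, l, hy, hy0, hdense, hl, hl1, hlc⟩ := hgen.exists_generators hG
  have hnz := zpowers_coe_ne_zero (p := p)
  -- the scalars by which `N` acts show that `N ≤ H j`, and that `φ j` extends `ψ`
  have hNH : ∀ j n (hn : n ∈ N), ∃ h : n ∈ H j, φ j ⟨n, h⟩ = ψ ⟨n, hn⟩ := by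
    intro j n hn
    have h1 : l j (y j) = 1 := by
      have h2 := hl1 j 1
      rw [map_one, Module.End.one_apply, dif_pos (one_mem _)] at h2
      rw [h2, show (⟨1, one_mem _⟩ : H j) = 1 from rfl, map_one]
      rfl
    have h2 := hl1 j n
    rw [show zetaRep ρ hN ψ n (y j) = _ from zetaRep_of_mem ρ hN ψ ⟨n, hn⟩ (y j), map_smul, h1,
      smul_eq_mul, mul_one] at h2
    by_cases h : n ∈ H j
    · rw [dif_pos h] at h2
      exact ⟨h, (zpowers_coe_injective _ _ h2).symm⟩
    · rw [dif_neg h] at h2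
      exact absurd h2 (hnz _)
  let K : J → Subgroup G := fun j => (φ j).ker.map (H j).subtype
  have hK : ∀ j g, g ∈ K j ↔ ∃ h : g ∈ H j, φ j ⟨g, h⟩ = 1 := by
    intro j g
    rw [Subgroup.mem_map]
    constructor
    · rintro ⟨h, hh, rfl⟩
      exact ⟨h.2, hh⟩
    · rintro ⟨h, hh⟩
      exact ⟨⟨g, h⟩, hh, rfl⟩
  have hyK : ∀ j, ∀ k ∈ K j, zetaRep ρ hN ψ k (y j) = y j := by
    intro j k hk
    obtain ⟨h, hk1⟩ := (hK j k).1 hk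
    have h1 := hy j ⟨k, h⟩
    rw [hk1] at h1
    refine h1.trans ?_
    exact one_smul (ZpZeta p) (y j)
  obtain ⟨x, hx, hx0⟩ := exists_null_selection
    (fun j => {x | (∀ k ∈ K j, ρ k x = x) ∧ FixedQuotient.proj ρ hN ψ x = y j})
    (fun j => (isClosed_invariants ρ hρ (K j)).inter
      (isClosed_singleton.preimage (continuous_proj ρ hN ψ)))
    (fun j => exists_fixed_lift ρ hN ψ hperm (K j) (y j) (hyK j)) (by
      intro O hO
      choose Q hQ hQO using fun S : Subgroup G => exists_small_fixed_lift ρ hN ψ hρ hperm S hO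
      filter_upwards [hy0 (Filter.iInter_mem.2 hQ)] with j hj
      obtain ⟨x, hxO, hx⟩ := hQO (K j) (y j) (Set.mem_iInter.1 hj (K j)) (hyK j)
      exact ⟨x, hx, hxO⟩)
  have hxy : ∀ j, y j = FixedQuotient.proj ρ hN ψ (x j) := fun j => (hx j).2.symm
  simp only [hxy] at hdense hl hl1
  obtain ⟨e, he, he0⟩ := exists_cosetIndex_family hρ (K := K) x (fun j => (hx j).1) hx0
  have heρ : ∀ g i, ρ g (e i) = e (g • i) := by
    intro g i
    obtain ⟨j, h, rfl⟩ := i.exists_mk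
    rw [CosetIndex.smul_mk, he, he, map_mul, Module.End.mul_apply]
  obtain ⟨f, hf⟩ := hρ.isProfiniteModule.exists_hom_pi e he0
  have hfρ : ∀ g c, f (permRep G p (CosetIndex K) g c) = ρ g (f c) := by
    intro g c
    have h1 : f.comp ⟨permRep G p (CosetIndex K) g, continuous_permRep g⟩ =
        (⟨ρ g, hρ.continuous g⟩ : U →L[ℤ_[p]] U).comp f := hom_ext_pi fun i => by
      change f (permRep G p (CosetIndex K) g (Pi.single i 1)) = ρ g (f (Pi.single i 1))
      rw [permRep_single, hf, hf, heρ]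
    exact DFunLike.congr_fun h1 c
  have hfx : ∀ j g, f (Pi.single (CosetIndex.mk j g) 1) = ρ g (x j) := fun j g => by rw [hf, he]
  have hfree' : ∀ (n : N) (i : CosetIndex K), n • i = i → n = 1 := by
    intro n i h
    obtain ⟨j, g, rfl⟩ := i.exists_mk
    have h1 : (CosetIndex.mk j ((n : G) * g) : CosetIndex K) = CosetIndex.mk j g := h
    obtain ⟨-, h2⟩ := CosetIndex.mk_eq_mk.1 h1.symm
    rw [← Subgroup.mem_center_iff.1 (hN n.2) g, inv_mul_cancel_left] at h2
    obtain ⟨h3, h4⟩ := (hK j n).1 h2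
    obtain ⟨h5, h6⟩ := hNH j n n.2
    exact ψ.injective ((h6.symm.trans h4).trans (map_one ψ).symm)
  refine isPermutationLattice_of_null hρ e he0 heρ f hf ?_
  refine bijective_of_trace (by rw [← hcard, Nat.card_eq_fintype_card]) (isProfiniteModule_pi _)
    (permRep N p (CosetIndex K)) hρ.isProfiniteModule (ρ.comp N.subtype) hθ f
    (fun n c => hfρ n c) (fun z => ?_)
    (fun c hc n => permRep_eq_of_map_eq_zero hcard hρ hK hNH hl hl1 hlc f hfx hc n)
    (exists_sum_permRep_eq hfree')
  obtain ⟨c, hc⟩ := exists_proj_eq hρ hdense f hfρ (fun j g => ⟨_, hfx j g⟩)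
    (FixedQuotient.proj ρ hN ψ z)
  refine ⟨c, fun n => ?_⟩
  exact (proj_eq_zero ρ hN ψ).1 (by rw [map_sub, hc, sub_self]) n n.2
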